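/- For real $a>0$, $c$ and $z>0$ let $$U(a,c,z)=\frac1{\Gamma(a)}\int_0^\infty e^{-zt}t^{a-1}(1+t)^{c-a-1}\,dt$$ be the Kummer function, and $\widetilde U(a,c,z)=z^{a}U(a,c,z)$. For $a,b,z>0$ put $$\alpha=\frac az,\quad \beta=\frac bz,\quad \mu=\beta-\alpha,\quad \tau=\frac{2}{\beta+1+\sqrt{(\beta+1)^2-4\mu}},\quad t_0=\mu\tau,$$ $$\mathcal A=\mu(\tau-\ln\tau-1)-\alpha\ln(1-\mu\tau).$$ Let $\phi(t)=t-\alpha\ln(1-t)-\mu\ln|t|$ and $\psi(s)=s-\mu\ln|s|$ (for $\mu=0$ the terms $\mu\ln|\cdot|$ are $0$), and for $s$ near $\mu$ let $t=t(s)<1$ be the solution of $\phi(t)-\phi(t_0)=\psi(s)-\psi(\mu)$ with $\operatorname{sign}(t-t_0)=\operatorname{sign}(s-\mu)$ and $\operatorname{sign} t=\operatorname{sign} s$. Put $p(s)=\frac st\frac{dt}{ds}$ (extended by its limit to $s=\mu$), and define functions $p_n(s)$ by $$p_0(s)=p(s),\qquad p_{n+1}(s)=s\,\frac{d}{ds}\,\frac{p_n(s)-p_n(\mu)}{s-\mu},$$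 and $\widetilde p_n(\mu)=p_n(\mu)/p_0(\mu)$. The coefficients $p_n(\mu)$, $\widetilde p_n(\mu)$ depend on $\alpha$ and $\beta$. Then the asymptotic expansions $$U(a,b+1,z)\sim e^{z\mathcal A}z^{-a}\sum_{n=0}^\infty(-1)^n\frac{p_n(\mu)}{z^n},\qquad \widetilde U(a,b+1,z)\sim e^{z\mathcal A}p_0(\mu)\sum_{n=0}^\infty(-1)^n\frac{\widetilde p_n(\mu)}{z^n}, \qquad z\to\infty,$$ with $$p_0(\mu)=\frac{1-\mu\tau}{\sqrt{\beta\mu\tau^2-2\mu\tau+1}}>0,$$ hold uniformly for $b\ge a\ge a_0$ with $t_0\le\rho$, as well as for $b_0\le b\le a$, where $a_0>0$, $b_0>0$ and $\rho\in(0,1)$ are fixed. That is, for all $a_0,b_0>0$, $\rho\in(0,1)$ and every integer $N\ge0$ there are $C>0$ and $z_0>0$ such that for all $z\ge z_0$ and all $a,b$ with ($a_0\le a\le b$ and $t_0\le\rho$) or $b_0\le b\le a$, $$\Bigl|U(a,b+1,z)-e^{z\mathcal A}z^{-a}\sum_{n=0}^{N}(-1)^n\frac{p_n(\mu)}{z^n}\Bigr|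 \le C\,\frac{e^{z\mathcal A}z^{-a}}{z^{N+1}},$$ $$\Bigl|\widetilde U(a,b+1,z)-e^{z\mathcal A}p_0(\mu)\sum_{n=0}^{N}(-1)^n\frac{\widetilde p_n(\mu)}{z^n}\Bigr| \le C\,\frac{e^{z\mathcal A}p_0(\mu)}{z^{N+1}}.$$ -/

import Mathlib

open Set Filter Topology MeasureTheory

noncomputable section

namespace KummerU

/-- The Kummer function `U(a, c, z)` for real `a > 0`, `c` and `z > 0`, through its Laplace integral
`U(a, c, z) = (1 / Γ(a)) ∫_0^∞ e^{-z t} t^{a-1} (1+t)^{c-a-1} dt`,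
which converges for all these parameters. -/
def U (a c z : ℝ) : ℝ :=
  1 / Real.Gamma a *
    ∫ t in Ioi (0 : ℝ), Real.exp (-(z * t)) * t ^ (a - 1) * (1 + t) ^ (c - a - 1)

/-- The scaled function `z^a U(a, c, z)`. -/
def scaledU (a c z : ℝ) : ℝ := z ^ a * U a c z

/-- The uniformity parameter `μ = β - α`, where `α = a / z` and `β = b / z`. -/
def mu (α β : ℝ) : ℝ := β - α

/-- The quantity `τ = t₀ / μ`, in the form that is regular at `μ = 0`. -/
def tau (α β : ℝ) : ℝ := 2 / (β + 1 + √((β + 1) ^ 2 - 4 * mu α β))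

/-- The saddle point `t₀ = μ τ`. It lies in `(0, 1)` for `μ > 0`, and `t₀ ≤ 0` for `μ ≤ 0`. -/
def t0 (α β : ℝ) : ℝ := mu α β * tau α β

/-- The exponent `A` of the front factor `e^{z A}`; it is `φ(t₀) - ψ(μ)` in a form that is
regular at `μ = 0`. -/
def expA (α β : ℝ) : ℝ :=
  mu α β * (tau α β - Real.log (tau α β) - 1) - α * Real.log (1 - mu α β * tau α β)

/-- The phase function `φ(t) = t - α log (1 - t) - μ log |t|`, for `t < 1`. -/
def phi (α β t : ℝ) : ℝ := t - α * Real.log (1 - t) - mu α β * Real.log t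

/-- The model phase function `ψ(s) = s - μ log |s|`. -/
def psi (α β s : ℝ) : ℝ := s - mu α β * Real.log s

/-- The relation between `s` and `t` defined by `φ(t) - φ(t₀) = ψ(s) - ψ(μ)` and the condition
`sign (t - t₀) = sign (s - μ)`, on the branch `t < 1`, `sign t = sign s`. For `μ > 0` it is
a bijection of `s ∈ (0, ∞)` and `t ∈ (0, 1)`, for `μ < 0` of `s ∈ (-∞, 0)` and
`t ∈ (-∞, 0)`, for `μ = 0` of `s ∈ (-∞, ∞)` and `t ∈ (-∞, 1)`. -/
def Corresponds (α β s t : ℝ) : Prop :=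
  t < 1 ∧ SignType.sign t = SignType.sign s ∧
    SignType.sign (t - t0 α β) = SignType.sign (s - mu α β) ∧
    phi α β t - phi α β (t0 α β) = psi α β s - psi α β (mu α β)

/-- The transformation `s ↦ t(s)`. -/
def tOf (α β s : ℝ) : ℝ := Classical.epsilon (Corresponds α β s)

/-- The function `p(s) = (s / t) dt/ds`, extended by its limit to the point `s = μ`
(this matters only if `μ = 0`, where the quotient `s / t` is `0 / 0` at `s = 0`). -/
def p (α β : ℝ) : ℝ → ℝ :=
  Function.update (fun s => s / tOf α β s * deriv (tOf α β) s) (mu α β)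
    (limUnder (𝓝[≠] (mu α β)) fun s => s / tOf α β s * deriv (tOf α β) s)

/-- The functions `p_n(s)` of the integration by parts procedure:
`p_0 = p` and `p_{n+1}(s) = s (d/ds) ((p_n(s) - p_n(μ)) / (s - μ))`. -/
def pFun (α β : ℝ) : ℕ → ℝ → ℝ
  | 0 => p α β
  | n + 1 => fun s => s * deriv (dslope (pFun α β n) (mu α β)) s

/-- The coefficients `p_n(μ)` of the expansion. -/
def coeff (α β : ℝ) (n : ℕ) : ℝ := pFun α β n (mu α β)

/-- The normalized coefficients `p_n(μ) / p_0(μ)`. -/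
def normCoeff (α β : ℝ) (n : ℕ) : ℝ := coeff α β n / coeff α β 0

/-- The closed form `(1 - μ τ) / √(β μ τ² - 2 μ τ + 1)` of the first coefficient. -/
def firstCoeff (α β : ℝ) : ℝ :=
  (1 - mu α β * tau α β) /
    √(β * mu α β * tau α β ^ 2 - 2 * mu α β * tau α β + 1)

end KummerU

end

/-! The coefficients are not estimated through the transformation `t(s)`. A uniform expansion with
unknown coefficients is proved first, and the coefficients are identified afterwards.

Uniformity. Keep `a`, `b` fixed and let `z` grow, so that `(α, β)` moves along a ray to the origin,
where `z^a U → 1`. The logarithmic `z`-derivative of the Laplace integral is minus the mean of `u`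
under the integrand. Its phase has the critical points `g > 0` and `-h < 0`, with `t₀ = 1 - h`.
Repeated integration by parts on polynomials in `h / (u + h)` expands the mean about `g`
(`exists_mean_expansion`); the bounds need only `h ≥ η`, which persists along the ray
(`le_saddleH_div`). The first two terms are accounted for by `e^{zA} z^{-a}` and `p_0`. Integrating
the others from `z` to infinity gives `exists_logRatio_expansion`, and exponentiating gives
`exists_uniform_expansion`. Since `p_0` may be large, the errors must carry a factor `1 / p_0`; it
comes from `one_div_saddleH_le`.

Identification. For fixed `α`, `β` an asymptotic expansion is unique, so a non-uniform Laplace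
expansion with the coefficients `p_n(μ)` suffices. Use the critical points `x < 1 < y` of `φ` as
parameters. For `x < 0` the Kummer transformation gives an integral of `e^{zφ(t)} / t` over `t < 0`;
the substitution `t = t(s)` turns it into a gamma integral of `p`, up to exponentially small terms
(`exists_laplace_expansion`). For `0 < x < 1` this integral is not available. The original integral,
however, has the same form with the critical points `(1 - y, 1 - x)`, for every `x < 1`. For `x < 0`
both expansions hold, so their coefficients agree. With `y` fixed, both families are rational in the
derivative of `t(s)` at `μ`, so the equality extends to `0 < x < 1` (`coeff_reflect`). For `μ = 0`
the function and all coefficients are explicit. -/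

noncomputable section

namespace KummerU


/-! ### Integrals against the Laplace weight -/

/-- The integrand of the Laplace integral of the Kummer function. -/
def weight (a m z u : ℝ) : ℝ := Real.exp (-(z * u)) * u ^ (a - 1) * (1 + u) ^ m

lemma U_eq_integral_weight (a b z : ℝ) :
    U a (b + 1) z = 1 / Real.Gamma a * ∫ u in Ioi (0 : ℝ), weight a (b - a) z u := by
  simp only [U, weight]
  rw [show b + 1 - a - 1 = b - a by ring]

/-- Raise `1 + u ≤ d⁻¹ e^{d(1+u)}` to the power `|m|`, with `d` so small that `d|m| ≤ δ`. -/
lemma one_add_rpow_le (m : ℝ) {δ : ℝ} (hδ : 0 < δ) :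
    ∃ K > 0, ∀ u : ℝ, 0 ≤ u → (1 + u) ^ m ≤ K * Real.exp (δ * u) := by
  set d := δ / (|m| + 1) with hd
  have hm : 0 < |m| + 1 := by positivity
  have hd0 : 0 < d := by positivity
  refine ⟨(1 / d) ^ |m| * Real.exp δ, by positivity, fun u hu => ?_⟩
  have h1 : (1 + u) ^ m ≤ (1 + u) ^ |m| :=
    Real.rpow_le_rpow_of_exponent_le (by linarith) (le_abs_self m)
  have h2 : 1 + u ≤ 1 / d * Real.exp (d * (1 + u)) := by
    rw [div_mul_eq_mul_div, one_mul, le_div_iff₀ hd0, mul_comm]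
    linarith [Real.add_one_le_exp (d * (1 + u))]
  have h3 : (1 + u) ^ |m| ≤ (1 / d * Real.exp (d * (1 + u))) ^ |m| :=
    Real.rpow_le_rpow (by linarith) h2 (abs_nonneg m)
  rw [Real.mul_rpow (by positivity) (Real.exp_pos _).le, ← Real.exp_mul] at h3
  have h4 : d * (1 + u) * |m| ≤ δ + δ * u := by
    have : d * |m| ≤ δ := by
      rw [hd, div_mul_eq_mul_div, div_le_iff₀ hm]; nlinarith
    nlinarith
  calc (1 + u) ^ m ≤ _ := h1.trans h3
    _ ≤ (1 / d) ^ |m| * Real.exp (δ + δ * u) := by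
      gcongr
    _ = _ := by rw [Real.exp_add]; ring

lemma weight_pos {a m z u : ℝ} (hu : 0 < u) : 0 < weight a m z u := by
  unfold weight; positivity

lemma continuousOn_weight (a m z : ℝ) : ContinuousOn (weight a m z) (Ioi 0) := by
  intro u hu
  have hu : 0 < u := hu
  unfold weight
  refine ContinuousAt.continuousWithinAt ?_
  refine ContinuousAt.mul (ContinuousAt.mul (by fun_prop) ?_) ?_
  · exact Real.continuousAt_rpow_const _ _ (Or.inl hu.ne')
  · exact ContinuousAt.rpow_const (by fun_prop) (Or.inl (by positivity))

lemma integrableOn_rpow_mul_exp {a b : ℝ} (ha : 0 < a) (hb : 0 < b) :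
    IntegrableOn (fun u : ℝ => u ^ (a - 1) * Real.exp (-(b * u))) (Ioi 0) := by
  have := integrableOn_rpow_mul_exp_neg_mul_rpow (s := a - 1) (p := 1) (b := b) (by linarith)
    one_pos hb
  simpa using this

/-- Half of the exponential decay absorbs `(1 + u)^m`. The majorant is the same for all `z ≥ z₁`, as
differentiation under the integral requires. -/
lemma weight_le (a m : ℝ) {z₁ : ℝ} (hz : 0 < z₁) :
    ∃ K > 0, ∀ u z : ℝ, 0 < u → z₁ ≤ z →
      weight a m z u ≤ K * (u ^ (a - 1) * Real.exp (-(z₁ / 2 * u))) := by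
  obtain ⟨K, hK, h⟩ := one_add_rpow_le m (half_pos hz)
  refine ⟨K, hK, fun u z hu hzz => ?_⟩
  have h1 := h u hu.le
  unfold weight
  calc _ ≤ Real.exp (-(z₁ * u)) * u ^ (a - 1) * (K * Real.exp (z₁ / 2 * u)) := by
        gcongr
    _ = K * (u ^ (a - 1) * (Real.exp (-(z₁ * u)) * Real.exp (z₁ / 2 * u))) := by ring
    _ = _ := by rw [← Real.exp_add]; ring_nf

lemma integrableOn_weight {a m z : ℝ} (ha : 0 < a) (hz : 0 < z) :
    IntegrableOn (weight a m z) (Ioi 0) := by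
  obtain ⟨K, hK, h⟩ := weight_le a m hz
  refine Integrable.mono' ((integrableOn_rpow_mul_exp ha (half_pos hz)).const_mul K)
    ((continuousOn_weight a m z).aestronglyMeasurable measurableSet_Ioi) ?_
  refine (ae_restrict_iff' measurableSet_Ioi).2 (Eventually.of_forall fun u hu => ?_)
  rw [Real.norm_of_nonneg (weight_pos hu).le]
  exact h u z hu le_rfl

lemma integral_weight_pos {a m z : ℝ} (ha : 0 < a) (hz : 0 < z) :
    0 < ∫ u in Ioi (0 : ℝ), weight a m z u := by
  rw [setIntegral_pos_iff_support_of_nonneg_ae]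
  · have : Ioi (0 : ℝ) ⊆ Function.support (weight a m z) ∩ Ioi 0 := fun u hu =>
      ⟨(weight_pos hu).ne', hu⟩
    refine lt_of_lt_of_le ?_ (measure_mono this)
    simp
  · refine (ae_restrict_iff' measurableSet_Ioi).2 (Eventually.of_forall fun u hu => ?_)
    exact (weight_pos hu).le
  · exact integrableOn_weight ha hz

lemma weight_add_one {a m z u : ℝ} (hu : 0 < u) :
    weight (a + 1) m z u = u * weight a m z u := by
  unfold weight
  rw [show a + 1 - 1 = (a - 1) + 1 by ring, Real.rpow_add hu, Real.rpow_one]; ring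

lemma hasDerivAt_integral_weight {a m z : ℝ} (ha : 0 < a) (hz : 0 < z) :
    HasDerivAt (fun z => ∫ u in Ioi (0 : ℝ), weight a m z u)
      (-∫ u in Ioi (0 : ℝ), weight (a + 1) m z u) z := by
  obtain ⟨K, hK, h⟩ := weight_le (a + 1) m (half_pos hz)
  rw [← integral_neg]
  refine (hasDerivAt_integral_of_dominated_loc_of_deriv_le (s := Ioi (z / 2))
    (F := fun z u => weight a m z u) (F' := fun z u => -weight (a + 1) m z u)
    (bound := fun u => K * (u ^ (a + 1 - 1) * Real.exp (-(z / 2 / 2 * u))))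
    (Ioi_mem_nhds (half_lt_self hz)) ?_ ?_ ?_ ?_ ?_ ?_).2
  · exact Eventually.of_forall fun x =>
      (continuousOn_weight a m x).aestronglyMeasurable measurableSet_Ioi
  · exact integrableOn_weight ha hz
  · exact (continuousOn_weight _ _ _).neg.aestronglyMeasurable measurableSet_Ioi
  · refine (ae_restrict_iff' measurableSet_Ioi).2 (Eventually.of_forall fun u hu x hx => ?_)
    rw [norm_neg, Real.norm_of_nonneg (weight_pos hu).le]
    exact h u x hu (le_of_lt hx)
  · exact (integrableOn_rpow_mul_exp (by linarith) (by positivity)).const_mul K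
  · refine (ae_restrict_iff' measurableSet_Ioi).2 (Eventually.of_forall fun u hu x hx => ?_)
    rw [weight_add_one hu]
    have : HasDerivAt (fun x : ℝ => Real.exp (-(x * u))) (Real.exp (-(x * u)) * (-u)) x := by
      have h0 : HasDerivAt (fun x : ℝ => -(x * u)) (-u) x := by
        simpa using ((hasDerivAt_id x).mul_const u).fun_neg
      exact h0.exp
    have := (this.mul_const (u ^ (a - 1))).mul_const ((1 + u) ^ m)
    unfold weight
    refine this.congr_deriv ?_
    ring

/-- A bounded continuous function is integrable against the weight. -/
lemma integrableOn_weight_mul {a m z K : ℝ} (ha : 0 < a) (hz : 0 < z) {r : ℝ → ℝ}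
    (hr : ContinuousOn r (Ioi 0)) (hK : ∀ u, 0 < u → |r u| ≤ K) :
    IntegrableOn (fun u => weight a m z u * r u) (Ioi 0) := by
  refine Integrable.mono' ((integrableOn_weight (m := m) ha hz).const_mul K)
    (((continuousOn_weight a m z).mul hr).aestronglyMeasurable measurableSet_Ioi) ?_
  refine (ae_restrict_iff' measurableSet_Ioi).2 (Eventually.of_forall fun u hu => ?_)
  rw [norm_mul, Real.norm_of_nonneg (weight_pos hu).le, mul_comm]
  exact mul_le_mul_of_nonneg_right (hK u hu) (weight_pos hu).le

/-- Integrate the derivative of `e^{-zu} u^a (1+u)^m B(u)`, which vanishes at both ends. The new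
factor is `-u` times the logarithmic derivative of `e^{-zu} u^a (1+u)^m`, hence zero at the saddle
point. -/
lemma integral_weight_by_parts {a m z K : ℝ} (ha : 0 < a) (hz : 0 < z) {B B' : ℝ → ℝ}
    (hB : ∀ u, 0 ≤ u → HasDerivAt B (B' u) u) (hB' : ContinuousOn B' (Ioi 0))
    (hK : ∀ u, 0 < u → |B u| ≤ K) (hK' : ∀ u, 0 < u → |u * B' u| ≤ K) :
    ∫ u in Ioi (0 : ℝ), weight a m z u * (u * B' u) =
      ∫ u in Ioi (0 : ℝ), weight a m z u * ((z * u - a - m * (u / (1 + u))) * B u) := by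
  have hBc : ContinuousOn B (Ioi 0) := fun u hu =>
    (hB u (le_of_lt hu)).continuousAt.continuousWithinAt
  have i1 : IntegrableOn (fun u => weight a m z u * (u * B' u)) (Ioi 0) :=
    integrableOn_weight_mul ha hz (continuousOn_id.mul hB') hK'
  have i2 : IntegrableOn (fun u => weight a m z u * ((z * u - a - m * (u / (1 + u))) * B u))
      (Ioi 0) := by
    have j1 := (integrableOn_weight_mul (a := a + 1) (m := m) (by linarith) hz hBc hK).const_mul z
    have hc : ContinuousOn (fun u => (-a - m * (u / (1 + u))) * B u) (Ioi 0) := by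
      refine ContinuousOn.mul ?_ hBc
      refine ContinuousOn.sub continuousOn_const (ContinuousOn.mul continuousOn_const ?_)
      exact ContinuousOn.div continuousOn_id (by fun_prop) fun u hu => by
        have : (0 : ℝ) < u := hu
        positivity
    have j2 := integrableOn_weight_mul (a := a) (m := m) (K := (|a| + |m|) * K) ha hz hc (by
      intro u hu
      rw [abs_mul]
      have h1 : |(-a - m * (u / (1 + u)))| ≤ |a| + |m| := by
        have h2 : |u / (1 + u)| ≤ 1 := by
          rw [abs_of_pos (by positivity), div_le_one (by positivity)]; linarith
        calc _ ≤ |-a| + |m * (u / (1 + u))| := abs_sub _ _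
          _ ≤ |a| + |m| * 1 := by
            rw [abs_neg, abs_mul]; gcongr
          _ = _ := by ring
      exact mul_le_mul h1 (hK u hu) (abs_nonneg _) (by positivity))
    refine IntegrableOn.congr_fun (j1.add j2) (fun u hu => ?_) measurableSet_Ioi
    simp only [Pi.add_apply]
    rw [weight_add_one hu]; ring
  have hd : ∀ u ∈ Ioi (0 : ℝ), HasDerivAt
      (fun u => Real.exp (-(z * u)) * u ^ a * (1 + u) ^ m * B u)
      (weight a m z u * (u * B' u) -
        weight a m z u * ((z * u - a - m * (u / (1 + u))) * B u)) u := by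
    intro u hu
    have hu : 0 < u := hu
    have h1 : HasDerivAt (fun u : ℝ => Real.exp (-(z * u))) (Real.exp (-(z * u)) * (-z)) u := by
      have h0 : HasDerivAt (fun u : ℝ => -(z * u)) (-z) u := by
        simpa using ((hasDerivAt_id u).const_mul z).fun_neg
      exact h0.exp
    have h2 : HasDerivAt (fun u : ℝ => u ^ a) (a * u ^ (a - 1)) u :=
      Real.hasDerivAt_rpow_const (Or.inl hu.ne')
    have h3 : HasDerivAt (fun u : ℝ => (1 + u) ^ m) (m * (1 + u) ^ (m - 1)) u := by
      have := ((hasDerivAt_id u).const_add 1).rpow_const (p := m)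
        (Or.inl (by simp; positivity))
      simpa using this
    have h4 := ((h1.fun_mul h2).fun_mul h3).fun_mul (hB u hu.le)
    refine h4.congr_deriv ?_
    simp only [weight]
    have e1 : u ^ a = u ^ (a - 1) * u := by
      rw [← Real.rpow_add_one hu.ne']; ring_nf
    have e2 : (1 + u) ^ m = (1 + u) ^ (m - 1) * (1 + u) := by
      rw [← Real.rpow_add_one (by positivity)]; ring_nf
    rw [e1, e2]
    have : (1 + u) ≠ 0 := by positivity
    field_simp
    ring
  have key := integral_Ioi_of_hasDerivAt_of_tendsto (a := (0 : ℝ)) (m := 0)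
    (f := fun u => Real.exp (-(z * u)) * u ^ a * (1 + u) ^ m * B u) ?_ hd (i1.sub i2) ?_
  · rw [integral_sub i1 i2] at key
    simp only [Real.zero_rpow ha.ne', mul_zero, zero_mul, sub_zero] at key
    linarith
  · refine ContinuousWithinAt.mul (ContinuousWithinAt.mul (ContinuousWithinAt.mul ?_ ?_) ?_) ?_
    · fun_prop
    · exact (Real.continuousAt_rpow_const _ _ (Or.inr ha.le)).continuousWithinAt
    · exact (ContinuousAt.rpow_const (by fun_prop) (Or.inl (by norm_num))).continuousWithinAt
    · exact (hB 0 le_rfl).continuousAt.continuousWithinAt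
  · obtain ⟨M, hM, h⟩ := weight_le (a + 1) m hz
    have hlim : Tendsto (fun u : ℝ => M * K * (u ^ a * Real.exp (-(z / 2) * u))) atTop (𝓝 0) := by
      simpa using (tendsto_rpow_mul_exp_neg_mul_atTop_nhds_zero a (z / 2) (half_pos hz)).const_mul
        (M * K)
    refine squeeze_zero_norm' ?_ hlim
    filter_upwards [eventually_gt_atTop 0] with u hu
    have h1 := h u z hu le_rfl
    rw [norm_mul, Real.norm_of_nonneg (by positivity), Real.norm_eq_abs]
    simp only [weight, add_sub_cancel_right] at h1
    calc _ ≤ (M * (u ^ a * Real.exp (-(z / 2 * u)))) * K :=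
          mul_le_mul h1 (hK u hu) (abs_nonneg _) (by positivity)
      _ = _ := by ring_nf

lemma integral_rpow_mul_exp {a b : ℝ} (ha : 0 < a) (hb : 0 < b) :
    ∫ u in Ioi (0 : ℝ), u ^ (a - 1) * Real.exp (-(b * u)) = Real.Gamma a * b ^ (-a) := by
  rw [Real.integral_rpow_mul_exp_neg_mul_Ioi ha hb, one_div, Real.inv_rpow hb.le,
    Real.rpow_neg hb.le, mul_comm]

/-- Substitute `w = z u` and use dominated convergence. This supplies the value at infinity for the
integration along rays. -/
lemma tendsto_rpow_mul_integral_weight {a m : ℝ} (ha : 0 < a) :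
    Tendsto (fun z => z ^ a * ∫ u in Ioi (0 : ℝ), weight a m z u) atTop
      (𝓝 (Real.Gamma a)) := by
  obtain ⟨K, hK, h⟩ := one_add_rpow_le |m| (half_pos one_pos)
  have h1 : Tendsto (fun z : ℝ => ∫ w in Ioi (0 : ℝ),
      w ^ (a - 1) * Real.exp (-w) * (1 + w / z) ^ m) atTop
      (𝓝 (∫ w in Ioi (0 : ℝ), w ^ (a - 1) * Real.exp (-w))) := by
    refine tendsto_integral_filter_of_dominated_convergence
      (fun w => K * (w ^ (a - 1) * Real.exp (-(1 / 2 * w)))) ?_ ?_ ?_ ?_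
    · filter_upwards [eventually_gt_atTop 0] with z hz
      refine ContinuousOn.aestronglyMeasurable (fun w hw => ?_) measurableSet_Ioi
      have hw : 0 < w := hw
      refine ContinuousAt.continuousWithinAt ?_
      refine ContinuousAt.mul (ContinuousAt.mul ?_ (by fun_prop)) ?_
      · exact Real.continuousAt_rpow_const _ _ (Or.inl hw.ne')
      · exact ContinuousAt.rpow_const (by fun_prop) (Or.inl (by positivity))
    · filter_upwards [eventually_ge_atTop 1] with z hz
      refine (ae_restrict_iff' measurableSet_Ioi).2 (Eventually.of_forall fun w hw => ?_)
      have hw : 0 < w := hw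
      rw [Real.norm_of_nonneg (by positivity)]
      have e1 : (1 + w / z) ^ m ≤ K * Real.exp (1 / 2 * w) := by
        calc (1 + w / z) ^ m ≤ (1 + w / z) ^ |m| :=
              Real.rpow_le_rpow_of_exponent_le (by simp; positivity) (le_abs_self m)
          _ ≤ (1 + w) ^ |m| := by
              refine Real.rpow_le_rpow (by positivity) ?_ (abs_nonneg m)
              have : w / z ≤ w := div_le_self hw.le hz
              linarith
          _ ≤ _ := h w hw.le
      calc _ ≤ w ^ (a - 1) * Real.exp (-w) * (K * Real.exp (1 / 2 * w)) := by gcongr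
        _ = K * (w ^ (a - 1) * (Real.exp (-w) * Real.exp (1 / 2 * w))) := by ring
        _ = _ := by rw [← Real.exp_add]; ring_nf
    · exact (integrableOn_rpow_mul_exp ha (by norm_num)).const_mul K
    · refine (ae_restrict_iff' measurableSet_Ioi).2 (Eventually.of_forall fun w hw => ?_)
      have e1 : Tendsto (fun z : ℝ => 1 + w / z) atTop (𝓝 (1 + 0)) :=
        tendsto_const_nhds.add (tendsto_const_nhds.div_atTop tendsto_id)
      have e2 := e1.rpow_const (p := m) (Or.inl (by norm_num))
      simpa using e2.const_mul (w ^ (a - 1) * Real.exp (-w))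
  have h2 : ∫ w in Ioi (0 : ℝ), w ^ (a - 1) * Real.exp (-w) = Real.Gamma a := by
    have := integral_rpow_mul_exp ha one_pos
    simpa using this
  rw [h2] at h1
  refine h1.congr' ?_
  filter_upwards [eventually_gt_atTop 0] with z hz
  have := integral_comp_mul_left_Ioi (fun w => w ^ (a - 1) * Real.exp (-w) * (1 + w / z) ^ m) 0 hz
  rw [mul_zero, smul_eq_mul] at this
  have h3 : ∫ u in Ioi (0 : ℝ), (z * u) ^ (a - 1) * Real.exp (-(z * u)) * (1 + z * u / z) ^ m =
      z ^ (a - 1) * ∫ u in Ioi (0 : ℝ), weight a m z u := by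
    rw [← integral_const_mul]
    refine setIntegral_congr_fun measurableSet_Ioi fun u hu => ?_
    have hu : 0 < u := hu
    simp only [weight]
    rw [Real.mul_rpow hz.le hu.le, mul_div_cancel_left₀ _ hz.ne']; ring
  rw [h3] at this
  have e : z ^ a = z ^ (a - 1) * z := by rw [← Real.rpow_add_one hz.ne']; ring_nf
  rw [e, mul_right_comm, this, mul_comm z⁻¹, mul_assoc, inv_mul_cancel₀ hz.ne', mul_one]

/-- The Kummer transformation `U(a, c, z) = z ^ (1 - c) U(a - c + 1, 2 - c, z)` for integrals. -/
lemma integral_weight_kummer {a a' z : ℝ} (ha : 0 < a) (ha' : 0 < a') (hz : 0 < z) :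
    Real.Gamma a' * ∫ u in Ioi (0 : ℝ), weight a (-a') z u =
      Real.Gamma a * (z ^ (a' - a) * ∫ u in Ioi (0 : ℝ), weight a' (-a) z u) := by
  -- Integrating out `x` produces `Γ(a') (1+t)^(-a')`, integrating out `t` produces `Γ(a)
  -- (z+x)^(-a)`. Fubini then gives the transformation, after the rescaling `x = z u`.
  set F : ℝ → ℝ → ℝ := fun t x =>
    (t ^ (a - 1) * Real.exp (-(z * t))) * (x ^ (a' - 1) * Real.exp (-((1 + t) * x))) with hF
  have hsymm : ∀ t x : ℝ, F t x =
      (x ^ (a' - 1) * Real.exp (-x)) * (t ^ (a - 1) * Real.exp (-((z + x) * t))) := by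
    intro t x
    have : Real.exp (-(z * t)) * Real.exp (-((1 + t) * x)) =
        Real.exp (-x) * Real.exp (-((z + x) * t)) := by
      rw [← Real.exp_add, ← Real.exp_add]; ring_nf
    simp only [hF]
    linear_combination (t ^ (a - 1) * x ^ (a' - 1)) * this
  have inner1 : ∀ t ∈ Ioi (0 : ℝ), ∫ x in Ioi (0 : ℝ), F t x =
      Real.Gamma a' * weight a (-a') z t := by
    intro t ht
    have ht : 0 < t := ht
    simp only [hF]
    rw [integral_const_mul, integral_rpow_mul_exp ha' (by positivity), weight]; ring
  have inner2 : ∀ x ∈ Ioi (0 : ℝ), ∫ t in Ioi (0 : ℝ), F t x =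
      Real.Gamma a * ((x ^ (a' - 1) * Real.exp (-x)) * (z + x) ^ (-a)) := by
    intro x hx
    have hx : 0 < x := hx
    simp only [hsymm]
    rw [integral_const_mul, integral_rpow_mul_exp ha (by positivity)]; ring
  have hcont : ContinuousOn (Function.uncurry F) (Ioi 0 ×ˢ Ioi 0) := by
    rintro ⟨t, x⟩ ⟨ht, hx⟩
    have ht : 0 < t := ht
    have hx : 0 < x := hx
    refine ContinuousAt.continuousWithinAt ?_
    simp only [hF, Function.uncurry_def]
    refine ContinuousAt.mul (ContinuousAt.mul ?_ (by fun_prop)) (ContinuousAt.mul ?_ (by fun_prop))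
    · exact ContinuousAt.rpow_const (by fun_prop) (Or.inl ht.ne')
    · exact ContinuousAt.rpow_const (by fun_prop) (Or.inl hx.ne')
  have hint : Integrable (Function.uncurry F)
      ((volume.restrict (Ioi (0 : ℝ))).prod (volume.restrict (Ioi (0 : ℝ)))) := by
    have hm : AEStronglyMeasurable (Function.uncurry F)
        ((volume.restrict (Ioi (0 : ℝ))).prod (volume.restrict (Ioi (0 : ℝ)))) := by
      rw [Measure.prod_restrict]
      exact hcont.aestronglyMeasurable (measurableSet_Ioi.prod measurableSet_Ioi)
    rw [integrable_prod_iff hm]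
    constructor
    · refine (ae_restrict_iff' measurableSet_Ioi).2 (Eventually.of_forall fun t ht => ?_)
      have ht : 0 < t := ht
      exact (integrableOn_rpow_mul_exp ha' (b := 1 + t) (by positivity)).const_mul
        (t ^ (a - 1) * Real.exp (-(z * t)))
    · have : IntegrableOn (fun t => Real.Gamma a' * weight a (-a') z t) (Ioi 0) :=
        (integrableOn_weight ha hz).const_mul _
      refine this.congr_fun (fun t ht => ?_) measurableSet_Ioi
      refine (inner1 t ht).symm.trans ?_
      refine setIntegral_congr_fun measurableSet_Ioi fun x hx => ?_
      have ht : 0 < t := ht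
      have hx : 0 < x := hx
      simp only [Function.uncurry_apply_pair]
      rw [Real.norm_of_nonneg]
      simp only [hF]; positivity
  have hswap := integral_integral_swap hint
  rw [setIntegral_congr_fun measurableSet_Ioi inner1,
    setIntegral_congr_fun measurableSet_Ioi inner2, integral_const_mul, integral_const_mul] at hswap
  rw [hswap]
  congr 1
  have := integral_comp_mul_left_Ioi
    (fun x => (x ^ (a' - 1) * Real.exp (-x)) * (z + x) ^ (-a)) 0 hz
  rw [mul_zero, smul_eq_mul] at this
  have h3 : ∫ u in Ioi (0 : ℝ), ((z * u) ^ (a' - 1) * Real.exp (-(z * u))) * (z + z * u) ^ (-a) =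
      z ^ (a' - 1 + (-a)) * ∫ u in Ioi (0 : ℝ), weight a' (-a) z u := by
    rw [← integral_const_mul]
    refine setIntegral_congr_fun measurableSet_Ioi fun u hu => ?_
    have hu : 0 < u := hu
    simp only [weight]
    rw [show z + z * u = z * (1 + u) by ring, Real.mul_rpow hz.le hu.le,
      Real.mul_rpow hz.le (by positivity), Real.rpow_add hz]; ring
  rw [h3] at this
  rw [show a' - a = (a' - 1 + -a) + 1 by ring, Real.rpow_add_one hz.ne']
  field_simp at this
  linarith


/-! ### The critical points as parameters, and closed forms in terms of them -/

/-- The saddle point `g > 0` of the integrand of the Laplace integral. -/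
def saddleG (α β : ℝ) : ℝ := (β - 1 + √((1 - β) ^ 2 + 4 * α)) / 2

/-- The opposite `h > 0` of the negative critical point of the integrand. -/
def saddleH (α β : ℝ) : ℝ := (1 - β + √((1 - β) ^ 2 + 4 * α)) / 2

lemma saddleG_sub_saddleH (α β : ℝ) : saddleG α β - saddleH α β = β - 1 := by
  unfold saddleG saddleH; ring

lemma saddleG_mul_saddleH {α : ℝ} (hα : 0 < α) (β : ℝ) : saddleG α β * saddleH α β = α := by
  unfold saddleG saddleH
  have := Real.sq_sqrt (show 0 ≤ (1 - β) ^ 2 + 4 * α by positivity)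
  linear_combination this / 4

lemma abs_lt_sqrt_disc {α : ℝ} (hα : 0 < α) (β : ℝ) : |1 - β| < √((1 - β) ^ 2 + 4 * α) := by
  rw [← Real.sqrt_sq_eq_abs]
  exact Real.sqrt_lt_sqrt (sq_nonneg _) (by linarith)

lemma saddleG_pos {α : ℝ} (hα : 0 < α) (β : ℝ) : 0 < saddleG α β := by
  have := (abs_lt.1 (abs_lt_sqrt_disc hα β)).2
  unfold saddleG; linarith

lemma saddleH_pos {α : ℝ} (hα : 0 < α) (β : ℝ) : 0 < saddleH α β := by
  have := (abs_lt.1 (abs_lt_sqrt_disc hα β)).1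
  unfold saddleH; linarith

/-- The parameter `α` as a function of the two critical points `x`, `y` of the phase. -/
def alphaOf (x y : ℝ) : ℝ := (1 - x) * (y - 1)

/-- The parameter `β` as a function of the two critical points `x`, `y` of the phase. -/
def betaOf (x y : ℝ) : ℝ := x + y - 1

lemma alphaOf_saddle {α : ℝ} (hα : 0 < α) (β : ℝ) :
    alphaOf (1 - saddleH α β) (1 + saddleG α β) = α := by
  have := saddleG_mul_saddleH hα β
  unfold alphaOf; linarith

lemma betaOf_saddle (α β : ℝ) : betaOf (1 - saddleH α β) (1 + saddleG α β) = β := by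
  have := saddleG_sub_saddleH α β
  unfold betaOf; linarith

lemma mu_param (x y : ℝ) : mu (alphaOf x y) (betaOf x y) = x * y := by
  unfold mu alphaOf betaOf; ring

/-- The discriminant becomes the square `(y - x)^2`, so the root disappears in the parameters `x`,
`y`. -/
lemma tau_param {x y : ℝ} (h : x < y) : tau (alphaOf x y) (betaOf x y) = 1 / y := by
  unfold tau
  rw [mu_param, show (betaOf x y + 1) ^ 2 - 4 * (x * y) = (y - x) ^ 2 by unfold betaOf; ring,
    Real.sqrt_sq (by linarith), show betaOf x y + 1 + (y - x) = 2 * y by unfold betaOf; ring]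
  rw [div_mul_eq_div_div, div_self two_ne_zero]

lemma t0_param {x y : ℝ} (h : x < y) (hy : 0 < y) : t0 (alphaOf x y) (betaOf x y) = x := by
  unfold t0
  rw [mu_param, tau_param h]; field_simp

lemma expA_param {x y : ℝ} (h : x < y) (hy : 0 < y) :
    expA (alphaOf x y) (betaOf x y) =
      x - x * y + x * y * Real.log y - alphaOf x y * Real.log (1 - x) := by
  unfold expA
  rw [mu_param, tau_param h, one_div, Real.log_inv]
  have : x * y * y⁻¹ = x := by field_simp
  rw [this]
  linear_combination this

lemma firstCoeff_param {x y : ℝ} (h : x < y) (hy : 0 < y) (hx : x < 1) :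
    firstCoeff (alphaOf x y) (betaOf x y) = √(y * (1 - x) / (y - x)) := by
  unfold firstCoeff
  rw [mu_param, tau_param h]
  have h1 : 1 - x * y * (1 / y) = 1 - x := by field_simp
  have h2 : betaOf x y * (x * y) * (1 / y) ^ 2 - 2 * (x * y) * (1 / y) + 1 =
      (y - x) * (1 - x) / y := by
    unfold betaOf; field_simp; ring
  have hx1 : 0 < 1 - x := by linarith
  have hyx : 0 < y - x := by linarith
  rw [h1, h2]
  rw [div_eq_iff (by positivity), ← Real.sqrt_mul (by positivity)]
  rw [show y * (1 - x) / (y - x) * ((y - x) * (1 - x) / y) = (1 - x) ^ 2 by field_simp]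
  rw [Real.sqrt_sq hx1.le]

lemma expA_saddle {α : ℝ} (hα : 0 < α) (β : ℝ) :
    expA α β = (1 - saddleH α β) * (Real.log (1 + saddleG α β) * (1 + saddleG α β)
      - saddleG α β) - α * Real.log (saddleH α β) := by
  have hg := saddleG_pos hα β
  have hh := saddleH_pos hα β
  have := expA_param (x := 1 - saddleH α β) (y := 1 + saddleG α β) (by linarith) (by linarith)
  rw [alphaOf_saddle hα, betaOf_saddle] at this
  rw [this]; ring_nf

lemma firstCoeff_saddle {α : ℝ} (hα : 0 < α) (β : ℝ) :
    firstCoeff α β = √((1 + saddleG α β) * saddleH α β / (saddleG α β + saddleH α β)) := by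
  have hg := saddleG_pos hα β
  have hh := saddleH_pos hα β
  have := firstCoeff_param (x := 1 - saddleH α β) (y := 1 + saddleG α β) (by linarith)
    (by linarith) (by linarith)
  rw [alphaOf_saddle hα, betaOf_saddle] at this
  rw [this]; ring_nf

lemma firstCoeff_pos {α : ℝ} (hα : 0 < α) (β : ℝ) : 0 < firstCoeff α β := by
  have hg := saddleG_pos hα β
  have hh := saddleH_pos hα β
  rw [firstCoeff_saddle hα]; positivity

lemma t0_saddle {α : ℝ} (hα : 0 < α) (β : ℝ) : t0 α β = 1 - saddleH α β := by
  have hg := saddleG_pos hα β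
  have hh := saddleH_pos hα β
  have := t0_param (x := 1 - saddleH α β) (y := 1 + saddleG α β) (by linarith) (by linarith)
  rwa [alphaOf_saddle hα, betaOf_saddle] at this

/-! ### Averages with respect to the weight -/

open Polynomial in
/-- Up to powers of `h`, the functions that arise from `u - g` by repeated integration by parts
against the weight, as polynomials in `h / (u + h)`; the coefficients are continuous functions of
`ξ = h / (g + h)` and `κ = (1 - h) / h`. -/
def avgPoly : ℕ → C(ℝ × ℝ, ℝ)[X]
  | 0 => -C ContinuousMap.snd * X * (1 - X)
  | n + 1 => X * (1 - X) * derivative ((1 + C ContinuousMap.snd * X) * X * C ContinuousMap.fst *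
      (avgPoly n /ₘ (X - C ContinuousMap.fst)))

/-- Evaluation of continuous functions of two variables at a point. -/
def evalAt (θ : ℝ × ℝ) : C(ℝ × ℝ, ℝ) →+* ℝ :=
  (Pi.evalRingHom (fun _ => ℝ) θ).comp ContinuousMap.coeFnRingHom

@[simp] lemma evalAt_apply (θ : ℝ × ℝ) (f : C(ℝ × ℝ, ℝ)) : evalAt θ f = f θ := rfl

open Polynomial in
lemma avgPoly_map_zero (ξ κ : ℝ) :
    (avgPoly 0).map (evalAt (ξ, κ)) = -C κ * X * (1 - X) := by
  simp [avgPoly]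

open Polynomial in
lemma avgPoly_map_succ (n : ℕ) (ξ κ : ℝ) :
    ∃ Q : ℝ[X], (avgPoly n).map (evalAt (ξ, κ)) =
      (X - C ξ) * Q + C (((avgPoly n).map (evalAt (ξ, κ))).eval ξ) ∧
      (avgPoly (n + 1)).map (evalAt (ξ, κ)) =
        X * (1 - X) * derivative ((1 + C κ * X) * X * C ξ * Q) := by
  refine ⟨(avgPoly n /ₘ (X - C ContinuousMap.fst)).map (evalAt (ξ, κ)), ?_, ?_⟩
  · have h := modByMonic_add_div (avgPoly n) (X - C (ContinuousMap.fst : C(ℝ × ℝ, ℝ)))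
    rw [modByMonic_X_sub_C_eq_C_eval] at h
    have h2 := congrArg (Polynomial.map (evalAt (ξ, κ))) h
    simp only [Polynomial.map_add, Polynomial.map_mul, Polynomial.map_sub, Polynomial.map_X,
      Polynomial.map_C] at h2
    have h3 : ((avgPoly n).map (evalAt (ξ, κ))).eval ξ =
        evalAt (ξ, κ) ((avgPoly n).eval ContinuousMap.fst) := by
      rw [Polynomial.eval_map, ← Polynomial.eval₂_at_apply]; rfl
    rw [h3, add_comm]
    exact h2.symm
  · rw [avgPoly]
    simp [← Polynomial.derivative_map]

open Polynomial in
-- The coefficients are continuous in `(ξ, κ)` and hence bounded on a compact rectangle. This is the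
-- purpose of taking polynomials over a ring of continuous functions.
lemma avgPoly_bound (n : ℕ) (K : ℝ) : ∃ C > 0, ∀ ξ κ x : ℝ, 0 ≤ ξ → ξ ≤ 1 → |κ| ≤ K →
    0 ≤ x → x ≤ 1 → |((avgPoly n).map (evalAt (ξ, κ))).eval x| ≤ C := by
  have hcpt : IsCompact (Icc (0 : ℝ) 1 ×ˢ Icc (-K) K) := isCompact_Icc.prod isCompact_Icc
  have hb : ∀ i : ℕ, ∃ C : ℝ, ∀ θ ∈ Icc (0 : ℝ) 1 ×ˢ Icc (-K) K, ‖(avgPoly n).coeff i θ‖ ≤ C :=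
    fun i => hcpt.exists_bound_of_continuousOn ((avgPoly n).coeff i).continuous.continuousOn
  choose B hB using hb
  refine ⟨∑ i ∈ Finset.range ((avgPoly n).natDegree + 1), |B i| + 1, by positivity,
    fun ξ κ x h0 h1 hκ hx0 hx1 => ?_⟩
  have hθ : (ξ, κ) ∈ Icc (0 : ℝ) 1 ×ˢ Icc (-K) K := ⟨⟨h0, h1⟩, abs_le.1 hκ⟩
  rw [Polynomial.eval_map, Polynomial.eval₂_eq_sum_range]
  refine (Finset.abs_sum_le_sum_abs _ _).trans ?_
  refine (Finset.sum_le_sum fun i _ => ?_).trans (le_add_of_nonneg_right zero_le_one)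
  rw [abs_mul, abs_of_nonneg (pow_nonneg hx0 i)]
  calc _ ≤ |B i| * 1 := by
        refine mul_le_mul ((hB i _ hθ).trans (le_abs_self _)) (pow_le_one₀ hx0 hx1)
          (pow_nonneg hx0 i) (abs_nonneg _)
    _ = _ := mul_one _

/-- The parameters of a weight with critical points `g` and `-h`. -/
structure IsSaddle (a m z g h : ℝ) : Prop where
  a_pos : 0 < a
  z_pos : 0 < z
  g_pos : 0 < g
  h_pos : 0 < h
  a_eq : a = z * (g * h)
  m_eq : m = z * ((1 + g) * (1 - h))

lemma isSaddle {a z : ℝ} (ha : 0 < a) (b : ℝ) (hz : 0 < z) :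
    IsSaddle a (b - a) z (saddleG (a / z) (b / z)) (saddleH (a / z) (b / z)) := by
  have hα : 0 < a / z := by positivity
  have h1 := saddleG_mul_saddleH hα (b / z)
  have h2 := saddleG_sub_saddleH (a / z) (b / z)
  refine ⟨ha, hz, saddleG_pos hα _, saddleH_pos hα _, ?_, ?_⟩
  · rw [h1]; field_simp
  · have : (1 + saddleG (a / z) (b / z)) * (1 - saddleH (a / z) (b / z)) = (b - a) / z := by
      rw [sub_div]; linarith
    rw [this]; field_simp

open Polynomial in
-- Integration by parts with `B(u) = p(X)`, `X = h / (u + h)`. Here `u dX/du = -X(1 - X)`, and the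
-- logarithmic factor is `z(u - g)(u + h)/(1 + u)`.
lemma IsSaddle.integral_derivative {a m z g h : ℝ} (S : IsSaddle a m z g h) (p : ℝ[X]) :
    ∫ u in Ioi (0 : ℝ), weight a m z u *
        (h / (u + h) * (1 - h / (u + h)) * (derivative p).eval (h / (u + h))) =
      ∫ u in Ioi (0 : ℝ), weight a m z u *
        (-z * ((u - g) * ((u + h) / (1 + u)) * p.eval (h / (u + h)))) := by
  have hh := S.h_pos
  have hX : ∀ u : ℝ, 0 ≤ u → HasDerivAt (fun u => h / (u + h)) (-h / (u + h) ^ 2) u := by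
    intro u hu
    have : u + h ≠ 0 := by positivity
    have h1 := (hasDerivAt_const u h).fun_div ((hasDerivAt_id u).add_const h) this
    refine h1.congr_deriv ?_
    simp
  have hx0 : ∀ u : ℝ, 0 ≤ u → 0 ≤ h / (u + h) ∧ h / (u + h) ≤ 1 := by
    intro u hu
    refine ⟨by positivity, ?_⟩
    rw [div_le_one (by positivity)]; linarith
  have hpb : ∀ q : ℝ[X], ∃ K : ℝ, ∀ u, 0 < u → |q.eval (h / (u + h))| ≤ K := by
    intro q
    obtain ⟨K, hK⟩ := (isCompact_Icc (a := (0 : ℝ)) (b := 1)).exists_bound_of_continuousOn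
      q.continuous.continuousOn
    exact ⟨K, fun u hu => hK _ (hx0 u hu.le)⟩
  obtain ⟨K₁, hK₁⟩ := hpb p
  obtain ⟨K₂, hK₂⟩ := hpb (X * (1 - X) * derivative p)
  have hrel : ∀ u : ℝ, 0 < u → u * ((derivative p).eval (h / (u + h)) * (-h / (u + h) ^ 2)) =
      -(X * (1 - X) * derivative p).eval (h / (u + h)) := by
    intro u hu
    have : u + h ≠ 0 := by positivity
    simp only [eval_mul, eval_X, eval_sub, eval_one]
    field_simp
    ring
  have key := integral_weight_by_parts (m := m) (K := max K₁ K₂) S.a_pos S.z_pos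
    (B := fun u => p.eval (h / (u + h)))
    (B' := fun u => (derivative p).eval (h / (u + h)) * (-h / (u + h) ^ 2)) ?_ ?_ ?_ ?_
  · have e : ∀ f : ℝ → ℝ, ∫ u in Ioi (0 : ℝ), f u = -∫ u in Ioi (0 : ℝ), -f u := by
      intro f; rw [integral_neg, neg_neg]
    rw [e, e (fun u => weight a m z u *
        (-z * ((u - g) * ((u + h) / (1 + u)) * p.eval (h / (u + h)))))]
    congr 1
    refine Eq.trans (setIntegral_congr_fun measurableSet_Ioi fun u hu => ?_)
      (key.trans (setIntegral_congr_fun measurableSet_Ioi fun u hu => ?_))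
    · rw [hrel u hu]
      simp
    · have hu : 0 < u := hu
      rw [S.a_eq, S.m_eq]
      have : 1 + u ≠ 0 := by positivity
      field_simp
      ring
  · intro u hu
    exact (p.hasDerivAt _).comp u (hX u hu)
  · intro u hu
    have hu : 0 < u := hu
    have : u + h ≠ 0 := by positivity
    refine ContinuousAt.continuousWithinAt ?_
    have hc : ContinuousAt (fun u => h / (u + h)) u := (hX u hu.le).continuousAt
    refine ContinuousAt.mul ?_ ?_
    · exact ContinuousAt.comp (f := fun u => h / (u + h)) (derivative p).continuous.continuousAt hc
    · exact ContinuousAt.div (by fun_prop) (by fun_prop) (by positivity)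
  · exact fun u hu => (hK₁ u hu).trans (le_max_left _ _)
  · intro u hu
    rw [hrel u hu, abs_neg]
    exact (hK₂ u hu).trans (le_max_right _ _)

open Polynomial in
lemma integrableOn_weight_eval {a m z h : ℝ} (ha : 0 < a) (hz : 0 < z) (hh : 0 < h)
    (p : ℝ[X]) : IntegrableOn (fun u => weight a m z u * p.eval (h / (u + h))) (Ioi 0) := by
  obtain ⟨K, hK⟩ := (isCompact_Icc (a := (0 : ℝ)) (b := 1)).exists_bound_of_continuousOn
    p.continuous.continuousOn
  refine integrableOn_weight_mul ha hz (K := K) ?_ ?_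
  · refine p.continuous.comp_continuousOn (ContinuousOn.div continuousOn_const (by fun_prop) ?_)
    intro u hu
    have hu : 0 < u := hu
    positivity
  · intro u hu
    refine hK _ ⟨by positivity, ?_⟩
    rw [div_le_one (by positivity)]; linarith

/-- The coefficients in the expansion of the logarithmic derivative of the scaled function. -/
def avgCoeff (n : ℕ) (α β : ℝ) : ℝ :=
  ((avgPoly n).map (evalAt (saddleH α β / (saddleG α β + saddleH α β),
    (1 - saddleH α β) / saddleH α β))).eval (saddleH α β / (saddleG α β + saddleH α β)) /
    saddleH α β ^ n

open Polynomial in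
-- With `κ = (1 - h)/h` the polynomial `1 + κX` equals `(1 + u)/(u + h)`, so it cancels the extra
-- factor and leaves `u - g`.
lemma IsSaddle.integral_mul_id {a m z g h : ℝ} (S : IsSaddle a m z g h) :
    ∫ u in Ioi (0 : ℝ), weight (a + 1) m z u = g * (∫ u in Ioi (0 : ℝ), weight a m z u) +
      1 / z * ∫ u in Ioi (0 : ℝ), weight a m z u *
        ((avgPoly 0).map (evalAt (h / (g + h), (1 - h) / h))).eval (h / (u + h)) := by
  have hh := S.h_pos
  have key := S.integral_derivative (1 + C ((1 - h) / h) * X)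
  have e1 : ∫ u in Ioi (0 : ℝ), weight a m z u *
      (h / (u + h) * (1 - h / (u + h)) *
        (derivative (1 + C ((1 - h) / h) * X : ℝ[X])).eval (h / (u + h))) =
      -∫ u in Ioi (0 : ℝ), weight a m z u *
        ((avgPoly 0).map (evalAt (h / (g + h), (1 - h) / h))).eval (h / (u + h)) := by
    rw [← integral_neg]
    refine setIntegral_congr_fun measurableSet_Ioi fun u hu => ?_
    have hd : derivative (1 + C ((1 - h) / h) * X : ℝ[X]) = C ((1 - h) / h) := by simp
    simp only [avgPoly_map_zero, hd, eval_mul, eval_neg, eval_C, eval_X, eval_sub, eval_one]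
    ring
  have i1 := integrableOn_weight (a := a + 1) (m := m) (by linarith [S.a_pos]) S.z_pos
  have i0 := integrableOn_weight (m := m) S.a_pos S.z_pos
  have e2 : ∫ u in Ioi (0 : ℝ), weight a m z u *
      (-z * ((u - g) * ((u + h) / (1 + u)) * (1 + C ((1 - h) / h) * X : ℝ[X]).eval (h / (u + h))))
      = -z * ((∫ u in Ioi (0 : ℝ), weight (a + 1) m z u) -
        g * ∫ u in Ioi (0 : ℝ), weight a m z u) := by
    rw [← integral_const_mul g, ← integral_sub i1 (i0.const_mul g), ← integral_const_mul]
    refine setIntegral_congr_fun measurableSet_Ioi fun u hu => ?_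
    have hu : 0 < u := hu
    rw [weight_add_one hu]
    have : (u + h) / (1 + u) * (1 + C ((1 - h) / h) * X : ℝ[X]).eval (h / (u + h)) = 1 := by
      have : u + h ≠ 0 := by positivity
      have : 1 + u ≠ 0 := by positivity
      simp
      field_simp
      ring
    rw [mul_assoc (u - g), this]; ring
  rw [e1, e2] at key
  have hz := S.z_pos
  field_simp
  linarith

open Polynomial in
-- Split off the value at the saddle, `X = ξ`. The rest is divisible by `X - ξ = -(u - g) X ξ / h`,
-- so one more integration by parts applies and gains `1/(zh)`.
lemma IsSaddle.integral_avgPoly {a m z g h : ℝ} (S : IsSaddle a m z g h) (n : ℕ) :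
    ∫ u in Ioi (0 : ℝ), weight a m z u *
        ((avgPoly n).map (evalAt (h / (g + h), (1 - h) / h))).eval (h / (u + h)) =
      ((avgPoly n).map (evalAt (h / (g + h), (1 - h) / h))).eval (h / (g + h)) *
        (∫ u in Ioi (0 : ℝ), weight a m z u) +
      1 / (z * h) * ∫ u in Ioi (0 : ℝ), weight a m z u *
        ((avgPoly (n + 1)).map (evalAt (h / (g + h), (1 - h) / h))).eval (h / (u + h)) := by
  have hh := S.h_pos
  have hg := S.g_pos
  have hz := S.z_pos
  obtain ⟨Q, hQ1, hQ2⟩ := avgPoly_map_succ n (h / (g + h)) ((1 - h) / h)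
  set P := (avgPoly n).map (evalAt (h / (g + h), (1 - h) / h)) with hP
  set c := P.eval (h / (g + h)) with hc
  have key := S.integral_derivative ((1 + C ((1 - h) / h) * X) * X * C (h / (g + h)) * Q)
  have e1 : ∫ u in Ioi (0 : ℝ), weight a m z u *
      (h / (u + h) * (1 - h / (u + h)) * (derivative
        ((1 + C ((1 - h) / h) * X) * X * C (h / (g + h)) * Q)).eval (h / (u + h))) =
      ∫ u in Ioi (0 : ℝ), weight a m z u *
        ((avgPoly (n + 1)).map (evalAt (h / (g + h), (1 - h) / h))).eval (h / (u + h)) := by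
    refine setIntegral_congr_fun measurableSet_Ioi fun u hu => ?_
    simp only [hQ2]
    congr 1
    rw [eval_mul (p := X * (1 - X))]
    simp
  have i1 := integrableOn_weight_eval (m := m) S.a_pos hz hh P
  have i0 := integrableOn_weight (m := m) S.a_pos S.z_pos
  have e2 : ∫ u in Ioi (0 : ℝ), weight a m z u *
      (-z * ((u - g) * ((u + h) / (1 + u)) *
        ((1 + C ((1 - h) / h) * X) * X * C (h / (g + h)) * Q).eval (h / (u + h)))) =
      z * h * ((∫ u in Ioi (0 : ℝ), weight a m z u * P.eval (h / (u + h))) -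
        c * ∫ u in Ioi (0 : ℝ), weight a m z u) := by
    rw [← integral_const_mul c, ← integral_sub i1 (i0.const_mul c), ← integral_const_mul]
    refine setIntegral_congr_fun measurableSet_Ioi fun u hu => ?_
    have hu : 0 < u := hu
    have hPu : P.eval (h / (u + h)) = (h / (u + h) - h / (g + h)) * Q.eval (h / (u + h)) + c := by
      conv_lhs => rw [hQ1]
      simp
    rw [hPu]
    have : u + h ≠ 0 := by positivity
    have : 1 + u ≠ 0 := by positivity
    have : g + h ≠ 0 := by positivity
    simp only [eval_mul, eval_add, eval_one, eval_C, eval_X]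
    field_simp
    ring
  rw [e1, e2] at key
  rw [key]
  field_simp
  ring

lemma IsSaddle.integral_expansion {a m z g h : ℝ} (S : IsSaddle a m z g h) (n : ℕ) :
    ∫ u in Ioi (0 : ℝ), weight (a + 1) m z u =
      (g + ∑ j ∈ Finset.range n,
        ((avgPoly j).map (evalAt (h / (g + h), (1 - h) / h))).eval (h / (g + h)) / h ^ j /
          z ^ (j + 1)) * (∫ u in Ioi (0 : ℝ), weight a m z u) +
      1 / h ^ n / z ^ (n + 1) * ∫ u in Ioi (0 : ℝ), weight a m z u *
        ((avgPoly n).map (evalAt (h / (g + h), (1 - h) / h))).eval (h / (u + h)) := by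
  have hh := S.h_pos
  have hz := S.z_pos
  induction n with
  | zero => rw [S.integral_mul_id]; simp
  | succ n ih =>
    rw [ih, S.integral_avgPoly n, Finset.sum_range_succ]
    field_simp
    ring

lemma saddle_ratio_mem {g h : ℝ} (hg : 0 < g) (hh : 0 < h) :
    0 ≤ h / (g + h) ∧ h / (g + h) ≤ 1 := by
  refine ⟨by positivity, ?_⟩
  rw [div_le_one (by positivity)]; linarith

/-- The lower bound on `h`, that is, `t₀` staying away from `1`, confines `κ` to a compact interval.
-/
lemma abs_saddle_kappa_le {η h : ℝ} (hη : 0 < η) (hη1 : η ≤ 1) (hh : η ≤ h) :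
    |(1 - h) / h| ≤ 1 / η := by
  have h0 : 0 < h := by linarith
  have h1 : 1 ≤ 1 / η := by rw [le_div_iff₀ hη]; linarith
  have h2 : 1 / h ≤ 1 / η := one_div_le_one_div_of_le hη hh
  rw [sub_div, div_self h0.ne', abs_le]
  constructor
  · have : 0 < 1 / h := by positivity
    linarith
  · linarith

lemma exists_avgCoeff_bound (n : ℕ) {η : ℝ} (hη : 0 < η) (hη1 : η ≤ 1) :
    ∃ C > 0, ∀ α β : ℝ, 0 < α → η ≤ saddleH α β →
      |avgCoeff n α β| ≤ C / saddleH α β ^ n := by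
  obtain ⟨C, hC, hb⟩ := avgPoly_bound n (1 / η)
  refine ⟨C, hC, fun α β hα hh => ?_⟩
  have h0 : 0 < saddleH α β := by linarith
  obtain ⟨h1, h2⟩ := saddle_ratio_mem (saddleG_pos hα β) h0
  unfold avgCoeff
  rw [abs_div, abs_of_pos (pow_pos h0 n)]
  gcongr
  exact hb _ _ _ h1 h2 (abs_saddle_kappa_le hη hη1 hh) h1 h2

/-- Expansion of the mean value of `u`, uniform in the parameters. -/
lemma exists_mean_expansion (n : ℕ) {η : ℝ} (hη : 0 < η) (hη1 : η ≤ 1) :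
    ∃ C > 0, ∀ a b z : ℝ, 0 < a → 0 < z → η ≤ saddleH (a / z) (b / z) →
      |(∫ u in Ioi (0 : ℝ), weight (a + 1) (b - a) z u) / (∫ u in Ioi (0 : ℝ), weight a (b - a) z u)
        - (saddleG (a / z) (b / z) + ∑ j ∈ Finset.range n,
          avgCoeff j (a / z) (b / z) / z ^ (j + 1))| ≤
      C / saddleH (a / z) (b / z) ^ n / z ^ (n + 1) := by
  obtain ⟨C, hC, hb⟩ := avgPoly_bound n (1 / η)
  refine ⟨C, hC, fun a b z ha hz hh => ?_⟩
  have S := isSaddle ha b hz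
  have hI := integral_weight_pos (m := b - a) ha hz
  have hg0 := S.g_pos
  have hh0 := S.h_pos
  rw [S.integral_expansion n]
  set g := saddleG (a / z) (b / z)
  set h := saddleH (a / z) (b / z)
  set I := ∫ u in Ioi (0 : ℝ), weight a (b - a) z u
  obtain ⟨h1, h2⟩ := saddle_ratio_mem hg0 hh0
  -- The weight is positive and `h / (u + h)` lies in `[0, 1]`, so the mean of the last polynomial
  -- obeys its uniform bound.
  have hbd : |∫ u in Ioi (0 : ℝ), weight a (b - a) z u *
        ((avgPoly n).map (evalAt (h / (g + h), (1 - h) / h))).eval (h / (u + h))| ≤ C * I := by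
    rw [← integral_const_mul]
    refine (Real.norm_eq_abs _).symm.le.trans
      (norm_integral_le_of_norm_le ((integrableOn_weight ha hz).const_mul C) ?_)
    refine (ae_restrict_iff' measurableSet_Ioi).2 (Eventually.of_forall fun u hu => ?_)
    rw [norm_mul, Real.norm_of_nonneg (weight_pos hu).le, mul_comm]
    refine mul_le_mul_of_nonneg_right ?_ (weight_pos hu).le
    obtain ⟨h3, h4⟩ := saddle_ratio_mem hu hh0
    exact hb _ _ _ h1 h2 (abs_saddle_kappa_le hη hη1 hh) h3 h4
  rw [add_div, mul_div_assoc, div_self hI.ne', mul_one]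
  have : ∀ j, avgCoeff j (a / z) (b / z) =
      ((avgPoly j).map (evalAt (h / (g + h), (1 - h) / h))).eval (h / (g + h)) / h ^ j :=
    fun j => rfl
  simp only [this]
  rw [add_sub_cancel_left, abs_div, abs_mul, abs_of_pos hI, div_le_iff₀ hI, abs_of_pos (by positivity)]
  calc _ ≤ 1 / h ^ n / z ^ (n + 1) * (C * I) := by gcongr
    _ = _ := by ring


/-! ### The saddle points along rays -/

/-- The quadratic has the roots `h` and `-g`; comparisons with `h` thus become polynomial
inequalities. -/
lemma le_saddleH_iff {α β X : ℝ} (hα : 0 < α) (hX : 0 ≤ X) :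
    X ≤ saddleH α β ↔ X ^ 2 - (1 - β) * X - α ≤ 0 := by
  have h1 := saddleG_mul_saddleH hα β
  have h2 := saddleG_sub_saddleH α β
  have hg := saddleG_pos hα β
  have : X ^ 2 - (1 - β) * X - α = (X - saddleH α β) * (X + saddleG α β) := by
    linear_combination h1 - X * h2
  rw [this]
  constructor
  · intro h
    exact mul_nonpos_of_nonpos_of_nonneg (by linarith) (by linarith)
  · intro h
    by_contra hc
    push Not at hc
    have : 0 < (X - saddleH α β) * (X + saddleG α β) := mul_pos (by linarith) (by linarith)
    linarith

/-- Along the ray the quadratic at `η` is `(η² - η) + (βη - α)/l`. The first term is nonpositive,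
and a positive second term only decreases with `l`. -/
lemma le_saddleH_div {α β η l : ℝ} (hα : 0 < α) (hη : 0 < η) (hη1 : η ≤ 1)
    (h : η ≤ saddleH α β) (hl : 1 ≤ l) : η ≤ saddleH (α / l) (β / l) := by
  have hl0 : 0 < l := by linarith
  rw [le_saddleH_iff hα hη.le] at h
  rw [le_saddleH_iff (by positivity) hη.le]
  have e : η ^ 2 - (1 - β / l) * η - α / l = (η ^ 2 - η) + (β * η - α) / l := by ring
  rw [e]
  have h1 : η ^ 2 - η ≤ 0 := by nlinarith
  rcases le_total (β * η - α) 0 with h2 | h2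
  · have : (β * η - α) / l ≤ 0 := div_nonpos_of_nonpos_of_nonneg h2 hl0.le
    linarith
  · have : (β * η - α) / l ≤ β * η - α := div_le_self h2 hl
    linarith

/-- At `h/l` the quadratic of the scaled parameters equals `-(h + α)/l · (1 - 1/l) ≤ 0`. -/
lemma saddleH_le_mul {α l : ℝ} (hα : 0 < α) (β : ℝ) (hl : 1 ≤ l) :
    saddleH α β ≤ l * saddleH (α / l) (β / l) := by
  have hl0 : 0 < l := by linarith
  have hh := saddleH_pos hα β
  have h1 := saddleG_mul_saddleH hα β
  have h2 := saddleG_sub_saddleH α β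
  have : saddleH α β / l ≤ saddleH (α / l) (β / l) := by
    rw [le_saddleH_iff (by positivity) (by positivity)]
    have e : (saddleH α β / l) ^ 2 - (1 - β / l) * (saddleH α β / l) - α / l =
        -((saddleH α β + α) / l * (1 - 1 / l)) := by
      field_simp
      linear_combination (-saddleH α β) * h2 + h1
    rw [e, neg_nonpos]
    have : 0 ≤ 1 - 1 / l := by
      rw [sub_nonneg, div_le_one hl0]; exact hl
    positivity
  rwa [div_le_iff₀' hl0] at this

lemma firstCoeff_sq {α : ℝ} (hα : 0 < α) (β : ℝ) : firstCoeff α β ^ 2 =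
    (1 + saddleG α β) * saddleH α β / (saddleG α β + saddleH α β) := by
  have hg := saddleG_pos hα β
  have hh := saddleH_pos hα β
  rw [firstCoeff_saddle hα, Real.sq_sqrt (by positivity)]

/-- The square `(h·1 + g·h)/(g + h)` is a weighted mean of `1` and `h`; the lower bound in
`le_firstCoeff_sq` has the same reason. -/
lemma firstCoeff_sq_le {α : ℝ} (hα : 0 < α) (β : ℝ) :
    firstCoeff α β ^ 2 ≤ max 1 (saddleH α β) := by
  have hg := saddleG_pos hα β
  have hh := saddleH_pos hα β
  rw [firstCoeff_sq hα, div_le_iff₀ (by positivity)]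
  rcases le_total 1 (saddleH α β) with h | h
  · rw [max_eq_right h]; nlinarith
  · rw [max_eq_left h]; nlinarith

lemma le_firstCoeff_sq {α β η : ℝ} (hα : 0 < α) (hη1 : η ≤ 1)
    (h : η ≤ saddleH α β) : η ≤ firstCoeff α β ^ 2 := by
  have hg := saddleG_pos hα β
  have hh := saddleH_pos hα β
  rw [firstCoeff_sq hα, le_div_iff₀ (by positivity)]
  rcases le_total 1 (saddleH α β) with h1 | h1
  · nlinarith
  · nlinarith

/-- Multiply `η p_0² ≤ l h_l` by `η ≤ h_l` and take the root, where `h_l` belongs to the scaled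
parameters. The bound gains `1 / p_0` at the price of `√l`, which remains integrable against
`l^{-2}`. -/
lemma one_div_saddleH_le {α β η l : ℝ} (hα : 0 < α) (hη : 0 < η) (hη1 : η ≤ 1)
    (h : η ≤ saddleH α β) (hl : 1 ≤ l) :
    1 / saddleH (α / l) (β / l) ≤ √l / (η * firstCoeff α β) := by
  have hl0 : 0 < l := by linarith
  have h1 := le_saddleH_div hα hη hη1 h hl
  have h2 := saddleH_le_mul hα β hl
  have h3 := firstCoeff_sq_le hα β
  have hp := firstCoeff_pos hα β
  have hh : 0 < saddleH (α / l) (β / l) := by linarith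
  rw [div_le_div_iff₀ hh (by positivity), one_mul]
  refine abs_le_of_sq_le_sq' ?_ (by positivity) |>.2
  rw [mul_pow, mul_pow, Real.sq_sqrt hl0.le]
  have h4 : max 1 (saddleH α β) * η ≤ l * saddleH (α / l) (β / l) := by
    rcases le_total 1 (saddleH α β) with h5 | h5
    · rw [max_eq_right h5]; nlinarith
    · rw [max_eq_left h5]; nlinarith
  have h5 : firstCoeff α β ^ 2 * η ≤ l * saddleH (α / l) (β / l) :=
    (mul_le_mul_of_nonneg_right h3 hη.le).trans h4
  nlinarith [mul_le_mul h5 h1 hη.le (by positivity)]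

lemma hasDerivAt_saddleH_ray {a z : ℝ} (ha : 0 < a) (b : ℝ) (hz : 0 < z) :
    HasDerivAt (fun z => saddleH (a / z) (b / z))
      (saddleH (a / z) (b / z) * (1 - saddleH (a / z) (b / z)) /
        (saddleG (a / z) (b / z) + saddleH (a / z) (b / z)) / z) z := by
  have hα : 0 < a / z := by positivity
  have d : ∀ c : ℝ, HasDerivAt (fun z => c / z) (-(c / z) / z) z := fun c => by
    have := (hasDerivAt_const z c).fun_div (hasDerivAt_id z) hz.ne'
    refine this.congr_deriv ?_
    simp; field_simp
  have d1 : HasDerivAt (fun z => 1 - b / z) (b / z / z) z := by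
    refine ((d b).const_sub 1).congr_deriv ?_
    ring
  have d2 := (d1.fun_pow 2).fun_add ((d a).const_mul 4)
  have hpos : 0 < (1 - b / z) ^ 2 + 4 * (a / z) := by positivity
  have d3 := (d1.fun_add (d2.sqrt hpos.ne')).div_const 2
  refine (d3.congr_deriv ?_)
  have hs : √((1 - b / z) ^ 2 + 4 * (a / z)) =
      saddleG (a / z) (b / z) + saddleH (a / z) (b / z) := by
    unfold saddleG saddleH; ring
  have h1 := saddleG_mul_saddleH hα (b / z)
  have h2 := saddleG_sub_saddleH (a / z) (b / z)
  have hg := saddleG_pos hα (b / z)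
  have hh := saddleH_pos hα (b / z)
  have h3 : b / z = 1 + saddleG (a / z) (b / z) - saddleH (a / z) (b / z) := by linarith
  rw [hs]
  set g := saddleG (a / z) (b / z)
  set h := saddleH (a / z) (b / z)
  rw [h3, ← h1]
  have : g + h ≠ 0 := by positivity
  field_simp
  simp
  ring

lemma hasDerivAt_saddleG_ray {a z : ℝ} (ha : 0 < a) (b : ℝ) (hz : 0 < z) :
    HasDerivAt (fun z => saddleG (a / z) (b / z))
      (-(saddleG (a / z) (b / z) * (1 + saddleG (a / z) (b / z)) /
        (saddleG (a / z) (b / z) + saddleH (a / z) (b / z)) / z)) z := by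
  have hα : 0 < a / z := by positivity
  have d : HasDerivAt (fun z => b / z) (-(b / z) / z) z := by
    have := (hasDerivAt_const z b).fun_div (hasDerivAt_id z) hz.ne'
    refine this.congr_deriv ?_
    simp; field_simp
  have e : (fun z => saddleG (a / z) (b / z)) = fun z => saddleH (a / z) (b / z) + b / z - 1 := by
    ext z
    linarith [saddleG_sub_saddleH (a / z) (b / z)]
  have d2 := ((hasDerivAt_saddleH_ray ha b hz).fun_add d).sub_const 1
  rw [e]
  refine d2.congr_deriv ?_
  have h2 := saddleG_sub_saddleH (a / z) (b / z)
  have hg := saddleG_pos hα (b / z)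
  have hh := saddleH_pos hα (b / z)
  have h3 : b / z = 1 + saddleG (a / z) (b / z) - saddleH (a / z) (b / z) := by linarith
  set g := saddleG (a / z) (b / z)
  set h := saddleH (a / z) (b / z)
  have : g + h ≠ 0 := by positivity
  rw [h3]
  field_simp
  ring

lemma mul_expA_ray {a z : ℝ} (ha : 0 < a) (b : ℝ) (hz : 0 < z) :
    z * expA (a / z) (b / z) =
      (b - a) * (Real.log (1 + saddleG (a / z) (b / z)) -
        saddleG (a / z) (b / z) / (1 + saddleG (a / z) (b / z))) -
      a * Real.log (saddleH (a / z) (b / z)) := by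
  have hα : 0 < a / z := by positivity
  have S := isSaddle ha b hz
  have hg := S.g_pos
  rw [expA_saddle hα, S.m_eq]
  field_simp

/-- The value is `a/z - g`, because `a/z = gh`: exactly the leading part of the logarithmic
derivative of `z^a` times the Laplace integral. -/
lemma hasDerivAt_mul_expA_ray {a z : ℝ} (ha : 0 < a) (b : ℝ) (hz : 0 < z) :
    HasDerivAt (fun z => z * expA (a / z) (b / z))
      (-(saddleG (a / z) (b / z) * (1 - saddleH (a / z) (b / z)))) z := by
  have S := isSaddle ha b hz
  have hg := S.g_pos
  have hh := S.h_pos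
  have hG := hasDerivAt_saddleG_ray ha b hz
  have hH := hasDerivAt_saddleH_ray ha b hz
  have h1 : 1 + saddleG (a / z) (b / z) ≠ 0 := by positivity
  have d := (((hG.const_add 1).log h1).fun_sub (hG.fun_div (hG.const_add 1) h1)).const_mul (b - a)
    |>.fun_sub ((hH.log hh.ne').const_mul a)
  have e : (fun z => z * expA (a / z) (b / z)) =ᶠ[𝓝 z] fun z =>
      (b - a) * (Real.log (1 + saddleG (a / z) (b / z)) -
        saddleG (a / z) (b / z) / (1 + saddleG (a / z) (b / z))) -
      a * Real.log (saddleH (a / z) (b / z)) := by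
    filter_upwards [lt_mem_nhds hz] with x hx using mul_expA_ray ha b hx
  refine (d.congr_of_eventuallyEq e).congr_deriv ?_
  have ha' := S.a_eq
  have hm' := S.m_eq
  set g := saddleG (a / z) (b / z)
  set h := saddleH (a / z) (b / z)
  rw [hm', ha']
  have : g + h ≠ 0 := by positivity
  field_simp
  ring

lemma log_firstCoeff {α : ℝ} (hα : 0 < α) (β : ℝ) : Real.log (firstCoeff α β) =
    (Real.log (1 + saddleG α β) + Real.log (saddleH α β) -
      Real.log (saddleG α β + saddleH α β)) / 2 := by
  have hg := saddleG_pos hα β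
  have hh := saddleH_pos hα β
  rw [firstCoeff_saddle hα, Real.log_sqrt (by positivity), Real.log_div (by positivity)
    (by positivity), Real.log_mul (by positivity) (by positivity)]

lemma avgCoeff_zero {α : ℝ} (hα : 0 < α) (β : ℝ) : avgCoeff 0 α β =
    -(saddleG α β * (1 - saddleH α β) / (saddleG α β + saddleH α β) ^ 2) := by
  have hg := saddleG_pos hα β
  have hh := saddleH_pos hα β
  have : saddleG α β + saddleH α β ≠ 0 := by positivity
  unfold avgCoeff
  rw [avgPoly_map_zero]
  simp
  field_simp
  ring

/-- The factor `p_0` accounts for the first correction to the mean, so only the corrections of index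
at least `1` remain to be integrated. -/
lemma hasDerivAt_log_firstCoeff_ray {a z : ℝ} (ha : 0 < a) (b : ℝ) (hz : 0 < z) :
    HasDerivAt (fun z => Real.log (firstCoeff (a / z) (b / z)))
      (-(avgCoeff 0 (a / z) (b / z) / z)) z := by
  have S := isSaddle ha b hz
  have hg := S.g_pos
  have hh := S.h_pos
  have hG := hasDerivAt_saddleG_ray ha b hz
  have hH := hasDerivAt_saddleH_ray ha b hz
  have h1 : 1 + saddleG (a / z) (b / z) ≠ 0 := by positivity
  have h2 : saddleG (a / z) (b / z) + saddleH (a / z) (b / z) ≠ 0 := by positivity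
  have d := ((((hG.const_add 1).log h1).fun_add (hH.log hh.ne')).fun_sub
    ((hG.fun_add hH).log h2)).div_const 2
  have e : (fun z => Real.log (firstCoeff (a / z) (b / z))) =ᶠ[𝓝 z] fun z =>
      (Real.log (1 + saddleG (a / z) (b / z)) + Real.log (saddleH (a / z) (b / z)) -
      Real.log (saddleG (a / z) (b / z) + saddleH (a / z) (b / z))) / 2 := by
    filter_upwards [lt_mem_nhds hz] with x hx using log_firstCoeff (by positivity) _
  refine (d.congr_of_eventuallyEq e).congr_deriv ?_
  rw [avgCoeff_zero (by positivity)]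
  set g := saddleG (a / z) (b / z)
  set h := saddleH (a / z) (b / z)
  field_simp
  ring

lemma tendsto_saddle_ray (a b : ℝ) :
    Tendsto (fun z => saddleG (a / z) (b / z)) atTop (𝓝 0) ∧
    Tendsto (fun z => saddleH (a / z) (b / z)) atTop (𝓝 1) := by
  have t : ∀ c : ℝ, Tendsto (fun z : ℝ => c / z) atTop (𝓝 0) := fun c =>
    tendsto_const_nhds.div_atTop tendsto_id
  have t2 : Tendsto (fun z : ℝ => (a / z, b / z)) atTop (𝓝 (0, 0)) := (t a).prodMk_nhds (t b)
  constructor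
  · have c : Continuous fun p : ℝ × ℝ => saddleG p.1 p.2 := by
      unfold saddleG; fun_prop
    have := (c.tendsto (0, 0)).comp t2
    simpa [saddleG, Function.comp_def] using this
  · have c : Continuous fun p : ℝ × ℝ => saddleH p.1 p.2 := by
      unfold saddleH; fun_prop
    have := (c.tendsto (0, 0)).comp t2
    have e : saddleH 0 0 = 1 := by norm_num [saddleH]
    simpa [e, Function.comp_def] using this

/-! ### Logarithm of the quotient by the leading term -/

/-- The logarithm of the quotient of the scaled function and the leading term. -/
def logRatio (a b z : ℝ) : ℝ :=
  Real.log (z ^ a * (∫ u in Ioi (0 : ℝ), weight a (b - a) z u)) - Real.log (Real.Gamma a) -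
    z * expA (a / z) (b / z) - Real.log (firstCoeff (a / z) (b / z))

lemma exp_logRatio {a z : ℝ} (ha : 0 < a) (b : ℝ) (hz : 0 < z) :
    scaledU a (b + 1) z =
      Real.exp (z * expA (a / z) (b / z)) * firstCoeff (a / z) (b / z) *
        Real.exp (logRatio a b z) := by
  have hI := integral_weight_pos (m := b - a) ha hz
  have hp := firstCoeff_pos (α := a / z) (by positivity) (b / z)
  have hΓ := Real.Gamma_pos_of_pos ha
  unfold logRatio scaledU
  rw [Real.exp_sub, Real.exp_sub, Real.exp_sub, Real.exp_log (by positivity), Real.exp_log hΓ,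
    Real.exp_log hp, U_eq_integral_weight]
  have := Real.exp_pos (z * expA (a / z) (b / z))
  field_simp

/-- The logarithmic derivative of the integral is minus the mean of `u`; the term `a/z` from `z^a`
cancels the part `gh` of the derivative of `zA`. -/
lemma hasDerivAt_logRatio {a z : ℝ} (ha : 0 < a) (b : ℝ) (hz : 0 < z) :
    HasDerivAt (logRatio a b)
      (-((∫ u in Ioi (0 : ℝ), weight (a + 1) (b - a) z u) /
        (∫ u in Ioi (0 : ℝ), weight a (b - a) z u) -
        (saddleG (a / z) (b / z) + avgCoeff 0 (a / z) (b / z) / z))) z := by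
  have hI := integral_weight_pos (m := b - a) ha hz
  have S := isSaddle ha b hz
  have d1 := (Real.hasDerivAt_rpow_const (p := a) (Or.inl hz.ne')).fun_mul
    (hasDerivAt_integral_weight (m := b - a) ha hz)
  have d2 := ((d1.log (by positivity)).sub_const (Real.log (Real.Gamma a))).fun_sub
    (hasDerivAt_mul_expA_ray ha b hz) |>.fun_sub (hasDerivAt_log_firstCoeff_ray ha b hz)
  refine d2.congr_deriv ?_
  have e1 : z ^ a = z ^ (a - 1) * z := by rw [← Real.rpow_add_one hz.ne']; ring_nf
  have e2 : (a * z ^ (a - 1) * (∫ u in Ioi (0 : ℝ), weight a (b - a) z u) +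
      z ^ a * -∫ u in Ioi (0 : ℝ), weight (a + 1) (b - a) z u) /
      (z ^ a * ∫ u in Ioi (0 : ℝ), weight a (b - a) z u) =
      a / z - (∫ u in Ioi (0 : ℝ), weight (a + 1) (b - a) z u) /
        (∫ u in Ioi (0 : ℝ), weight a (b - a) z u) := by
    rw [e1]
    have : 0 < z ^ (a - 1) := by positivity
    field_simp
    ring
  rw [e2]
  have e3 : a / z = saddleG (a / z) (b / z) * saddleH (a / z) (b / z) :=
    (saddleG_mul_saddleH (by positivity) _).symm
  linear_combination e3

/-- This fixes the constant of integration along the ray: there `g → 0` and `h → 1`, hence `zA → 0`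
and `p_0 → 1`. -/
lemma tendsto_logRatio {a : ℝ} (ha : 0 < a) (b : ℝ) :
    Tendsto (logRatio a b) atTop (𝓝 0) := by
  obtain ⟨tg, th⟩ := tendsto_saddle_ray a b
  have hΓ := Real.Gamma_pos_of_pos ha
  have t1 := (tendsto_rpow_mul_integral_weight (m := b - a) ha).log hΓ.ne'
  have tg1 : Tendsto (fun z => 1 + saddleG (a / z) (b / z)) atTop (𝓝 1) := by
    simpa using tg.const_add 1
  have tgh : Tendsto (fun z => saddleG (a / z) (b / z) + saddleH (a / z) (b / z)) atTop (𝓝 1) := by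
    simpa using tg.add th
  have l1 := tg1.log one_ne_zero
  have l2 := th.log one_ne_zero
  have l3 := tgh.log one_ne_zero
  have t2 : Tendsto (fun z => z * expA (a / z) (b / z)) atTop (𝓝 0) := by
    have := ((l1.sub (tg.div tg1 one_ne_zero)).const_mul (b - a)).sub (l2.const_mul a)
    simp only [Real.log_one, div_one, sub_zero, mul_zero] at this
    refine this.congr' ?_
    filter_upwards [eventually_gt_atTop 0] with z hz using (mul_expA_ray ha b hz).symm
  have t3 : Tendsto (fun z => Real.log (firstCoeff (a / z) (b / z))) atTop (𝓝 0) := by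
    have := ((l1.add l2).sub l3).div_const 2
    simp only [Real.log_one, add_zero, sub_zero, zero_div] at this
    refine this.congr' ?_
    filter_upwards [eventually_gt_atTop 0] with z hz using
      (log_firstCoeff (by positivity) _).symm
  have := ((t1.sub_const (Real.log (Real.Gamma a))).sub t2).sub t3
  simp only [sub_self] at this
  exact this


/-! ### Integration along rays -/

/-- A function with limit zero is bounded by a majorant of its derivative with limit zero. -/
lemma abs_le_of_deriv_bound {f f' k k' : ℝ → ℝ} {z : ℝ}
    (hf : ∀ x, z ≤ x → HasDerivAt f (f' x) x) (hk : ∀ x, z ≤ x → HasDerivAt k (k' x) x)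
    (h : ∀ x, z ≤ x → |f' x| ≤ -k' x) (tf : Tendsto f atTop (𝓝 0)) (tk : Tendsto k atTop (𝓝 0)) :
    |f z| ≤ k z := by
  have anti : ∀ (F F' : ℝ → ℝ), (∀ x, z ≤ x → HasDerivAt F (F' x) x) → (∀ x, z ≤ x → F' x ≤ 0) →
      Tendsto F atTop (𝓝 0) → 0 ≤ F z := by
    intro F F' hF hF' tF
    have : AntitoneOn F (Ici z) := by
      refine antitoneOn_of_deriv_nonpos (convex_Ici z)
        (fun x hx => (hF x hx).continuousAt.continuousWithinAt)
        (fun x hx => ?_) (fun x hx => ?_)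
      · rw [interior_Ici] at hx
        exact (hF x (le_of_lt hx)).differentiableAt.differentiableWithinAt
      · rw [interior_Ici] at hx
        rw [(hF x (le_of_lt hx)).deriv]; exact hF' x (le_of_lt hx)
    refine le_of_tendsto tF ?_
    filter_upwards [eventually_ge_atTop z] with x hx using this self_mem_Ici hx hx
  have h1 := anti (fun x => k x + f x) (fun x => k' x + f' x)
    (fun x hx => (hk x hx).fun_add (hf x hx))
    (fun x hx => by linarith [(abs_le.1 (h x hx)).2]) (by simpa using tk.add tf)
  have h2 := anti (fun x => k x - f x) (fun x => k' x - f' x)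
    (fun x hx => (hk x hx).fun_sub (hf x hx))
    (fun x hx => by linarith [(abs_le.1 (h x hx)).1]) (by simpa using tk.sub tf)
  rw [abs_le]; constructor <;> linarith

/-- The coefficients in the expansion of the logarithm of the scaled function. -/
def logCoeff (j : ℕ) (α β : ℝ) : ℝ :=
  ∫ l in Ioi (1 : ℝ), avgCoeff j (α / l) (β / l) / l ^ (j + 1)

lemma continuousAt_avgCoeff (j : ℕ) {a z : ℝ} (ha : 0 < a) (b : ℝ) (hz : 0 < z) :
    ContinuousAt (fun z => avgCoeff j (a / z) (b / z)) z := by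
  have S := isSaddle ha b hz
  have hg := S.g_pos
  have hh := S.h_pos
  have cg := (hasDerivAt_saddleG_ray ha b hz).continuousAt
  have ch := (hasDerivAt_saddleH_ray ha b hz).continuousAt
  have e : ∀ α β : ℝ, avgCoeff j α β = ((avgPoly j).eval ContinuousMap.fst)
      (saddleH α β / (saddleG α β + saddleH α β), (1 - saddleH α β) / saddleH α β) /
      saddleH α β ^ j := by
    intro α β
    unfold avgCoeff
    congr 1
    set θ := (saddleH α β / (saddleG α β + saddleH α β), (1 - saddleH α β) / saddleH α β) with hθ
    rw [Polynomial.eval_map, ← evalAt_apply θ, ← Polynomial.eval₂_at_apply]; rfl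
  simp only [e]
  refine ContinuousAt.div ?_ (ch.pow j) (by positivity)
  refine ContinuousAt.comp (g := ((avgPoly j).eval ContinuousMap.fst : C(ℝ × ℝ, ℝ)))
    (f := fun z => (saddleH (a / z) (b / z) / (saddleG (a / z) (b / z) + saddleH (a / z) (b / z)),
      (1 - saddleH (a / z) (b / z)) / saddleH (a / z) (b / z))) (by fun_prop) ?_
  refine ContinuousAt.prodMk (ch.div (cg.add ch) (by positivity)) ?_
  exact (continuousAt_const.sub ch).div ch (by positivity)

lemma div_mem_ray {a z x : ℝ} (hz : 0 < z) : a / x = a / z / (x / z) := by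
  rw [div_div, mul_div_cancel₀ _ hz.ne']

/-- Only one of the `j + 1` factors takes the refined bound with `1 / p_0`; the others are at most
`1 / η`. -/
lemma one_div_saddleH_pow_le {a b z x η : ℝ} (ha : 0 < a) (hz : 0 < z) (hη : 0 < η) (hη1 : η ≤ 1)
    (h : η ≤ saddleH (a / z) (b / z)) (hx : z ≤ x) (j : ℕ) :
    1 / saddleH (a / x) (b / x) ^ (j + 1) ≤
      (1 / η) ^ (j + 1) / firstCoeff (a / z) (b / z) * (√x / √z) := by
  have hα : 0 < a / z := by positivity
  have hl : 1 ≤ x / z := by rw [le_div_iff₀ hz]; linarith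
  have h1 := one_div_saddleH_le hα hη hη1 h hl
  have h2 := le_saddleH_div hα hη hη1 h hl
  rw [← div_mem_ray hz, ← div_mem_ray hz] at h1 h2
  have h3 : 0 < saddleH (a / x) (b / x) := by linarith
  have h4 : 1 / saddleH (a / x) (b / x) ≤ 1 / η := one_div_le_one_div_of_le hη h2
  have hp := firstCoeff_pos hα (b / z)
  rw [Real.sqrt_div' _ hz.le] at h1
  calc 1 / saddleH (a / x) (b / x) ^ (j + 1)
      = (1 / saddleH (a / x) (b / x)) ^ j * (1 / saddleH (a / x) (b / x)) := by
        rw [← pow_succ, one_div_pow]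
    _ ≤ (1 / η) ^ j * (√x / √z / (η * firstCoeff (a / z) (b / z))) := by gcongr
    _ = _ := by rw [pow_succ]; field_simp

/-- The loss `√x` of the refined bound against `x^{-2}` leaves the integrable majorant `x^{-3/2}`,
with `p_0` taken at the start of the ray. -/
lemma abs_avgCoeff_ray_le (j : ℕ) {η : ℝ} (hη : 0 < η) (hη1 : η ≤ 1) :
    ∃ C > 0, ∀ a b z x : ℝ, 0 < a → 1 ≤ z → η ≤ saddleH (a / z) (b / z) → z ≤ x →
      |avgCoeff (j + 1) (a / x) (b / x) / x ^ (j + 1 + 1)| ≤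
        C / firstCoeff (a / z) (b / z) / √z * x ^ (-(3 / 2) : ℝ) := by
  obtain ⟨C, hC, hb⟩ := exists_avgCoeff_bound (j + 1) hη hη1
  refine ⟨C * (1 / η) ^ (j + 1), by positivity, fun a b z x ha hz1 h hx => ?_⟩
  have hz : 0 < z := by linarith
  have hx0 : 0 < x := by linarith
  have hα : 0 < a / z := by positivity
  have hl : 1 ≤ x / z := by rw [le_div_iff₀ hz]; linarith
  have h2 := le_saddleH_div hα hη hη1 h hl
  rw [← div_mem_ray hz, ← div_mem_ray hz] at h2
  have h3 := hb (a / x) (b / x) (by positivity) h2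
  have hp := firstCoeff_pos hα (b / z)
  have hh : 0 < saddleH (a / x) (b / x) := by linarith
  have h4 := one_div_saddleH_pow_le ha hz hη hη1 h hx j
  rw [abs_div, abs_of_pos (pow_pos hx0 _)]
  have e : √x / x ^ (j + 1 + 1) ≤ x ^ (-(3 / 2) : ℝ) := by
    have : x ^ (-(3 / 2) : ℝ) = √x / x ^ 2 := by
      rw [Real.sqrt_eq_rpow, ← Real.rpow_natCast, ← Real.rpow_sub hx0]; norm_num
    rw [this]
    gcongr
    · linarith
    · omega
  calc _ ≤ C / saddleH (a / x) (b / x) ^ (j + 1) / x ^ (j + 1 + 1) := by gcongr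
    _ = C * (1 / saddleH (a / x) (b / x) ^ (j + 1)) / x ^ (j + 1 + 1) := by ring
    _ ≤ C * ((1 / η) ^ (j + 1) / firstCoeff (a / z) (b / z) * (√x / √z)) / x ^ (j + 1 + 1) := by
        gcongr
    _ = C * (1 / η) ^ (j + 1) / firstCoeff (a / z) (b / z) / √z * (√x / x ^ (j + 1 + 1)) := by ring
    _ ≤ _ := by gcongr

lemma integrableOn_avgCoeff_ray (j : ℕ) {a b z η : ℝ} (ha : 0 < a) (hz : 1 ≤ z) (hη : 0 < η)
    (hη1 : η ≤ 1) (h : η ≤ saddleH (a / z) (b / z)) :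
    IntegrableOn (fun x => avgCoeff (j + 1) (a / x) (b / x) / x ^ (j + 1 + 1)) (Ioi z) := by
  have hz0 : 0 < z := by linarith
  obtain ⟨C, hC, hb⟩ := abs_avgCoeff_ray_le j hη hη1
  refine Integrable.mono' ((integrableOn_Ioi_rpow_of_lt (a := -(3 / 2)) (by norm_num) hz0).const_mul
    (C / firstCoeff (a / z) (b / z) / √z)) ?_ ?_
  · refine ContinuousOn.aestronglyMeasurable (fun x hx => ?_) measurableSet_Ioi
    have hx0 : 0 < x := hz0.trans hx
    exact ((continuousAt_avgCoeff (j + 1) ha b hx0).div (by fun_prop)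
      (by positivity)).continuousWithinAt
  · refine (ae_restrict_iff' measurableSet_Ioi).2 (Eventually.of_forall fun x hx => ?_)
    exact hb a b z x ha hz h (le_of_lt hx)

/-- By the scaling `x = z l` the integrated term is a pure power of `1/z` times a function of `α`,
`β`. -/
lemma integral_avgCoeff_ray (j : ℕ) (a b : ℝ) {z : ℝ} (hz : 0 < z) :
    ∫ x in Ioi z, avgCoeff (j + 1) (a / x) (b / x) / x ^ (j + 1 + 1) =
      logCoeff (j + 1) (a / z) (b / z) / z ^ (j + 1) := by
  have := integral_comp_mul_left_Ioi
    (fun x => avgCoeff (j + 1) (a / x) (b / x) / x ^ (j + 1 + 1)) 1 hz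
  rw [mul_one, smul_eq_mul] at this
  rw [eq_comm, inv_mul_eq_iff_eq_mul₀ hz.ne'] at this
  rw [this, logCoeff, ← integral_const_mul, ← integral_div]
  refine setIntegral_congr_fun measurableSet_Ioi fun l hl => ?_
  have hl0 : (0 : ℝ) < l := one_pos.trans hl
  rw [← div_div, ← div_div]
  field_simp
  ring

lemma exists_logCoeff_bound (j : ℕ) {η : ℝ} (hη : 0 < η) (hη1 : η ≤ 1) :
    ∃ C > 0, ∀ α β : ℝ, 0 < α → η ≤ saddleH α β →
      |logCoeff (j + 1) α β| ≤ C / firstCoeff α β := by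
  obtain ⟨C, hC, hb⟩ := abs_avgCoeff_ray_le j hη hη1
  refine ⟨2 * C, by positivity, fun α β hα h => ?_⟩
  have hint : IntegrableOn (fun x : ℝ => x ^ (-(3 / 2) : ℝ)) (Ioi 1) :=
    integrableOn_Ioi_rpow_of_lt (by norm_num) one_pos
  unfold logCoeff
  have := norm_integral_le_of_norm_le (hint.const_mul (C / firstCoeff α β))
    (f := fun l => avgCoeff (j + 1) (α / l) (β / l) / l ^ (j + 1 + 1))
    ((ae_restrict_iff' measurableSet_Ioi).2 (Eventually.of_forall fun l hl => by
      have := hb α β 1 l hα le_rfl (by simpa using h) (le_of_lt hl)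
      rw [Real.norm_eq_abs]
      simpa only [div_one, Real.sqrt_one] using this))
  rw [integral_const_mul, integral_Ioi_rpow_of_lt (by norm_num) one_pos, Real.norm_eq_abs] at this
  refine this.trans_eq ?_
  norm_num
  ring

/-- Expansion of the logarithm of the scaled function, uniform in the parameters. -/
lemma exists_logRatio_expansion (N : ℕ) {η : ℝ} (hη : 0 < η) (hη1 : η ≤ 1) :
    ∃ C > 0, ∀ a b z : ℝ, 0 < a → 1 ≤ z → η ≤ saddleH (a / z) (b / z) →
      |logRatio a b z - ∑ j ∈ Finset.range N, logCoeff (j + 1) (a / z) (b / z) / z ^ (j + 1)| ≤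
        C / firstCoeff (a / z) (b / z) / z ^ (N + 1) := by
  -- One term more than `N`, because the term of index `0` belongs to `p_0`.
  obtain ⟨C, hC, hb⟩ := exists_mean_expansion (N + 1) hη hη1
  refine ⟨C * (1 / η) ^ (N + 1) * 2, by positivity, fun a b z ha hz1 h => ?_⟩
  have hz : 0 < z := by linarith
  have hp := firstCoeff_pos (α := a / z) (by positivity) (b / z)
  set c : ℝ := C * (1 / η) ^ (N + 1) / firstCoeff (a / z) (b / z) / √z / z ^ N with hc
  have hc0 : 0 < c := by positivity
  -- For `y ≥ z` this is the tail integral from `y` to infinity, written so that it can be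
  -- differentiated in `y`.
  set V : ℕ → ℝ → ℝ := fun j y =>
    (∫ x in Ioi z, avgCoeff (j + 1) (a / x) (b / x) / x ^ (j + 1 + 1)) -
      ∫ x in z..y, avgCoeff (j + 1) (a / x) (b / x) / x ^ (j + 1 + 1) with hV
  have hVd : ∀ j, ∀ x, z ≤ x → HasDerivAt (V j)
      (-(avgCoeff (j + 1) (a / x) (b / x) / x ^ (j + 1 + 1))) x := by
    intro j x hx
    have hcont : ∀ y, 0 < y → ContinuousAt
        (fun x => avgCoeff (j + 1) (a / x) (b / x) / x ^ (j + 1 + 1)) y := fun y hy =>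
      (continuousAt_avgCoeff (j + 1) ha b hy).div (by fun_prop) (by positivity)
    refine HasDerivAt.const_sub _ ?_
    refine intervalIntegral.integral_hasDerivAt_right ?_ ?_ (hcont x (by linarith))
    · refine ContinuousOn.intervalIntegrable fun y hy => ?_
      rw [uIcc_of_le hx] at hy
      exact (hcont y (by linarith [hy.1])).continuousWithinAt
    · refine ContinuousOn.stronglyMeasurableAtFilter (s := Ioi 0) isOpen_Ioi
        (fun y hy => (hcont y hy).continuousWithinAt) x (by show 0 < x; linarith)
  have hVt : ∀ j, Tendsto (V j) atTop (𝓝 0) := by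
    intro j
    have := intervalIntegral_tendsto_integral_Ioi z
      (integrableOn_avgCoeff_ray j ha hz1 hη hη1 h) tendsto_id
    have h2 := this.const_sub
      (∫ x in Ioi z, avgCoeff (j + 1) (a / x) (b / x) / x ^ (j + 1 + 1))
    simpa [hV] using h2
  -- The majorant `2c/√x` is the tail integral of `c x^{-3/2}`.
  have key := abs_le_of_deriv_bound (z := z)
    (f := fun x => logRatio a b x - ∑ j ∈ Finset.range N, V j x)
    (f' := fun x => -((∫ u in Ioi (0 : ℝ), weight (a + 1) (b - a) x u) /
        (∫ u in Ioi (0 : ℝ), weight a (b - a) x u) -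
        (saddleG (a / x) (b / x) + avgCoeff 0 (a / x) (b / x) / x)) -
        ∑ j ∈ Finset.range N, -(avgCoeff (j + 1) (a / x) (b / x) / x ^ (j + 1 + 1)))
    (k := fun x => 2 * c * (√x)⁻¹) (k' := fun x => 2 * c * (-(1 / (2 * √x)) / (√x) ^ 2))
    ?_ ?_ ?_ ?_ ?_
  · have e : ∀ j, V j z = logCoeff (j + 1) (a / z) (b / z) / z ^ (j + 1) := by
      intro j
      simp only [hV, intervalIntegral.integral_same, sub_zero]
      exact integral_avgCoeff_ray j a b hz
    simp only [e] at key
    refine key.trans_eq ?_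
    rw [hc]
    have : √z * √z = z := Real.mul_self_sqrt hz.le
    have h0 : 0 < √z := Real.sqrt_pos.2 hz
    field_simp
    rw [pow_succ, Real.sq_sqrt hz.le]
    ring
  · intro x hx
    exact (hasDerivAt_logRatio ha b (by linarith)).fun_sub
      (HasDerivAt.fun_sum fun j _ => hVd j x hx)
  · intro x hx
    have hx0 : 0 < x := by linarith
    exact ((Real.hasDerivAt_sqrt hx0.ne').fun_inv (by positivity)).const_mul _
  · intro x hx
    have hx0 : 0 < x := by linarith
    have hl : 1 ≤ x / z := by rw [le_div_iff₀ hz]; linarith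
    have h2 := le_saddleH_div (by positivity) hη hη1 h hl
    rw [← div_mem_ray hz, ← div_mem_ray hz] at h2
    have h3 := hb a b x ha hx0 h2
    have h4 := one_div_saddleH_pow_le ha hz hη hη1 h hx N
    have hh : 0 < saddleH (a / x) (b / x) := by linarith
    have e1 : -((∫ u in Ioi (0 : ℝ), weight (a + 1) (b - a) x u) /
        (∫ u in Ioi (0 : ℝ), weight a (b - a) x u) -
        (saddleG (a / x) (b / x) + avgCoeff 0 (a / x) (b / x) / x)) -
        ∑ j ∈ Finset.range N, -(avgCoeff (j + 1) (a / x) (b / x) / x ^ (j + 1 + 1)) =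
        -((∫ u in Ioi (0 : ℝ), weight (a + 1) (b - a) x u) /
        (∫ u in Ioi (0 : ℝ), weight a (b - a) x u) - (saddleG (a / x) (b / x) +
        ∑ j ∈ Finset.range (N + 1), avgCoeff j (a / x) (b / x) / x ^ (j + 1))) := by
      rw [Finset.sum_range_succ', Finset.sum_neg_distrib]
      simp only [zero_add, pow_one]
      ring
    rw [e1, abs_neg]
    refine h3.trans ?_
    have hs : √x ^ 2 = x := Real.sq_sqrt hx0.le
    have hs0 : 0 < √x := Real.sqrt_pos.2 hx0
    have hsz : 0 < √z := Real.sqrt_pos.2 hz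
    have e2 : -(2 * c * (-(1 / (2 * √x)) / √x ^ 2)) = c * (√x / x ^ 2) := by
      have : x ^ 2 = √x ^ 4 := by rw [show √x ^ 4 = (√x ^ 2) ^ 2 by ring, hs]
      rw [this]; field_simp
    rw [e2]
    calc C / saddleH (a / x) (b / x) ^ (N + 1) / x ^ (N + 1 + 1)
        = C * (1 / saddleH (a / x) (b / x) ^ (N + 1)) / x ^ 2 / x ^ N := by
          field_simp; ring
      _ ≤ C * ((1 / η) ^ (N + 1) / firstCoeff (a / z) (b / z) * (√x / √z)) / x ^ 2 / z ^ N := by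
          gcongr
      _ = c * (√x / x ^ 2) := by rw [hc]; ring
  · have := (tendsto_logRatio ha b).sub
      (tendsto_finsetSum (Finset.range N) fun j _ => hVt j)
    simpa using this
  · have : Tendsto (fun x : ℝ => (√x)⁻¹) atTop (𝓝 0) :=
      tendsto_inv_atTop_zero.comp Real.tendsto_sqrt_atTop
    simpa using this.const_mul (2 * c)

/-! ### Exponentials of expansions -/

lemma abs_exp_sub_sum_le (x : ℝ) (n : ℕ) :
    |Real.exp x - ∑ m ∈ Finset.range n, x ^ m / m.factorial| ≤ |x| ^ n * Real.exp |x| := by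
  have := Complex.norm_exp_sub_sum_le_norm_mul_exp (x : ℂ) n
  rw [Complex.norm_real] at this
  rw [← Real.norm_eq_abs, ← Complex.norm_real]
  push_cast
  exact this

open Polynomial in
/-- The polynomial `∑ G_j X^(j+1)`, `j < N`. -/
def seriesPoly (N : ℕ) (G : ℕ → ℝ) : ℝ[X] := ∑ j ∈ Finset.range N, C (G j) * X ^ (j + 1)

open Polynomial in
/-- The exponential of `∑ G_j X^(j+1)`, up to terms of order greater than `N`. -/
def expPoly (N : ℕ) (G : ℕ → ℝ) : ℝ[X] :=
  ∑ m ∈ Finset.range (N + 1), C (1 / (m.factorial : ℝ)) * seriesPoly N G ^ m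

open Polynomial in
lemma seriesPoly_eval (N : ℕ) (G : ℕ → ℝ) (x : ℝ) :
    (seriesPoly N G).eval x = ∑ j ∈ Finset.range N, G j * x ^ (j + 1) := by
  simp [seriesPoly, eval_finsetSum]

open Polynomial in
-- The method of majorants: coefficientwise domination passes to products.
lemma coeff_pow_dominated {p q : ℝ[X]} (h : ∀ n, |p.coeff n| ≤ q.coeff n) (m n : ℕ) :
    |(p ^ m).coeff n| ≤ (q ^ m).coeff n := by
  induction m generalizing n with
  | zero => simp only [pow_zero, coeff_one]; split_ifs <;> simp
  | succ m ih =>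
    rw [pow_succ, pow_succ, coeff_mul, coeff_mul]
    refine (Finset.abs_sum_le_sum_abs _ _).trans (Finset.sum_le_sum fun i _ => ?_)
    rw [abs_mul]
    exact mul_le_mul (ih _) (h _) (abs_nonneg _) ((abs_nonneg _).trans (ih _))

open Polynomial in
-- The power `m = 0` contributes only to degree `0`, so every other coefficient contains a factor
-- `ε`. Linearity in `ε` matters because `ε` will carry `1 / p_0`.
lemma exists_coeff_expPoly_bound (N n : ℕ) (K : ℝ) : ∃ C > 0, ∀ (G : ℕ → ℝ) (ε : ℝ), 0 ≤ ε →
    ε ≤ K → (∀ j < N, |G j| ≤ ε) → |(expPoly N G).coeff (n + 1)| ≤ C * ε := by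
  set S : ℝ[X] := seriesPoly N fun _ => 1
  refine ⟨∑ m ∈ Finset.range (N + 1), |(S ^ m).coeff (n + 1)| * |K| ^ (m - 1) + 1, by positivity,
    fun G ε h0 hK hG => ?_⟩
  have hdom : ∀ i, |(seriesPoly N G).coeff i| ≤ (C ε * S).coeff i := by
    intro i
    simp only [S, seriesPoly, finsetSum_coeff, coeff_C_mul, coeff_X_pow, one_mul, C_1,
      Finset.mul_sum]
    refine (Finset.abs_sum_le_sum_abs _ _).trans (Finset.sum_le_sum fun j hj => ?_)
    have := hG j (Finset.mem_range.1 hj)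
    split_ifs <;> simp [this]
  unfold expPoly
  rw [finsetSum_coeff]
  refine (Finset.abs_sum_le_sum_abs _ _).trans ?_
  have hle : ∀ m ∈ Finset.range (N + 1),
      |(C (1 / (m.factorial : ℝ)) * seriesPoly N G ^ m).coeff (n + 1)| ≤
        |(S ^ m).coeff (n + 1)| * |K| ^ (m - 1) * ε := by
    intro m _
    rw [coeff_C_mul, abs_mul]
    have h1 : |1 / (m.factorial : ℝ)| ≤ 1 := by
      rw [abs_of_pos (by positivity), div_le_one (by positivity)]
      exact_mod_cast Nat.one_le_iff_ne_zero.2 (Nat.factorial_ne_zero m)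
    rcases m with _ | m
    · simp [coeff_one]
    have h2 := coeff_pow_dominated hdom (m + 1) (n + 1)
    rw [mul_pow, ← C_pow, coeff_C_mul] at h2
    have h3 : ε ^ (m + 1) * (S ^ (m + 1)).coeff (n + 1) ≤
        |(S ^ (m + 1)).coeff (n + 1)| * |K| ^ m * ε := by
      have h4 : ε ^ m ≤ |K| ^ m := pow_le_pow_left₀ h0 (hK.trans (le_abs_self K)) m
      calc _ ≤ ε ^ (m + 1) * |(S ^ (m + 1)).coeff (n + 1)| := by
            gcongr; exact le_abs_self _
        _ = |(S ^ (m + 1)).coeff (n + 1)| * ε ^ m * ε := by ring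
        _ ≤ _ := by gcongr
    calc _ ≤ 1 * |(seriesPoly N G ^ (m + 1)).coeff (n + 1)| := by gcongr
      _ ≤ _ := by rw [one_mul]; exact h2.trans h3
  refine (Finset.sum_le_sum hle).trans ?_
  rw [← Finset.sum_mul]
  nlinarith

open Polynomial in
lemma natDegree_expPoly_lt (N : ℕ) (G : ℕ → ℝ) : (expPoly N G).natDegree < N * N + 1 := by
  rw [Nat.lt_succ_iff]
  refine natDegree_sum_le_of_forall_le _ _ fun m hm => ?_
  refine (natDegree_C_mul_le _ _).trans (natDegree_pow_le.trans ?_)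
  refine Nat.mul_le_mul (Nat.lt_succ_iff.1 (Finset.mem_range.1 hm)) ?_
  refine natDegree_sum_le_of_forall_le _ _ fun j hj => ?_
  exact (natDegree_C_mul_X_pow_le _ _).trans (Finset.mem_range.1 hj)

open Polynomial in
lemma exists_exp_expansion (N : ℕ) (K : ℝ) : ∃ C > 0, ∀ (G : ℕ → ℝ) (ε x R : ℝ), 0 ≤ ε → ε ≤ K →
    (∀ j < N, |G j| ≤ ε) → 0 < x → x ≤ 1 → |R| ≤ ε * x ^ (N + 1) →
    |Real.exp (∑ j ∈ Finset.range N, G j * x ^ (j + 1) + R) -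
      ∑ n ∈ Finset.range (N + 1), (expPoly N G).coeff n * x ^ n| ≤ C * ε * x ^ (N + 1) := by
  choose B hB0 hB using fun n => exists_coeff_expPoly_bound N n K
  set k := |K| with hk
  -- The three summands bound the effect of `R`, the Taylor remainder of the exponential, and the
  -- terms of `expPoly` of degree above `N`.
  refine ⟨Real.exp (N * k) * Real.exp k + (N : ℝ) ^ (N + 1) * k ^ N * Real.exp (N * k) +
    ∑ n ∈ Finset.range (N * N + 1), B (N + n), ?_, fun G ε x R h0 hK hG hx hx1 hR => ?_⟩
  · have : 0 ≤ ∑ n ∈ Finset.range (N * N + 1), B (N + n) := Finset.sum_nonneg fun n _ => (hB0 _).le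
    positivity
  set w := ∑ j ∈ Finset.range N, G j * x ^ (j + 1) with hw
  have hεk : ε ≤ k := hK.trans (le_abs_self K)
  have hwb : |w| ≤ N * ε * x := by
    refine (Finset.abs_sum_le_sum_abs _ _).trans ?_
    have : ∀ j ∈ Finset.range N, |G j * x ^ (j + 1)| ≤ ε * x := by
      intro j hj
      rw [abs_mul, abs_of_pos (pow_pos hx _)]
      refine mul_le_mul (hG j (Finset.mem_range.1 hj)) ?_ (by positivity) h0
      exact pow_le_of_le_one hx.le hx1 (by omega)
    refine (Finset.sum_le_sum this).trans_eq ?_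
    simp; ring
  have hwk : |w| ≤ N * k := by
    refine hwb.trans ?_
    calc N * ε * x ≤ N * k * 1 := by gcongr
      _ = _ := mul_one _
  have hRk : |R| ≤ k := by
    refine hR.trans ?_
    calc ε * x ^ (N + 1) ≤ k * 1 := by
          gcongr; exact pow_le_one₀ hx.le hx1
      _ = _ := mul_one _
  have p1 : |Real.exp (w + R) - Real.exp w| ≤
      Real.exp (N * k) * Real.exp k * (ε * x ^ (N + 1)) := by
    have h1 := abs_exp_sub_sum_le R 1
    simp only [Finset.range_one, Finset.sum_singleton, pow_zero, Nat.factorial_zero, Nat.cast_one,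
      div_one, pow_one] at h1
    rw [Real.exp_add, ← mul_sub_one, abs_mul, abs_of_pos (Real.exp_pos w)]
    calc _ ≤ Real.exp (N * k) * (|R| * Real.exp |R|) := by
          gcongr; exact (le_abs_self w).trans hwk
      _ ≤ Real.exp (N * k) * (ε * x ^ (N + 1) * Real.exp k) := by gcongr
      _ = _ := by ring
  have p2 : |Real.exp w - (expPoly N G).eval x| ≤
      (N : ℝ) ^ (N + 1) * k ^ N * Real.exp (N * k) * (ε * x ^ (N + 1)) := by
    have h1 := abs_exp_sub_sum_le w (N + 1)
    have e : (expPoly N G).eval x = ∑ m ∈ Finset.range (N + 1), w ^ m / m.factorial := by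
      rw [expPoly, eval_finsetSum]
      refine Finset.sum_congr rfl fun m _ => ?_
      rw [eval_mul, eval_C, eval_pow, seriesPoly_eval, ← hw]; ring
    rw [e]
    refine h1.trans ?_
    calc _ ≤ (N * ε * x) ^ (N + 1) * Real.exp (N * k) := by gcongr
      _ = (N : ℝ) ^ (N + 1) * ε ^ N * Real.exp (N * k) * (ε * x ^ (N + 1)) := by ring
      _ ≤ _ := by gcongr
  have p3 : |(expPoly N G).eval x - ∑ n ∈ Finset.range (N + 1), (expPoly N G).coeff n * x ^ n| ≤
      (∑ n ∈ Finset.range (N * N + 1), B (N + n)) * (ε * x ^ (N + 1)) := by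
    have hd : (expPoly N G).natDegree < (N + 1) + (N * N + 1) :=
      (natDegree_expPoly_lt N G).trans_le (by omega)
    rw [eval_eq_sum_range' hd, Finset.sum_range_add, add_sub_cancel_left]
    refine (Finset.abs_sum_le_sum_abs _ _).trans ?_
    rw [Finset.sum_mul]
    have hBn : ∀ n ∈ Finset.range (N * N + 1), |(expPoly N G).coeff (N + 1 + n) *
        x ^ (N + 1 + n)| ≤ B (N + n) * (ε * x ^ (N + 1)) := by
      intro n _
      have := hB (N + n) G ε h0 hK hG
      rw [show N + n + 1 = N + 1 + n by ring] at this
      rw [abs_mul, abs_of_pos (pow_pos hx _), ← mul_assoc]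
      refine mul_le_mul this ?_ (by positivity) ((abs_nonneg _).trans this)
      exact pow_le_pow_of_le_one hx.le hx1 (by omega)
    exact Finset.sum_le_sum hBn
  calc _ ≤ |Real.exp (w + R) - Real.exp w| + |Real.exp w - (expPoly N G).eval x| +
        |(expPoly N G).eval x - ∑ n ∈ Finset.range (N + 1), (expPoly N G).coeff n * x ^ n| := by
        refine (abs_sub_le _ ((expPoly N G).eval x) _).trans ?_
        gcongr
        exact abs_sub_le _ _ _
    _ ≤ _ := by
        refine (add_le_add (add_le_add p1 p2) p3).trans_eq ?_
        ring

/-- The coefficients of the uniform expansion of order `N`. -/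
def uniformCoeff (N n : ℕ) (α β : ℝ) : ℝ :=
  (expPoly N fun j => logCoeff (j + 1) α β).coeff n

/-- Expansion of the scaled function, uniform in the parameters. -/
lemma exists_uniform_expansion (N : ℕ) {η : ℝ} (hη : 0 < η) (hη1 : η ≤ 1) :
    ∃ C > 0, ∀ a b z : ℝ, 0 < a → 1 ≤ z → η ≤ saddleH (a / z) (b / z) →
      |scaledU a (b + 1) z -
        Real.exp (z * expA (a / z) (b / z)) * firstCoeff (a / z) (b / z) *
          ∑ n ∈ Finset.range (N + 1), uniformCoeff N n (a / z) (b / z) / z ^ n| ≤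
        C * Real.exp (z * expA (a / z) (b / z)) / z ^ (N + 1) := by
  obtain ⟨C, hC, hb⟩ := exists_logRatio_expansion N hη hη1
  choose B hB0 hB using fun j => exists_logCoeff_bound j hη hη1
  set M := ∑ j ∈ Finset.range N, B j + C with hM
  have hS : 0 ≤ ∑ j ∈ Finset.range N, B j := Finset.sum_nonneg fun j _ => (hB0 j).le
  have hM0 : 0 < M := by positivity
  obtain ⟨D, hD, hexp⟩ := exists_exp_expansion N (M / η)
  refine ⟨D * M, by positivity, fun a b z ha hz h => ?_⟩
  have hz0 : 0 < z := by linarith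
  have hα : 0 < a / z := by positivity
  have hp := firstCoeff_pos hα (b / z)
  have hpη : η ≤ firstCoeff (a / z) (b / z) := by
    refine abs_le_of_sq_le_sq' ?_ hp.le |>.2
    have := le_firstCoeff_sq hα hη1 h
    nlinarith
  -- With `ε = M / p_0` the relative error cancels the factor `p_0` of the leading term.
  have key := hexp (fun j => logCoeff (j + 1) (a / z) (b / z)) (M / firstCoeff (a / z) (b / z))
    (1 / z) (logRatio a b z - ∑ j ∈ Finset.range N,
      logCoeff (j + 1) (a / z) (b / z) * (1 / z) ^ (j + 1)) (by positivity)
    (by gcongr) ?_ (by positivity) ?_ ?_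
  · rw [add_sub_cancel] at key
    rw [exp_logRatio ha b hz0, ← mul_sub, abs_mul, abs_of_pos (by positivity)]
    have e : ∀ n, uniformCoeff N n (a / z) (b / z) / z ^ n =
        (expPoly N fun j => logCoeff (j + 1) (a / z) (b / z)).coeff n * (1 / z) ^ n := fun n => by
      rw [uniformCoeff, one_div_pow]; ring
    simp only [e]
    refine (mul_le_mul_of_nonneg_left key (by positivity)).trans_eq ?_
    rw [one_div_pow]
    field_simp
  · intro j hj
    refine (hB j _ _ hα h).trans ?_
    gcongr
    have := Finset.single_le_sum (f := B) (fun i _ => (hB0 i).le) (Finset.mem_range.2 hj)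
    linarith
  · rw [div_le_one hz0]; exact hz
  · have := hb a b z ha hz h
    have e : ∀ j, logCoeff (j + 1) (a / z) (b / z) * (1 / z) ^ (j + 1) =
        logCoeff (j + 1) (a / z) (b / z) / z ^ (j + 1) := fun j => by
      rw [one_div_pow]; ring
    simp only [e]
    refine this.trans ?_
    rw [one_div_pow, mul_one_div]
    gcongr
    linarith


/-! ### The local transformation -/

lemma analyticAt_dslope {f : ℝ → ℝ} {c : ℝ} (hf : AnalyticAt ℝ f c) :
    AnalyticAt ℝ (dslope f c) c := by
  obtain ⟨p, hp⟩ := hf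
  exact hp.has_fpower_series_dslope_fslope.analyticAt

lemma dslope_congr {f g : ℝ → ℝ} {c : ℝ} (h : f =ᶠ[𝓝 c] g) : dslope f c =ᶠ[𝓝 c] dslope g c := by
  filter_upwards [h] with x hx
  rcases eq_or_ne x c with rfl | hxc
  · rw [dslope_same, dslope_same, h.deriv_eq]
  · rw [dslope_of_ne _ hxc, dslope_of_ne _ hxc, slope_def_field, slope_def_field, hx,
      h.eq_of_nhds]

lemma sub_mul_dslope (f : ℝ → ℝ) (c x : ℝ) : f x = f c + (x - c) * dslope f c x := by
  have := sub_smul_dslope f c x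
  rw [smul_eq_mul] at this
  linarith

lemma analyticAt_real_log {x : ℝ} (hx : x ≠ 0) : AnalyticAt ℝ Real.log x := by
  rcases hx.lt_or_gt with h | h
  · have : AnalyticAt ℝ (fun z => Real.log (-z)) x :=
      AnalyticAt.log (analyticAt_id.neg) (by simpa using h)
    simpa [Real.log_neg_eq_log] using this
  · exact analyticAt_log h

/-- An analytic function with a nondegenerate minimal value zero is locally the square of an
analytic function with positive derivative. -/
lemma exists_analytic_sqrt {f k : ℝ → ℝ} {c : ℝ} (hf : AnalyticAt ℝ f c) (hfc : f c = 0)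
    (hk : ContinuousAt k c) (hkc : 0 < k c) (hd : ∀ᶠ t in 𝓝 c, deriv f t = (t - c) * k t) :
    ∃ w : ℝ → ℝ, AnalyticAt ℝ w c ∧ w c = 0 ∧ 0 < deriv w c ∧ ∀ᶠ t in 𝓝 c, f t = w t ^ 2 := by
  have a1 := analyticAt_dslope hf
  have a2 := analyticAt_dslope a1
  have h1 : dslope f c c = 0 := by
    rw [dslope_same, hd.self_of_nhds]; simp
  have e1 : ∀ t, f t = (t - c) * dslope f c t := fun t => by
    have := sub_mul_dslope f c t
    rwa [hfc, zero_add] at this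
  have e2 : ∀ t, dslope f c t = (t - c) * dslope (dslope f c) c t := fun t => by
    have := sub_mul_dslope (dslope f c) c t
    rwa [h1, zero_add] at this
  have e3 : ∀ᶠ t in 𝓝[≠] c, k t = dslope (dslope f c) c t + deriv (dslope f c) t := by
    have hev := (hd.and a1.eventually_analyticAt).filter_mono (nhdsWithin_le_nhds (s := {c}ᶜ))
    filter_upwards [hev, self_mem_nhdsWithin] with t ⟨h2, h3⟩ hne
    have hne' : t - c ≠ 0 := sub_ne_zero.2 hne
    have d1 : HasDerivAt f (1 * dslope f c t + (t - c) * deriv (dslope f c) t) t := by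
      have := ((hasDerivAt_id t).sub_const c).fun_mul h3.differentiableAt.hasDerivAt
      refine this.congr_of_eventuallyEq (Eventually.of_forall fun s => e1 s)
    rw [d1.deriv, e2 t] at h2
    have : (t - c) * k t = (t - c) * (dslope (dslope f c) c t + deriv (dslope f c) t) := by
      rw [← h2]; ring
    exact mul_left_cancel₀ hne' this
  -- Write `f = (t - c)² q`. Letting `t → c` in `e3` gives `k(c) = 2 q(c)`, so `q(c) > 0` and `√q`
  -- is analytic near `c`.
  have e4 : k c = dslope (dslope f c) c c + deriv (dslope f c) c := by
    have t1 := (hk.tendsto.mono_left (nhdsWithin_le_nhds (s := {c}ᶜ)))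
    have t2 := ((a2.continuousAt.add a1.deriv.continuousAt).tendsto.mono_left
      (nhdsWithin_le_nhds (s := {c}ᶜ)))
    exact tendsto_nhds_unique t1 (t2.congr' (e3.mono fun t ht => ht.symm))
  have hpos : 0 < dslope (dslope f c) c c := by
    rw [← dslope_same (dslope f c)] at e4
    linarith
  set r : ℝ → ℝ := fun t => Real.exp (Real.log (dslope (dslope f c) c t) / 2) with hr
  have ar : AnalyticAt ℝ r c := by
    refine AnalyticAt.rexp' ?_
    exact (a2.log hpos).div analyticAt_const two_ne_zero
  have ha : AnalyticAt ℝ (fun t => (t - c) * r t) c :=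
    (analyticAt_id.sub analyticAt_const).mul ar
  refine ⟨fun t => (t - c) * r t, ha, by simp, ?_, ?_⟩
  · have := (((hasDerivAt_id c).sub_const c).fun_mul ar.differentiableAt.hasDerivAt).deriv
    simp only [id] at this
    rw [this]
    simp [hr, Real.exp_pos]
  · filter_upwards [a2.continuousAt.eventually (lt_mem_nhds hpos)] with t ht
    rw [e1 t, e2 t, mul_pow]
    have : r t ^ 2 = dslope (dslope f c) c t := by
      rw [hr]
      simp only []
      rw [← Real.exp_nat_mul]
      push_cast
      rw [mul_div_cancel₀ _ two_ne_zero, Real.exp_log ht]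
    rw [this]; ring

/-- The critical points of a phase, on the branch under consideration. -/
structure Branch (x y : ℝ) : Prop where
  ne_zero : x ≠ 0
  lt_one : x < 1
  pos : 0 < y
  lt : x < y
  neg_or : x < 0 ∨ 1 < y

lemma hasDerivAt_phi (x y : ℝ) {t : ℝ} (ht : t ≠ 0) (ht1 : t < 1) :
    HasDerivAt (phi (alphaOf x y) (betaOf x y)) ((t - x) * (y - t) / (t * (1 - t))) t := by
  have h1 : 1 - t ≠ 0 := by linarith
  have d := ((hasDerivAt_id t).fun_sub ((((hasDerivAt_id t).const_sub 1).log h1).const_mul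
    (alphaOf x y))).fun_sub ((Real.hasDerivAt_log ht).const_mul (mu (alphaOf x y) (betaOf x y)))
  refine d.congr_deriv ?_
  rw [mu_param]
  simp only [id, alphaOf]
  field_simp
  ring

lemma hasDerivAt_psi (x y : ℝ) {s : ℝ} (hs : s ≠ 0) :
    HasDerivAt (psi (alphaOf x y) (betaOf x y)) ((s - x * y) / s) s := by
  have d := (hasDerivAt_id s).fun_sub ((Real.hasDerivAt_log hs).const_mul
    (mu (alphaOf x y) (betaOf x y)))
  refine d.congr_deriv ?_
  rw [mu_param]
  field_simp

lemma analyticAt_phi (α β : ℝ) {t : ℝ} (ht : t ≠ 0) (ht1 : t < 1) :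
    AnalyticAt ℝ (phi α β) t := by
  unfold phi
  refine (analyticAt_id.sub (analyticAt_const.mul ?_)).sub
    (analyticAt_const.mul (analyticAt_real_log ht))
  exact AnalyticAt.log (analyticAt_const.sub analyticAt_id) (by linarith)

lemma analyticAt_psi (α β : ℝ) {s : ℝ} (hs : s ≠ 0) : AnalyticAt ℝ (psi α β) s := by
  unfold psi
  exact analyticAt_id.sub (analyticAt_const.mul (analyticAt_real_log hs))

/-- A local analytic solution of `φ(t) - φ(x) = ψ(s) - ψ(μ)`. -/
structure IsGerm (x y : ℝ) (T : ℝ → ℝ) : Prop where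
  analytic : AnalyticAt ℝ T (x * y)
  apply_mu : T (x * y) = x
  deriv_pos : 0 < deriv T (x * y)
  relation : ∀ᶠ s in 𝓝 (x * y), phi (alphaOf x y) (betaOf x y) (T s) -
    phi (alphaOf x y) (betaOf x y) x =
    psi (alphaOf x y) (betaOf x y) s - psi (alphaOf x y) (betaOf x y) (x * y)

lemma Branch.mu_ne_zero {x y : ℝ} (H : Branch x y) : x * y ≠ 0 := mul_ne_zero H.ne_zero H.pos.ne'

/-- Both sides of the relation have a nondegenerate critical value. Taking analytic square roots
`w(t)` and `v(s)` with positive derivative reduces the relation to `w(t) = v(s)`, solved by the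
inverse function theorem. -/
lemma Branch.exists_germ {x y : ℝ} (H : Branch x y) : ∃ T, IsGerm x y T := by
  have hμ := H.mu_ne_zero
  have hx1 := H.lt_one
  have hxy := H.lt
  have hy := H.pos
  -- Both second derivatives, `(y-x)/(x(1-x))` and `1/(xy)`, have the sign of `x`; multiplying by
  -- `ε` makes them positive.
  obtain ⟨ε, hεx⟩ : ∃ ε : ℝ, 0 < ε / x := ⟨x, by rw [div_self H.ne_zero]; exact one_pos⟩
  have hε0 : ε ≠ 0 := by
    intro h; rw [h] at hεx; simp at hεx
  have near0 : ∀ᶠ t in 𝓝 x, t ≠ 0 ∧ t < 1 :=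
    (eventually_ne_nhds H.ne_zero).and (eventually_lt_nhds hx1)
  obtain ⟨w, aw, w0, wd, hw⟩ := exists_analytic_sqrt (c := x)
    (f := fun t => ε * (phi (alphaOf x y) (betaOf x y) t - phi (alphaOf x y) (betaOf x y) x))
    (k := fun t => ε * ((y - t) / (t * (1 - t))))
    (analyticAt_const.mul ((analyticAt_phi _ _ H.ne_zero hx1).sub analyticAt_const)) (by simp)
    (by
      refine ContinuousAt.mul continuousAt_const (ContinuousAt.div (by fun_prop) (by fun_prop) ?_)
      exact mul_ne_zero H.ne_zero (by linarith))
    (by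
      have : ε * ((y - x) / (x * (1 - x))) = ε / x * ((y - x) / (1 - x)) := by
        field_simp
      rw [this]
      exact mul_pos hεx (div_pos (by linarith) (by linarith)))
    (by
      filter_upwards [near0] with t ht
      rw [(((hasDerivAt_phi x y ht.1 ht.2).sub_const _).const_mul ε).deriv]
      ring)
  obtain ⟨v, av, v0, vd, hv⟩ := exists_analytic_sqrt (c := x * y)
    (f := fun s => ε * (psi (alphaOf x y) (betaOf x y) s - psi (alphaOf x y) (betaOf x y) (x * y)))
    (k := fun s => ε * (1 / s))
    (analyticAt_const.mul ((analyticAt_psi _ _ hμ).sub analyticAt_const)) (by simp)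
    (ContinuousAt.mul continuousAt_const (ContinuousAt.div (by fun_prop) (by fun_prop) hμ))
    (by
      have : ε * (1 / (x * y)) = ε / x * (1 / y) := by field_simp
      rw [this]; positivity)
    (by
      filter_upwards [eventually_ne_nhds hμ] with s hs
      rw [(((hasDerivAt_psi x y hs).sub_const _).const_mul ε).deriv]
      ring)
  set L := aw.hasStrictDerivAt.localInverse _ _ _ wd.ne' with hL
  have aL : AnalyticAt ℝ L (v (x * y)) := by
    rw [v0, ← w0]; exact aw.analyticAt_localInverse wd.ne'
  have dL : HasStrictDerivAt L (deriv w x)⁻¹ (v (x * y)) := by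
    rw [v0, ← w0]; exact aw.hasStrictDerivAt.to_localInverse wd.ne'
  have L0 : L (v (x * y)) = x := by
    rw [v0, ← w0]; exact (aw.hasStrictDerivAt.eventually_left_inverse wd.ne').self_of_nhds
  have hright : ∀ᶠ r in 𝓝 (v (x * y)), w (L r) = r := by
    rw [v0, ← w0]; exact aw.hasStrictDerivAt.eventually_right_inverse wd.ne'
  have aT : AnalyticAt ℝ (fun s => L (v s)) (x * y) := aL.comp av
  refine ⟨fun s => L (v s), aT, L0, ?_, ?_⟩
  · have := (dL.hasDerivAt.comp (x * y) av.differentiableAt.hasDerivAt).deriv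
    have e : deriv (fun s => L (v s)) (x * y) = (deriv w x)⁻¹ * deriv v (x * y) := this
    rw [e]; positivity
  · have ht : Tendsto (fun s => L (v s)) (𝓝 (x * y)) (𝓝 x) := by
      have := aT.continuousAt.tendsto
      rwa [L0] at this
    filter_upwards [hv, ht.eventually hw, av.continuousAt.tendsto.eventually hright] with s h1 h2 h3
    rw [h3, ← h1] at h2
    exact mul_left_cancel₀ hε0 h2

lemma IsGerm.tendsto {x y : ℝ} {T : ℝ → ℝ} (G : IsGerm x y T) :
    Tendsto T (𝓝 (x * y)) (𝓝 x) := by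
  have := G.analytic.continuousAt.tendsto
  rwa [G.apply_mu] at this

/-- By Rolle, equal values would give a critical point strictly between. It cannot be `x`, since
both points lie on the same side of `x`, nor `y`, which lies off the branch by `neg_or`. -/
lemma Branch.phi_inj {x y t t' : ℝ} (H : Branch x y) (ht : t < 1) (ht' : t' < 1)
    (hs : SignType.sign t = SignType.sign x) (hs' : SignType.sign t' = SignType.sign x)
    (hd : SignType.sign (t - x) = SignType.sign (t' - x))
    (h : phi (alphaOf x y) (betaOf x y) t = phi (alphaOf x y) (betaOf x y) t') : t = t' := by
  wlog hlt : t < t' generalizing t t'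
  · rcases lt_trichotomy t t' with h1 | h1 | h1
    · exact absurd h1 hlt
    · exact h1
    · exact (this ht' ht hs' hs hd.symm h.symm h1).symm
  exfalso
  have hsame : ∀ c, t ≤ c → c ≤ t' → c ≠ 0 ∧ (c < 0 ∨ 1 < y) := by
    intro c h1 h2
    rcases H.ne_zero.lt_or_gt with hx | hx
    · rw [sign_neg hx, sign_eq_neg_one_iff] at hs'
      exact ⟨by linarith, Or.inl (by linarith)⟩
    · rw [sign_pos hx, sign_eq_one_iff] at hs
      rcases H.neg_or with h3 | h3
      · linarith
      · exact ⟨by linarith, Or.inr h3⟩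
  obtain ⟨c, ⟨hc1, hc2⟩, hc⟩ := exists_hasDerivAt_eq_zero hlt
    (fun c hc => (hasDerivAt_phi x y (hsame c hc.1 hc.2).1 (hc.2.trans_lt ht')
      ).continuousAt.continuousWithinAt) h
    (fun c hc => hasDerivAt_phi x y (hsame c hc.1.le hc.2.le).1 (hc.2.trans ht'))
  have hcx : c - x ≠ 0 := by
    intro h0
    have h1 : t - x < 0 := by linarith
    have h2 : 0 < t' - x := by linarith
    rw [sign_neg h1, sign_pos h2] at hd
    exact absurd hd (by decide)
  have hcy : y - c ≠ 0 := by
    rcases (hsame c hc1.le hc2.le).2 with h1 | h1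
    · have := H.pos; linarith
    · linarith
  have hc0 := (hsame c hc1.le hc2.le).1
  have : (c - x) * (y - c) / (c * (1 - c)) ≠ 0 :=
    div_ne_zero (mul_ne_zero hcx hcy) (mul_ne_zero hc0 (by linarith))
  exact this hc

lemma IsGerm.sign_sub {x y : ℝ} {T : ℝ → ℝ} (G : IsGerm x y T) :
    ∀ᶠ s in 𝓝 (x * y), SignType.sign (T s - x) = SignType.sign (s - x * y) := by
  have hc := (analyticAt_dslope G.analytic).continuousAt
  have hp : 0 < dslope T (x * y) (x * y) := by rw [dslope_same]; exact G.deriv_pos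
  filter_upwards [hc.eventually (lt_mem_nhds hp)] with s hs
  have := sub_mul_dslope T (x * y) s
  rw [G.apply_mu] at this
  rw [this, add_sub_cancel_left, sign_mul, sign_pos hs, mul_one]

lemma sign_eventually_eq {c : ℝ} (hc : c ≠ 0) :
    ∀ᶠ t in 𝓝 c, SignType.sign t = SignType.sign c := by
  rcases hc.lt_or_gt with h | h
  · filter_upwards [gt_mem_nhds h] with t ht
    rw [sign_neg h, sign_neg ht]
  · filter_upwards [lt_mem_nhds h] with t ht
    rw [sign_pos h, sign_pos ht]

lemma sign_mul_pos' {x y : ℝ} (hy : 0 < y) : SignType.sign (x * y) = SignType.sign x := by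
  rw [sign_mul, sign_pos hy, mul_one]

/-- The germ satisfies `Corresponds`, and `Branch.phi_inj` makes the solution unique; hence the
choice by `Classical.epsilon` returns it. -/
lemma IsGerm.tOf_eq {x y : ℝ} {T : ℝ → ℝ} (H : Branch x y) (G : IsGerm x y T) :
    tOf (alphaOf x y) (betaOf x y) =ᶠ[𝓝 (x * y)] T := by
  have ht0 := t0_param H.lt H.pos
  filter_upwards [G.relation, G.sign_sub, G.tendsto.eventually (gt_mem_nhds H.lt_one),
    G.tendsto.eventually (sign_eventually_eq H.ne_zero), sign_eventually_eq H.mu_ne_zero]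
    with s h1 h2 h3 h4 h5
  rw [sign_mul_pos' H.pos] at h5
  have hT : Corresponds (alphaOf x y) (betaOf x y) s (T s) := by
    refine ⟨h3, h4.trans h5.symm, ?_, ?_⟩
    · rw [ht0, mu_param]; exact h2
    · rw [ht0, mu_param]; exact h1
  obtain ⟨g1, g2, g3, g4⟩ := Classical.epsilon_spec (p := Corresponds (alphaOf x y) (betaOf x y) s)
    ⟨_, hT⟩
  rw [ht0, mu_param] at g3 g4
  refine H.phi_inj g1 h3 (g2.trans h5) h4 (g3.trans h2.symm) ?_
  unfold tOf at *
  linarith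

/-- The operator that produces the functions `p_n`. -/
def stepOp (c : ℝ) (f : ℝ → ℝ) : ℝ → ℝ := fun s => s * deriv (dslope f c) s

lemma stepOp_congr {c : ℝ} {f g : ℝ → ℝ} (h : f =ᶠ[𝓝 c] g) :
    stepOp c f =ᶠ[𝓝 c] stepOp c g := by
  filter_upwards [(dslope_congr h).deriv] with s hs
  rw [stepOp, stepOp, hs]

lemma analyticAt_stepOp {c : ℝ} {f : ℝ → ℝ} (hf : AnalyticAt ℝ f c) :
    AnalyticAt ℝ (stepOp c f) c :=
  analyticAt_id.mul (analyticAt_dslope hf).deriv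

lemma iterate_stepOp_congr {c : ℝ} {f g : ℝ → ℝ} (h : f =ᶠ[𝓝 c] g) (n : ℕ) :
    (stepOp c)^[n] f =ᶠ[𝓝 c] (stepOp c)^[n] g := by
  induction n with
  | zero => exact h
  | succ n ih =>
    rw [Function.iterate_succ_apply', Function.iterate_succ_apply']
    exact stepOp_congr ih

lemma analyticAt_iterate_stepOp {c : ℝ} {f : ℝ → ℝ} (hf : AnalyticAt ℝ f c) (n : ℕ) :
    AnalyticAt ℝ ((stepOp c)^[n] f) c := by
  induction n with
  | zero => exact hf
  | succ n ih =>
    rw [Function.iterate_succ_apply']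
    exact analyticAt_stepOp ih

lemma pFun_eq_iterate (α β : ℝ) (n : ℕ) : pFun α β n = (stepOp (mu α β))^[n] (p α β) := by
  induction n with
  | zero => rfl
  | succ n ih => rw [Function.iterate_succ_apply', ← ih]; rfl

/-- The germ of the function `p`. -/
def germP (T : ℝ → ℝ) : ℝ → ℝ := fun s => s / T s * deriv T s

lemma IsGerm.analyticAt_germP {x y : ℝ} {T : ℝ → ℝ} (H : Branch x y) (G : IsGerm x y T) :
    AnalyticAt ℝ (germP T) (x * y) := by
  refine (analyticAt_id.div G.analytic ?_).mul G.analytic.deriv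
  rw [G.apply_mu]; exact H.ne_zero

lemma IsGerm.p_eq {x y : ℝ} {T : ℝ → ℝ} (H : Branch x y) (G : IsGerm x y T) :
    p (alphaOf x y) (betaOf x y) =ᶠ[𝓝 (x * y)] germP T := by
  have ht := G.tOf_eq H
  have hq : (fun s => s / tOf (alphaOf x y) (betaOf x y) s *
      deriv (tOf (alphaOf x y) (betaOf x y)) s) =ᶠ[𝓝 (x * y)] germP T := by
    filter_upwards [ht, ht.deriv] with s h1 h2
    rw [germP, h1, h2]
  have hlim : limUnder (𝓝[≠] (x * y)) (fun s => s / tOf (alphaOf x y) (betaOf x y) s *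
      deriv (tOf (alphaOf x y) (betaOf x y)) s) = germP T (x * y) := by
    refine Tendsto.limUnder_eq ?_
    have h1 := (G.analyticAt_germP H).continuousAt.tendsto.mono_left
      (nhdsWithin_le_nhds (s := {x * y}ᶜ))
    exact h1.congr' (hq.symm.filter_mono nhdsWithin_le_nhds)
  unfold p
  rw [mu_param, hlim]
  filter_upwards [hq] with s hs
  rcases eq_or_ne s (x * y) with rfl | hne
  · rw [Function.update_self]
  · rw [Function.update_of_ne hne]; exact hs

lemma IsGerm.coeff_eq {x y : ℝ} {T : ℝ → ℝ} (H : Branch x y) (G : IsGerm x y T) (n : ℕ) :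
    coeff (alphaOf x y) (betaOf x y) n = (stepOp (x * y))^[n] (germP T) (x * y) := by
  unfold coeff
  rw [pFun_eq_iterate, mu_param]
  exact (iterate_stepOp_congr (G.p_eq H) n).eq_of_nhds

lemma IsGerm.ode {x y : ℝ} {T : ℝ → ℝ} (H : Branch x y) (G : IsGerm x y T) :
    ∀ᶠ s in 𝓝 (x * y), s * ((T s - x) * (y - T s)) * deriv T s =
      (s - x * y) * (T s * (1 - T s)) := by
  filter_upwards [G.relation.eventually_nhds, G.analytic.eventually_analyticAt,
    G.tendsto.eventually (gt_mem_nhds H.lt_one),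
    G.tendsto.eventually (eventually_ne_nhds H.ne_zero), eventually_ne_nhds H.mu_ne_zero]
    with s h1 h2 h3 h4 h5
  have d1 := ((hasDerivAt_phi x y h4 h3).comp s h2.differentiableAt.hasDerivAt).sub_const
    (phi (alphaOf x y) (betaOf x y) x)
  have d2 := (hasDerivAt_psi x y h5).sub_const (psi (alphaOf x y) (betaOf x y) (x * y))
  have h6 := d1.unique (d2.congr_of_eventuallyEq h1)
  have h7 : 1 - T s ≠ 0 := by linarith
  field_simp at h6
  linarith


/-! ### Mean values of polynomials with respect to the gamma distribution -/

open Polynomial in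
/-- The mean value of a polynomial in `-v`, where `v` has the gamma distribution of shape `-c z`
and rate `z`. -/
def gammaMean (c z : ℝ) (P : ℝ[X]) : ℝ :=
  P.sum fun k r => r * ∏ j ∈ Finset.range k, (c - j / z)

open Polynomial in
lemma gammaMean_add (c z : ℝ) (P Q : ℝ[X]) :
    gammaMean c z (P + Q) = gammaMean c z P + gammaMean c z Q :=
  sum_add_index P Q _ (by simp) (by intros; ring)

open Polynomial in
lemma gammaMean_monomial (c z : ℝ) (k : ℕ) (r : ℝ) :
    gammaMean c z (monomial k r) = r * ∏ j ∈ Finset.range k, (c - j / z) :=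
  sum_monomial_index r (fun k r => r * ∏ j ∈ Finset.range k, (c - j / z)) (by simp)

open Polynomial in
lemma gammaMean_C (c z r : ℝ) : gammaMean c z (C r) = r := by
  rw [← monomial_zero_left, gammaMean_monomial]; simp

open Polynomial in
-- Integration by parts for the gamma density, carried out algebraically on monomials. It is the
-- source of the recursion for `p_n`, and its sign of the factor `(-1)^n`.
lemma gammaMean_sub_mul (c z : ℝ) (Q : ℝ[X]) :
    gammaMean c z ((X - C c) * Q) = -(1 / z) * gammaMean c z (X * derivative Q) := by
  induction Q using Polynomial.induction_on' with
  | add P Q hP hQ =>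
    rw [mul_add, gammaMean_add, hP, hQ, derivative_add, mul_add, gammaMean_add]; ring
  | monomial k r =>
    have e1 : (X - C c) * monomial k r = monomial (k + 1) r + monomial k (-(c * r)) := by
      rw [sub_mul, X_mul_monomial, C_mul_monomial, map_neg, sub_eq_add_neg]
    rw [e1, gammaMean_add, gammaMean_monomial, gammaMean_monomial, derivative_monomial,
      X_mul_monomial, gammaMean_monomial]
    rcases k with _ | k
    · simp; ring
    · rw [Finset.prod_range_succ]
      simp only [Nat.add_sub_cancel]
      ring

open Polynomial in
/-- The operator `stepOp` on polynomials. -/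
def stepPoly (c : ℝ) (P : ℝ[X]) : ℝ[X] := X * derivative (P /ₘ (X - C c))

open Polynomial in
lemma eq_sub_mul_divByMonic (c : ℝ) (P : ℝ[X]) :
    P = (X - C c) * (P /ₘ (X - C c)) + C (P.eval c) := by
  have h := modByMonic_add_div P (X - C c)
  rw [modByMonic_X_sub_C_eq_C_eval] at h
  rw [add_comm]; exact h.symm

open Polynomial in
lemma gammaMean_step (c z : ℝ) (P : ℝ[X]) :
    gammaMean c z P = P.eval c + -(1 / z) * gammaMean c z (stepPoly c P) := by
  conv_lhs => rw [eq_sub_mul_divByMonic c P]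
  rw [gammaMean_add, gammaMean_C, gammaMean_sub_mul, stepPoly]; ring

open Polynomial in
lemma gammaMean_iterate (c z : ℝ) (P : ℝ[X]) (N : ℕ) :
    gammaMean c z P = ∑ n ∈ Finset.range N, (-(1 / z)) ^ n * ((stepPoly c)^[n] P).eval c +
      (-(1 / z)) ^ N * gammaMean c z ((stepPoly c)^[N] P) := by
  induction N with
  | zero => simp
  | succ N ih =>
    rw [ih, Finset.sum_range_succ, gammaMean_step c z ((stepPoly c)^[N] P),
      Function.iterate_succ_apply']
    ring

open Polynomial in
lemma exists_gammaMean_bound (c : ℝ) (P : ℝ[X]) :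
    ∃ C > 0, ∀ z : ℝ, 1 ≤ z → |gammaMean c z P| ≤ C := by
  refine ⟨∑ k ∈ P.support, |P.coeff k| * ∏ j ∈ Finset.range k, (|c| + j) + 1, by positivity,
    fun z hz => ?_⟩
  have hz0 : 0 < z := by linarith
  unfold gammaMean
  rw [Polynomial.sum]
  refine (Finset.abs_sum_le_sum_abs _ _).trans ((Finset.sum_le_sum fun k _ => ?_).trans
    (le_add_of_nonneg_right zero_le_one))
  rw [abs_mul, Finset.abs_prod]
  refine mul_le_mul_of_nonneg_left (Finset.prod_le_prod (fun _ _ => abs_nonneg _) fun j _ => ?_)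
    (abs_nonneg _)
  refine (abs_sub _ _).trans ?_
  gcongr
  rw [abs_of_nonneg (by positivity)]
  exact div_le_self (by positivity) hz

open Polynomial in
lemma stepOp_eval (c : ℝ) (P : ℝ[X]) :
    stepOp c (fun s => P.eval s) = fun s => (stepPoly c P).eval s := by
  have h : dslope (fun s => P.eval s) c = fun s => (P /ₘ (X - C c)).eval s := by
    have e : ∀ s, P.eval s = (s - c) * (P /ₘ (X - C c)).eval s + P.eval c := fun s => by
      conv_lhs => rw [eq_sub_mul_divByMonic c P]
      simp
    ext s
    rcases eq_or_ne s c with rfl | hs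
    · rw [dslope_same]
      have d := ((hasDerivAt_id s).sub_const s).fun_mul ((P /ₘ (X - C s)).hasDerivAt s)
      have d2 := (d.add_const (P.eval s)).congr_of_eventuallyEq (Eventually.of_forall e)
      rw [d2.deriv]; simp
    · rw [dslope_of_ne _ hs, slope_def_field, e s]
      have : s - c ≠ 0 := sub_ne_zero.2 hs
      field_simp
      ring
  ext s
  rw [stepOp, h, stepPoly, eval_mul, eval_X, Polynomial.deriv]

open Polynomial in
lemma iterate_stepOp_eval (c : ℝ) (P : ℝ[X]) (n : ℕ) :
    (stepOp c)^[n] (fun s => P.eval s) = fun s => ((stepPoly c)^[n] P).eval s := by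
  induction n with
  | zero => rfl
  | succ n ih =>
    rw [Function.iterate_succ_apply', ih, stepOp_eval, Function.iterate_succ_apply']

/-! ### Order of vanishing -/

/-- The function `f` vanishes at `c` to order at least `m`. -/
def Vanishes (c : ℝ) (m : ℕ) (f : ℝ → ℝ) : Prop :=
  ∃ k : ℝ → ℝ, AnalyticAt ℝ k c ∧ f =ᶠ[𝓝 c] fun s => (s - c) ^ m * k s

lemma Vanishes.apply_eq_zero {c : ℝ} {m : ℕ} {f : ℝ → ℝ} (h : Vanishes c (m + 1) f) :
    f c = 0 := by
  obtain ⟨k, _, hk⟩ := h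
  rw [hk.eq_of_nhds]; simp

/-- The divided difference and the derivative each cost one order. -/
lemma Vanishes.stepOp {c : ℝ} {m : ℕ} {f : ℝ → ℝ} (h : Vanishes c (m + 2) f) :
    Vanishes c m (stepOp c f) := by
  obtain ⟨k, ak, hk⟩ := h
  refine ⟨fun s => s * ((m + 1 : ℕ) * k s + (s - c) * deriv k s), ?_, ?_⟩
  · exact analyticAt_id.mul ((analyticAt_const.mul ak).add
      ((analyticAt_id.sub analyticAt_const).mul ak.deriv))
  have hd : dslope f c =ᶠ[𝓝 c] fun s => (s - c) ^ (m + 1) * k s := by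
    refine (dslope_congr hk).trans (Eventually.of_forall fun s => ?_)
    rcases eq_or_ne s c with rfl | hs
    · rw [dslope_same]
      have d := (((hasDerivAt_id s).sub_const s).fun_pow (m + 2)).fun_mul
        ak.differentiableAt.hasDerivAt
      simp only [id] at d
      rw [d.deriv]; simp
    · rw [dslope_of_ne _ hs, slope_def_field]
      have : s - c ≠ 0 := sub_ne_zero.2 hs
      field_simp
      simp
      ring
  filter_upwards [hd.deriv, ak.eventually_analyticAt] with s h1 h2
  have d := (((hasDerivAt_id s).sub_const c).fun_pow (m + 1)).fun_mul
        h2.differentiableAt.hasDerivAt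
  simp only [id] at d
  rw [KummerU.stepOp, h1, d.deriv]
  push_cast
  ring_nf

lemma Vanishes.iterate_stepOp {c : ℝ} (n : ℕ) {m : ℕ} {f : ℝ → ℝ}
    (h : Vanishes c (m + 2 * n) f) : Vanishes c m ((KummerU.stepOp c)^[n] f) := by
  induction n generalizing m with
  | zero => exact h
  | succ n ih =>
    rw [Function.iterate_succ_apply']
    exact (ih (m := m + 2) (by convert h using 1; ring)).stepOp

lemma stepOp_add {c : ℝ} {f g : ℝ → ℝ} (hf : AnalyticAt ℝ f c) (hg : AnalyticAt ℝ g c) :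
    stepOp c (fun s => f s + g s) =ᶠ[𝓝 c] fun s => stepOp c f s + stepOp c g s := by
  have h : dslope (fun s => f s + g s) c = fun s => dslope f c s + dslope g c s := by
    ext s
    rcases eq_or_ne s c with rfl | hs
    · rw [dslope_same, dslope_same, dslope_same]
      exact deriv_fun_add hf.differentiableAt hg.differentiableAt
    · simp only [dslope_of_ne _ hs, slope_def_field]; ring
  filter_upwards [(analyticAt_dslope hf).eventually_analyticAt,
    (analyticAt_dslope hg).eventually_analyticAt] with s h1 h2
  unfold stepOp
  rw [h, deriv_fun_add h1.differentiableAt h2.differentiableAt]; ring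

lemma iterate_stepOp_add {c : ℝ} {f g : ℝ → ℝ} (hf : AnalyticAt ℝ f c) (hg : AnalyticAt ℝ g c)
    (n : ℕ) : (stepOp c)^[n] (fun s => f s + g s) =ᶠ[𝓝 c]
      fun s => (stepOp c)^[n] f s + (stepOp c)^[n] g s := by
  induction n with
  | zero => rfl
  | succ n ih =>
    simp only [Function.iterate_succ_apply']
    exact (stepOp_congr ih).trans
      (stepOp_add (analyticAt_iterate_stepOp hf n) (analyticAt_iterate_stepOp hg n))

open Polynomial in
/-- Taylor polynomials, with a bound away from the base point. -/
lemma exists_taylor_poly {c : ℝ} (m : ℕ) {f : ℝ → ℝ} (hf : AnalyticAt ℝ f c) :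
    ∃ P : ℝ[X], Vanishes c m (fun s => f s - P.eval s) ∧
      ∀ δ > 0, ∃ C > 0, ∀ s, δ ≤ |s - c| → |P.eval s| ≤ C * |s - c| ^ m := by
  induction m generalizing f with
  | zero =>
    refine ⟨0, ⟨f, hf, Eventually.of_forall fun s => by simp⟩, fun δ _ => ⟨1, one_pos, fun s _ => ?_⟩⟩
    simp
  | succ m ih =>
    obtain ⟨P, ⟨k, ak, hk⟩, hP⟩ := ih (analyticAt_dslope hf)
    refine ⟨C (f c) + (X - C c) * P, ⟨k, ak, ?_⟩, fun δ hδ => ?_⟩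
    · filter_upwards [hk] with s hs
      rw [sub_mul_dslope f c s]
      simp only [eval_add, eval_C, eval_mul, eval_sub, eval_X]
      linear_combination (s - c) * hs
    · obtain ⟨K, hK, hb⟩ := hP δ hδ
      refine ⟨|f c| / δ ^ (m + 1) + K, by positivity, fun s hs => ?_⟩
      have h1 := hb s hs
      simp only [eval_add, eval_C, eval_mul, eval_sub, eval_X]
      refine (abs_add_le _ _).trans ?_
      rw [abs_mul, add_mul]
      refine add_le_add ?_ ?_
      · rw [div_mul_eq_mul_div, le_div_iff₀ (by positivity)]
        gcongr
      · calc |s - c| * |P.eval s| ≤ |s - c| * (K * |s - c| ^ m) := by gcongr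
          _ = _ := by ring

open Polynomial in
-- After `n ≤ N` steps the power still vanishes at `c`, so the first `N + 1` terms of
-- `gammaMean_iterate` drop out and only the remainder is left.
lemma exists_gammaMean_sub_pow_bound (c : ℝ) (N : ℕ) :
    ∃ C > 0, ∀ z : ℝ, 1 ≤ z →
      |gammaMean c z ((X - Polynomial.C c) ^ (2 * (N + 1)))| ≤ C / z ^ (N + 1) := by
  set P : ℝ[X] := (X - Polynomial.C c) ^ (2 * (N + 1))
  obtain ⟨K, hK, hb⟩ := exists_gammaMean_bound c ((stepPoly c)^[N + 1] P)
  refine ⟨K, hK, fun z hz => ?_⟩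
  have hz0 : 0 < z := by linarith
  have hv : ∀ n ∈ Finset.range (N + 1), (-(1 / z)) ^ n * ((stepPoly c)^[n] P).eval c = 0 := by
    intro n hn
    have hn : n < N + 1 := Finset.mem_range.1 hn
    have h1 : Vanishes c ((2 * (N - n) + 1 + 1) + 2 * n) (fun s => P.eval s) :=
      ⟨fun _ => 1, analyticAt_const, Eventually.of_forall fun s => by
        simp only [P, eval_pow, eval_sub, eval_X, eval_C, mul_one]
        congr 1; omega⟩
    have h2 := h1.iterate_stepOp.apply_eq_zero
    rw [iterate_stepOp_eval] at h2
    beta_reduce at h2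
    rw [h2, mul_zero]
  rw [gammaMean_iterate c z P (N + 1), Finset.sum_eq_zero hv, zero_add, abs_mul, abs_pow, abs_neg,
    abs_of_pos (by positivity), one_div_pow, div_mul_eq_mul_div, one_mul]
  gcongr
  exact hb z hz

open Polynomial in
lemma exists_gammaMean_expansion (c : ℝ) (P : ℝ[X]) (N : ℕ) :
    ∃ C > 0, ∀ z : ℝ, 1 ≤ z →
      |gammaMean c z P - ∑ n ∈ Finset.range (N + 1),
        (-1) ^ n * (((stepPoly c)^[n] P).eval c / z ^ n)| ≤ C / z ^ (N + 1) := by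
  obtain ⟨K, hK, hb⟩ := exists_gammaMean_bound c ((stepPoly c)^[N + 1] P)
  refine ⟨K, hK, fun z hz => ?_⟩
  have hz0 : 0 < z := by linarith
  have e : ∀ n, (-(1 / z)) ^ n * ((stepPoly c)^[n] P).eval c =
      (-1) ^ n * (((stepPoly c)^[n] P).eval c / z ^ n) := fun n => by
    rw [neg_pow, one_div_pow]; ring
  rw [gammaMean_iterate c z P (N + 1)]
  simp only [e]
  rw [add_sub_cancel_left, abs_mul, abs_pow, abs_neg,
    abs_of_pos (by positivity), one_div_pow, div_mul_eq_mul_div, one_mul]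
  gcongr
  exact hb z hz

open Polynomial in
/-- The gamma integral of a polynomial. -/
lemma gamma_integral_poly {ν z : ℝ} (hν : 0 < ν) (hz : 0 < z) (P : ℝ[X]) :
    IntegrableOn (fun v => v ^ (ν * z - 1) * Real.exp (-(z * v)) * P.eval (-v)) (Ioi 0) ∧
    ∫ v in Ioi (0 : ℝ), v ^ (ν * z - 1) * Real.exp (-(z * v)) * P.eval (-v) =
      gammaMean (-ν) z P * (Real.Gamma (ν * z) * z ^ (-(ν * z))) := by
  have hνz : 0 < ν * z := by positivity
  induction P using Polynomial.induction_on' with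
  | add P Q hP hQ =>
    simp only [eval_add, mul_add]
    refine ⟨hP.1.add hQ.1, ?_⟩
    rw [integral_add hP.1 hQ.1, hP.2, hQ.2, gammaMean_add]; ring
  | monomial k r =>
    have e : ∀ v ∈ Ioi (0 : ℝ), v ^ (ν * z - 1) * Real.exp (-(z * v)) *
        (monomial k r).eval (-v) =
        (r * (-1) ^ k) * (v ^ (ν * z + k - 1) * Real.exp (-(z * v))) := by
      intro v hv
      have hv : 0 < v := hv
      rw [eval_monomial, neg_pow, show ν * z + k - 1 = (ν * z - 1) + k by ring, Real.rpow_add hv,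
        Real.rpow_natCast]
      ring
    have hpos : 0 < ν * z + k := by positivity
    constructor
    · refine IntegrableOn.congr_fun ((integrableOn_rpow_mul_exp hpos hz).const_mul
        (r * (-1) ^ k)) (fun v hv => (e v hv).symm) measurableSet_Ioi
    · rw [setIntegral_congr_fun measurableSet_Ioi e, integral_const_mul,
        integral_rpow_mul_exp hpos hz, gammaMean_monomial]
      have hΓ : Real.Gamma (ν * z + k) * z ^ (-(ν * z + k)) =
          (-1) ^ k * (∏ j ∈ Finset.range k, (-ν - j / z)) *
            (Real.Gamma (ν * z) * z ^ (-(ν * z))) := by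
        clear e hpos
        induction k with
        | zero => simp
        | succ k ih =>
          have hpos : 0 < ν * z + k := by positivity
          push_cast
          rw [← add_assoc, Real.Gamma_add_one hpos.ne', Finset.prod_range_succ,
            show -(ν * z + k + 1) = -(ν * z + k) - 1 by ring, Real.rpow_sub_one hz.ne', pow_succ]
          have : (-ν - k / z) = -((ν * z + k) / z) := by field_simp; ring
          rw [this]
          linear_combination ((ν * z + k) / z) * ih
      rw [hΓ]
      have : ((-1 : ℝ) ^ k) * (-1) ^ k = 1 := by
        rw [← mul_pow]; norm_num
      linear_combination (r * (∏ j ∈ Finset.range k, (-ν - j / z)) *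
        (Real.Gamma (ν * z) * z ^ (-(ν * z)))) * this


/-! ### The Laplace integral for fixed parameters -/

/-- With `t = -u` the Kummer-transformed integrand is `e^{zφ(t)}/|t|`; the next lemma is the
analogue for the gamma density and `ψ`. -/
lemma weight_eq_exp_phi (x y : ℝ) {z u : ℝ} (hu : 0 < u) :
    weight (-(x * y) * z) (-(alphaOf x y * z)) z u =
      Real.exp (z * phi (alphaOf x y) (betaOf x y) (-u)) / u := by
  unfold weight phi
  rw [mu_param, Real.rpow_sub_one hu.ne', Real.rpow_def_of_pos hu,
    Real.rpow_def_of_pos (by linarith), Real.log_neg_eq_log, sub_neg_eq_add, ← mul_div_assoc,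
    div_mul_eq_mul_div, ← Real.exp_add, ← Real.exp_add]
  ring_nf

lemma rpow_mul_exp_eq_exp_psi (x y : ℝ) {z v : ℝ} (hv : 0 < v) :
    v ^ (-(x * y) * z - 1) * Real.exp (-(z * v)) =
      Real.exp (z * psi (alphaOf x y) (betaOf x y) (-v)) / v := by
  unfold psi
  rw [mu_param, Real.rpow_sub_one hv.ne', Real.rpow_def_of_pos hv, Real.log_neg_eq_log,
    div_mul_eq_mul_div, ← Real.exp_add]
  ring_nf

lemma expA_eq_sub {x y : ℝ} (H : Branch x y) : expA (alphaOf x y) (betaOf x y) =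
    phi (alphaOf x y) (betaOf x y) x - psi (alphaOf x y) (betaOf x y) (x * y) := by
  rw [expA_param H.lt H.pos, phi, psi, mu_param, Real.log_mul H.ne_zero H.pos.ne']
  ring

lemma phi_strictMonoOn {x y : ℝ} (H : Branch x y) (hx : x < 0) :
    StrictMonoOn (phi (alphaOf x y) (betaOf x y)) (Iic x) := by
  have hy := H.pos
  refine strictMonoOn_of_deriv_pos (convex_Iic x) (fun t ht => ?_) (fun t ht => ?_)
  · have ht : t ≤ x := ht
    exact (hasDerivAt_phi x y (by linarith) (by linarith)).continuousAt.continuousWithinAt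
  · rw [interior_Iic] at ht
    have ht : t < x := ht
    rw [(hasDerivAt_phi x y (by linarith) (by linarith)).deriv]
    exact div_pos_of_neg_of_neg (mul_neg_of_neg_of_pos (by linarith) (by linarith))
      (mul_neg_of_neg_of_pos (by linarith) (by linarith))

lemma phi_strictAntiOn {x y : ℝ} (H : Branch x y) :
    StrictAntiOn (phi (alphaOf x y) (betaOf x y)) (Ico x 0) := by
  have hy := H.pos
  refine strictAntiOn_of_deriv_neg (convex_Ico x 0) (fun t ht => ?_) (fun t ht => ?_)
  · exact (hasDerivAt_phi x y (by linarith [ht.2]) (by linarith [ht.2])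
      ).continuousAt.continuousWithinAt
  · rw [interior_Ico] at ht
    have h1 := ht.1
    have h2 := ht.2
    rw [(hasDerivAt_phi x y (by linarith) (by linarith)).deriv]
    exact div_neg_of_pos_of_neg (mul_pos (by linarith) (by linarith))
      (mul_neg_of_neg_of_pos (by linarith) (by linarith))

/-- Outside a neighbourhood of the saddle point the phase is bounded away from its maximum. -/
lemma exists_phi_gap {x y p q : ℝ} (H : Branch x y) (hx : x < 0) (hp : p < x) (hq : x < q)
    (hq0 : q < 0) : ∃ η > 0, ∀ t < 0, (t ≤ p ∨ q ≤ t) →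
      phi (alphaOf x y) (betaOf x y) t ≤ phi (alphaOf x y) (betaOf x y) x - η := by
  have h1 := phi_strictMonoOn H hx (mem_Iic.2 hp.le) (mem_Iic.2 le_rfl) hp
  have h2 := phi_strictAntiOn H (⟨le_rfl, hx⟩ : x ∈ Ico x 0) ⟨hq.le, hq0⟩ hq
  set Φ := phi (alphaOf x y) (betaOf x y)
  refine ⟨min (Φ x - Φ p) (Φ x - Φ q), lt_min (by linarith) (by linarith), fun t ht0 ht => ?_⟩
  rcases ht with ht | ht
  · have h3 := (phi_strictMonoOn H hx).monotoneOn (mem_Iic.2 (ht.trans hp.le)) (mem_Iic.2 hp.le) ht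
    have := min_le_left (Φ x - Φ p) (Φ x - Φ q)
    linarith
  · have h3 := (phi_strictAntiOn H).antitoneOn (⟨hq.le, hq0⟩ : q ∈ Ico x 0)
      ⟨hq.le.trans ht, ht0⟩ ht
    have := min_le_right (Φ x - Φ p) (Φ x - Φ q)
    linarith

lemma integrableOn_weight_neg {x y z : ℝ} (H : Branch x y) (hx : x < 0) (hz : 0 < z) :
    IntegrableOn (weight (-(x * y) * z) (-(alphaOf x y * z)) z) (Ioi 0) := by
  have : 0 < -(x * y) := by nlinarith [H.pos]
  exact integrableOn_weight (by positivity) hz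

/-- The contribution of the complement of a neighbourhood of the saddle point. -/
lemma exists_tail_bound {x y p q : ℝ} (H : Branch x y) (hx : x < 0) (hp : p < x) (hq : x < q)
    (hq0 : q < 0) : ∃ η > 0, ∃ C > 0, ∀ z : ℝ, 1 ≤ z →
      |(∫ u in Ioi (0 : ℝ), weight (-(x * y) * z) (-(alphaOf x y * z)) z u) -
        ∫ u in (-q)..(-p), weight (-(x * y) * z) (-(alphaOf x y * z)) z u| ≤
      C * Real.exp (z * (phi (alphaOf x y) (betaOf x y) x - η)) := by
  obtain ⟨η, hη, hgap⟩ := exists_phi_gap H hx hp hq hq0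
  set Φ := phi (alphaOf x y) (betaOf x y) with hΦ
  have i1 := integrableOn_weight_neg H hx one_pos
  have hI1 : 0 ≤ ∫ u in Ioi (0 : ℝ), weight (-(x * y) * 1) (-(alphaOf x y * 1)) 1 u :=
    setIntegral_nonneg measurableSet_Ioi fun u hu => (weight_pos hu).le
  refine ⟨η, hη, Real.exp (-(Φ x - η)) *
    ((∫ u in Ioi (0 : ℝ), weight (-(x * y) * 1) (-(alphaOf x y * 1)) 1 u) + 1), by positivity,
    fun z hz => ?_⟩
  have hz0 : 0 < z := by linarith
  have i2 := integrableOn_weight_neg H hx hz0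
  have hqp : -q ≤ -p := by linarith
  have hsub : Ioc (-q) (-p) ⊆ Ioi (0 : ℝ) := fun u hu => by
    have := hu.1; show 0 < u; linarith
  rw [intervalIntegral.integral_of_le hqp, ← setIntegral_sdiff measurableSet_Ioc i2 hsub]
  -- Split `e^{zφ} = e^{(z-1)φ} e^φ`: the gap bounds the first factor, and the second is the
  -- integrable weight at `z = 1`.
  have hb : ∀ u ∈ Ioi (0 : ℝ) \ Ioc (-q) (-p),
      weight (-(x * y) * z) (-(alphaOf x y * z)) z u ≤
      Real.exp ((z - 1) * (Φ x - η)) * weight (-(x * y) * 1) (-(alphaOf x y * 1)) 1 u := by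
    rintro u ⟨hu, hu2⟩
    have hu : 0 < u := hu
    have hcase : -u ≤ p ∨ q ≤ -u := by
      by_contra hc
      push Not at hc
      exact hu2 ⟨by linarith, by linarith⟩
    have h1 := hgap (-u) (by linarith) hcase
    rw [weight_eq_exp_phi x y hu, weight_eq_exp_phi x y hu, ← mul_div_assoc, ← Real.exp_add]
    gcongr
    nlinarith
  have hm : MeasurableSet (Ioi (0 : ℝ) \ Ioc (-q) (-p)) := measurableSet_Ioi.diff measurableSet_Ioc
  have hnn : 0 ≤ ∫ u in Ioi (0 : ℝ) \ Ioc (-q) (-p),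
      weight (-(x * y) * z) (-(alphaOf x y * z)) z u :=
    setIntegral_nonneg hm fun u hu => (weight_pos hu.1).le
  rw [abs_of_nonneg hnn]
  calc _ ≤ ∫ u in Ioi (0 : ℝ) \ Ioc (-q) (-p), Real.exp ((z - 1) * (Φ x - η)) *
        weight (-(x * y) * 1) (-(alphaOf x y * 1)) 1 u :=
        setIntegral_mono_on (i2.mono_set sdiff_subset) ((i1.mono_set sdiff_subset).const_mul _) hm hb
    _ ≤ Real.exp ((z - 1) * (Φ x - η)) * ∫ u in Ioi (0 : ℝ),
        weight (-(x * y) * 1) (-(alphaOf x y * 1)) 1 u := by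
        rw [integral_const_mul]
        refine mul_le_mul_of_nonneg_left ?_ (Real.exp_pos _).le
        refine setIntegral_mono_set i1 ?_ (Eventually.of_forall sdiff_subset)
        exact (ae_restrict_iff' measurableSet_Ioi).2
          (Eventually.of_forall fun u hu => (weight_pos hu).le)
    _ ≤ Real.exp ((z - 1) * (Φ x - η)) * ((∫ u in Ioi (0 : ℝ),
        weight (-(x * y) * 1) (-(alphaOf x y * 1)) 1 u) + 1) := by
        gcongr; linarith
    _ = _ := by
        rw [show (z - 1) * (Φ x - η) = -(Φ x - η) + z * (Φ x - η) by ring, Real.exp_add]; ring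

/-- A lower bound for the gamma integral. -/
lemma exists_gamma_lower_bound {x y η : ℝ} (H : Branch x y) (hx : x < 0) (hη : 0 < η) :
    ∃ c > 0, ∀ z : ℝ, 1 ≤ z →
      c * Real.exp (z * (psi (alphaOf x y) (betaOf x y) (x * y) - η)) ≤
        Real.Gamma (-(x * y) * z) * z ^ (-(-(x * y) * z)) := by
  have hν : 0 < -(x * y) := by nlinarith [H.pos]
  set Ψ := psi (alphaOf x y) (betaOf x y) with hΨ
  have hc : ContinuousAt (fun v => Ψ (-v)) (-(x * y)) := by
    refine ContinuousAt.comp (g := Ψ) (f := fun v => -v) ?_ (by fun_prop)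
    rw [neg_neg]
    exact (hasDerivAt_psi x y H.mu_ne_zero).continuousAt
  have hev : ∀ᶠ v in 𝓝 (-(x * y)), Ψ (x * y) - η < Ψ (-v) ∧ 0 < v := by
    refine (hc.eventually (lt_mem_nhds ?_)).and (lt_mem_nhds hν)
    simp only [neg_neg]; linarith
  obtain ⟨δ, hδ, hball⟩ := Metric.eventually_nhds_iff.1 hev
  set ν := -(x * y) with hνdef
  have hIoo : ∀ v ∈ Ioo ν (ν + δ), Ψ (x * y) - η < Ψ (-v) ∧ 0 < v := fun v hv => by
    refine hball ?_
    rw [Real.dist_eq, abs_of_pos (by linarith [hv.1])]; linarith [hv.2]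
  refine ⟨δ / (ν + δ), by positivity, fun z hz => ?_⟩
  have hz0 : 0 < z := by linarith
  have hνz : 0 < ν * z := by positivity
  rw [← integral_rpow_mul_exp hνz hz0]
  have hint := integrableOn_rpow_mul_exp hνz hz0
  have hsub : Ioo ν (ν + δ) ⊆ Ioi (0 : ℝ) := fun v hv => (hIoo v hv).2
  calc _ = ∫ _ in Ioo ν (ν + δ), Real.exp (z * (Ψ (x * y) - η)) / (ν + δ) := by
        rw [setIntegral_const]
        simp [hδ.le]
        ring
    _ ≤ ∫ v in Ioo ν (ν + δ), v ^ (ν * z - 1) * Real.exp (-(z * v)) := by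
        refine setIntegral_mono_on ?_ (hint.mono_set hsub) measurableSet_Ioo fun v hv => ?_
        · exact integrableOn_const (by simp)
        · obtain ⟨h1, h2⟩ := hIoo v hv
          rw [rpow_mul_exp_eq_exp_psi x y h2]
          have := hv.2
          gcongr
    _ ≤ _ := by
        refine setIntegral_mono_set hint ?_ (Eventually.of_forall hsub)
        refine (ae_restrict_iff' measurableSet_Ioi).2 (Eventually.of_forall fun u hu => ?_)
        have hu : (0 : ℝ) < u := hu
        simp only [Pi.zero_apply]
        positivity

/-- Change of variables near the saddle point. -/
lemma integral_change_of_variables {x y δ : ℝ} {T : ℝ → ℝ} (H : Branch x y) (hδ : 0 < δ)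
    (hT : ∀ s, |s - x * y| ≤ δ → s < 0 ∧ AnalyticAt ℝ T s ∧ T s < 0 ∧
      phi (alphaOf x y) (betaOf x y) (T s) - phi (alphaOf x y) (betaOf x y) x =
        psi (alphaOf x y) (betaOf x y) s - psi (alphaOf x y) (betaOf x y) (x * y)) (z : ℝ) :
    ∫ u in (-T (x * y + δ))..(-T (x * y - δ)),
        weight (-(x * y) * z) (-(alphaOf x y * z)) z u =
      Real.exp (z * expA (alphaOf x y) (betaOf x y)) *
        ∫ v in (-(x * y) - δ)..(-(x * y) + δ),
          v ^ (-(x * y) * z - 1) * Real.exp (-(z * v)) * germP T (-v) := by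
  have hmem : ∀ v ∈ uIcc (-(x * y) - δ) (-(x * y) + δ), |-v - x * y| ≤ δ := by
    intro v hv
    rw [uIcc_of_le (by linarith)] at hv
    rw [abs_le]; constructor <;> linarith [hv.1, hv.2]
  have hd : ∀ v ∈ uIcc (-(x * y) - δ) (-(x * y) + δ),
      HasDerivAt (fun v => -T (-v)) (deriv T (-v)) v := by
    intro v hv
    obtain ⟨_, h2, _, _⟩ := hT _ (hmem v hv)
    have := (h2.differentiableAt.hasDerivAt.comp v (hasDerivAt_neg v)).fun_neg
    refine this.congr_deriv ?_
    ring
  have hcd : ContinuousOn (fun v => deriv T (-v)) (uIcc (-(x * y) - δ) (-(x * y) + δ)) := by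
    intro v hv
    obtain ⟨_, h2, _, _⟩ := hT _ (hmem v hv)
    exact (ContinuousAt.comp (g := deriv T) (f := fun v => -v) h2.deriv.continuousAt
      (by fun_prop)).continuousWithinAt
  -- The substitution is `u = -T(-v)`; the quotient `v T'(-v)/u` that it creates is `p(-v)`.
  have key := intervalIntegral.integral_comp_mul_deriv' (a := -(x * y) - δ) (b := -(x * y) + δ)
    (f := fun v => -T (-v)) (f' := fun v => deriv T (-v))
    (g := weight (-(x * y) * z) (-(alphaOf x y * z)) z) hd hcd ?_
  · have e1 : -(-(x * y) - δ) = x * y + δ := by ring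
    have e2 : -(-(x * y) + δ) = x * y - δ := by ring
    simp only [e1, e2] at key
    rw [← key, ← intervalIntegral.integral_const_mul]
    refine intervalIntegral.integral_congr fun v hv => ?_
    obtain ⟨h1, h2, h3, h4⟩ := hT _ (hmem v hv)
    have hv0 : 0 < v := by linarith
    have hu0 : 0 < -T (-v) := by linarith
    have hT0 : T (-v) ≠ 0 := by linarith
    simp only [Function.comp_apply]
    rw [weight_eq_exp_phi x y hu0, rpow_mul_exp_eq_exp_psi x y hv0, neg_neg]
    have e : phi (alphaOf x y) (betaOf x y) (T (-v)) = expA (alphaOf x y) (betaOf x y) +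
        psi (alphaOf x y) (betaOf x y) (-v) := by
      rw [expA_eq_sub H]; linarith
    rw [e, mul_add, Real.exp_add, germP]
    field_simp
  · rintro _ ⟨v, hv, rfl⟩
    obtain ⟨h1, h2, h3, h4⟩ := hT _ (hmem v hv)
    have hu0 : 0 < -T (-v) := by linarith
    exact ((continuousOn_weight _ _ z).continuousAt (Ioi_mem_nhds hu0)).continuousWithinAt

open Polynomial in
/-- Comparison of a local integral with the mean value of a Taylor polynomial. -/
lemma abs_integral_sub_gammaMean_le {c δ z K : ℝ} {m : ℕ} {f : ℝ → ℝ} {P : ℝ[X]} (hc : c < 0)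
    (hδ : 0 < δ) (hδc : δ ≤ -c) (hz : 0 < z) (hf : ∀ s, |s - c| ≤ δ → ContinuousAt f s)
    (h1 : ∀ s, |s - c| ≤ δ → |f s - P.eval s| ≤ K * |s - c| ^ (2 * m))
    (h2 : ∀ s, δ ≤ |s - c| → |P.eval s| ≤ K * |s - c| ^ (2 * m)) :
    |(∫ v in (-c - δ)..(-c + δ), v ^ (-c * z - 1) * Real.exp (-(z * v)) * f (-v)) -
      gammaMean c z P * (Real.Gamma (-c * z) * z ^ (-(-c * z)))| ≤
    K * (gammaMean c z ((X - C c) ^ (2 * m)) * (Real.Gamma (-c * z) * z ^ (-(-c * z)))) := by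
  have hν : 0 < -c := by linarith
  obtain ⟨i1, e1⟩ := gamma_integral_poly hν hz P
  obtain ⟨i2, e2⟩ := gamma_integral_poly hν hz ((X - C c) ^ (2 * m))
  rw [neg_neg] at e1 e2
  have hsub : Ioc (-c - δ) (-c + δ) ⊆ Ioi (0 : ℝ) := fun v hv => by
    have := hv.1
    show 0 < v
    linarith
  have hmem : ∀ v ∈ Ioc (-c - δ) (-c + δ), |-v - c| ≤ δ := fun v hv => by
    rw [abs_le]; constructor <;> linarith [hv.1, hv.2]
  set w : ℝ → ℝ := fun v => v ^ (-c * z - 1) * Real.exp (-(z * v)) with hw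
  have hw0 : ∀ v ∈ Ioi (0 : ℝ), 0 ≤ w v := fun v hv => by
    have hv : 0 < v := hv
    simp only [hw]; positivity
  have hiw : IntegrableOn w (Ioi 0) := integrableOn_rpow_mul_exp (by positivity) hz
  have hfc : ContinuousOn (fun v => f (-v)) (Icc (-c - δ) (-c + δ)) := fun v hv =>
    (ContinuousAt.comp (g := f) (f := fun v => -v) (hf _ (by
      rw [abs_le]; constructor <;> linarith [hv.1, hv.2])) (by fun_prop)).continuousWithinAt
  have i3 : IntegrableOn (fun v => w v * f (-v)) (Ioc (-c - δ) (-c + δ)) := by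
    obtain ⟨M, hM⟩ := isCompact_Icc.exists_bound_of_continuousOn hfc
    refine Integrable.mono' ((hiw.mono_set hsub).const_mul M) ?_ ?_
    · exact (hiw.mono_set hsub).aestronglyMeasurable.mul
        ((hfc.mono Ioc_subset_Icc_self).aestronglyMeasurable measurableSet_Ioc)
    · refine (ae_restrict_iff' measurableSet_Ioc).2 (Eventually.of_forall fun v hv => ?_)
      rw [norm_mul, Real.norm_of_nonneg (hw0 v (hsub hv)), mul_comm]
      exact mul_le_mul_of_nonneg_right (hM v (Ioc_subset_Icc_self hv)) (hw0 v (hsub hv))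
  have i4 : IntegrableOn ((Ioc (-c - δ) (-c + δ)).indicator fun v => w v * f (-v)) (Ioi 0) :=
    (i3.integrable_indicator measurableSet_Ioc).integrableOn
  rw [intervalIntegral.integral_of_le (by linarith), ← e1, ← e2]
  have e3 : ∫ v in Ioc (-c - δ) (-c + δ), w v * f (-v) =
      ∫ v in Ioi (0 : ℝ), (Ioc (-c - δ) (-c + δ)).indicator (fun v => w v * f (-v)) v := by
    rw [setIntegral_indicator measurableSet_Ioc, inter_eq_right.2 hsub]
  rw [e3, ← integral_sub i4 i1, ← integral_const_mul, ← Real.norm_eq_abs]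
  refine norm_integral_le_of_norm_le (i2.const_mul K) ?_
  refine (ae_restrict_iff' measurableSet_Ioi).2 (Eventually.of_forall fun v hv => ?_)
  have hwv := hw0 v hv
  have hsq : ∀ s : ℝ, ((X - C c) ^ (2 * m) : ℝ[X]).eval s = |s - c| ^ (2 * m) := fun s => by
    rw [pow_mul |s - c|, sq_abs, ← pow_mul]; simp
  rw [hsq, Real.norm_eq_abs]
  by_cases hvI : v ∈ Ioc (-c - δ) (-c + δ)
  · rw [indicator_of_mem hvI]
    have := h1 (-v) (hmem v hvI)
    calc _ = w v * |f (-v) - P.eval (-v)| := by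
          rw [← mul_sub, abs_mul, abs_of_nonneg hwv]
      _ ≤ w v * (K * |-v - c| ^ (2 * m)) := by gcongr
      _ = _ := by ring
  · rw [indicator_of_notMem hvI, zero_sub, abs_neg, abs_mul, abs_of_nonneg hwv]
    have hle : δ ≤ |-v - c| := by
      by_contra hcon
      push Not at hcon
      rw [abs_lt] at hcon
      exact hvI ⟨by linarith, by linarith⟩
    calc _ ≤ w v * (K * |-v - c| ^ (2 * m)) := by gcongr; exact h2 (-v) hle
      _ = _ := by ring

lemma exp_neg_le_div_pow {η z : ℝ} (hη : 0 < η) (hz : 0 < z) (n : ℕ) :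
    Real.exp (-(z * η)) ≤ n.factorial / η ^ n / z ^ n := by
  have h := Real.pow_div_factorial_le_exp (z * η) (by positivity) n
  rw [Real.exp_neg, div_div, inv_le_comm₀ (Real.exp_pos _) (by positivity), inv_div, ← mul_pow,
    mul_comm η z]
  exact h

open Polynomial in
/-- Expansion of the Laplace integral for fixed parameters. -/
lemma exists_laplace_expansion {x y : ℝ} (H : Branch x y) (hx : x < 0) (N : ℕ) :
    ∃ C > 0, ∀ z : ℝ, 1 ≤ z →
      |(∫ u in Ioi (0 : ℝ), weight (-(x * y) * z) (-(alphaOf x y * z)) z u) -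
        Real.exp (z * expA (alphaOf x y) (betaOf x y)) *
          (Real.Gamma (-(x * y) * z) * z ^ (-(-(x * y) * z))) *
          ∑ n ∈ Finset.range (N + 1),
            (-1) ^ n * (coeff (alphaOf x y) (betaOf x y) n / z ^ n)| ≤
      C * (Real.exp (z * expA (alphaOf x y) (betaOf x y)) *
          (Real.Gamma (-(x * y) * z) * z ^ (-(-(x * y) * z)))) / z ^ (N + 1) := by
  obtain ⟨T, G⟩ := H.exists_germ
  have hν : 0 < -(x * y) := by nlinarith [H.pos]
  obtain ⟨P, ⟨k, ak, hk⟩, hP⟩ := exists_taylor_poly (2 * (N + 1)) (G.analyticAt_germP H)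
  have hkb : ∀ᶠ s in 𝓝 (x * y), |k s| ≤ |k (x * y)| + 1 :=
    ak.continuousAt.abs.eventually (Iic_mem_nhds (lt_add_one _))
  have hev := (((((G.relation.and G.sign_sub).and G.analytic.eventually_analyticAt).and
    (G.tendsto.eventually (gt_mem_nhds hx))).and
    (hkb.and hk)).and ((G.analyticAt_germP H).eventually_analyticAt)).and
    (gt_mem_nhds (show x * y < 0 by linarith))
  obtain ⟨ε, hε, hball⟩ := Metric.eventually_nhds_iff.1 hev
  set δ := ε / 2 with hδdef
  have hδ : 0 < δ := by positivity
  have hδε : δ < ε := half_lt_self hε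
  have hall := fun s (hs : |s - x * y| ≤ δ) =>
    @hball s (by rw [Real.dist_eq]; exact hs.trans_lt hδε)
  obtain ⟨K, hK, hPb⟩ := hP δ hδ
  have hp : T (x * y - δ) < x := by
    have := (hall (x * y - δ) (by simp [abs_of_pos hδ])).1.1.1.1.1.2
    rw [sub_sub_cancel_left, sign_neg (by linarith : -δ < 0), sign_eq_neg_one_iff] at this
    linarith
  have hq : x < T (x * y + δ) := by
    have := (hall (x * y + δ) (by simp [abs_of_pos hδ])).1.1.1.1.1.2
    rw [add_sub_cancel_left, sign_pos hδ, sign_eq_one_iff] at this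
    linarith
  have hq0 : T (x * y + δ) < 0 := (hall (x * y + δ) (by simp [abs_of_pos hδ])).1.1.1.2
  have hδc : δ ≤ -(x * y) := by
    have := (hall (x * y + δ) (by simp [abs_of_pos hδ])).2
    linarith
  obtain ⟨η, hη, C₁, hC₁, htail⟩ := exists_tail_bound H hx hp hq hq0
  -- Only half of the gap is spent on the lower bound; the other half makes the tail exponentially
  -- small relative to the gamma integral.
  obtain ⟨c₀, hc₀, hlow⟩ := exists_gamma_lower_bound H hx (half_pos hη)
  obtain ⟨C₂, hC₂, hm⟩ := exists_gammaMean_sub_pow_bound (x * y) N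
  obtain ⟨C₃, hC₃, hm3⟩ := exists_gammaMean_expansion (x * y) P N
  set F : ℝ := ((N + 1).factorial : ℝ) / (η / 2) ^ (N + 1) with hF
  have hF0 : 0 < F := by positivity
  set K' := max K (|k (x * y)| + 1) with hK'
  have hK'0 : 0 < K' := lt_max_of_lt_left hK
  refine ⟨C₁ / c₀ * F + K' * C₂ + C₃, by positivity, fun z hz => ?_⟩
  have hz0 : 0 < z := by linarith
  have hT : ∀ s, |s - x * y| ≤ δ → s < 0 ∧ AnalyticAt ℝ T s ∧ T s < 0 ∧
      phi (alphaOf x y) (betaOf x y) (T s) - phi (alphaOf x y) (betaOf x y) x =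
        psi (alphaOf x y) (betaOf x y) s - psi (alphaOf x y) (betaOf x y) (x * y) := fun s hs =>
    ⟨(hall s hs).2, (hall s hs).1.1.1.1.2, (hall s hs).1.1.1.2, (hall s hs).1.1.1.1.1.1⟩
  have t1 := htail z hz
  rw [integral_change_of_variables H hδ hT z] at t1
  have t2 := abs_integral_sub_gammaMean_le (c := x * y) (z := z) (K := K') (m := N + 1)
    (f := germP T) (P := P) (by linarith) hδ hδc hz0 (fun s hs => (hall s hs).1.2.continuousAt)
    (fun s hs => by
      obtain ⟨hk1, hk2⟩ := (hall s hs).1.1.2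
      beta_reduce at hk2
      rw [hk2, abs_mul, abs_pow, mul_comm]
      gcongr
      exact hk1.trans (le_max_right _ _))
    (fun s hs => (hPb s hs).trans (by gcongr; exact le_max_left _ _))
  have t3 := hm3 z hz
  -- The germ and its Taylor polynomial differ to order `2(N + 1)`, and `n ≤ N` steps lose `2n`
  -- orders, so the values at `μ` agree.
  have hcoef : ∀ n ∈ Finset.range (N + 1), ((stepPoly (x * y))^[n] P).eval (x * y) =
      coeff (alphaOf x y) (betaOf x y) n := by
    intro n hn
    have hn : n < N + 1 := Finset.mem_range.1 hn
    have hv : Vanishes (x * y) ((2 * (N - n) + 1 + 1) + 2 * n)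
        (fun s => germP T s - P.eval s) := ⟨k, ak, by
          have : 2 * (N - n) + 1 + 1 + 2 * n = 2 * (N + 1) := by omega
          rw [this]; exact hk⟩
    have h0 := hv.iterate_stepOp.apply_eq_zero
    have aP : AnalyticAt ℝ (fun s => P.eval s) (x * y) := by
      have := AnalyticAt.aeval_polynomial (analyticAt_id (𝕜 := ℝ) (z := x * y)) P
      simpa [Polynomial.aeval_def, Polynomial.eval₂_eq_eval_map] using this
    have hadd := (iterate_stepOp_add ((G.analyticAt_germP H).sub aP) aP n).eq_of_nhds
    rw [G.coeff_eq H n]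
    have e : (fun s => (germP T - fun s => P.eval s) s + P.eval s) = germP T := by
      ext s; simp
    rw [e] at hadd
    rw [hadd, iterate_stepOp_eval]
    have h0' : (stepOp (x * y))^[n] (germP T - fun s => P.eval s) (x * y) = 0 := h0
    rw [h0', zero_add]
  rw [Finset.sum_congr rfl (fun n hn => by rw [hcoef n hn])] at t3
  set Γz := Real.Gamma (-(x * y) * z) * z ^ (-(-(x * y) * z)) with hΓz
  have hΓ0 : 0 < Γz := by
    have : 0 < Real.Gamma (-(x * y) * z) := Real.Gamma_pos_of_pos (by positivity)
    positivity
  set A := expA (alphaOf x y) (betaOf x y) with hA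
  set Sm := ∑ n ∈ Finset.range (N + 1), (-1) ^ n * (coeff (alphaOf x y) (betaOf x y) n / z ^ n)
  set I := ∫ u in Ioi (0 : ℝ), weight (-(x * y) * z) (-(alphaOf x y * z)) z u
  set J := ∫ v in (-(x * y) - δ)..(-(x * y) + δ),
          v ^ (-(x * y) * z - 1) * Real.exp (-(z * v)) * germP T (-v)
  set g := gammaMean (x * y) z P
  have b1 : |I - Real.exp (z * A) * J| ≤ C₁ / c₀ * F * (Real.exp (z * A) * Γz) / z ^ (N + 1) := by
    have l1 := hlow z hz
    have l2 := exp_neg_le_div_pow (half_pos hη) hz0 (N + 1)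
    rw [← hF] at l2
    refine t1.trans ?_
    have e : Real.exp (z * (phi (alphaOf x y) (betaOf x y) x - η)) = Real.exp (z * A) *
        (Real.exp (z * (psi (alphaOf x y) (betaOf x y) (x * y) - η / 2)) *
          Real.exp (-(z * (η / 2)))) := by
      rw [← Real.exp_add, ← Real.exp_add, hA, expA_eq_sub H]; ring_nf
    rw [e]
    have l3 : Real.exp (z * (psi (alphaOf x y) (betaOf x y) (x * y) - η / 2)) ≤ Γz / c₀ := by
      rw [le_div_iff₀' hc₀]; exact l1
    calc _ ≤ C₁ * (Real.exp (z * A) * (Γz / c₀ * (F / z ^ (N + 1)))) := by gcongr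
      _ = _ := by ring
  have b2 : |J - g * Γz| ≤ K' * C₂ * Γz / z ^ (N + 1) := by
    refine t2.trans ?_
    have := (le_abs_self _).trans (hm z hz)
    calc _ ≤ K' * (C₂ / z ^ (N + 1) * Γz) := by gcongr
      _ = _ := by ring
  have hE := Real.exp_pos (z * A)
  calc |I - Real.exp (z * A) * Γz * Sm|
      = |(I - Real.exp (z * A) * J) + Real.exp (z * A) * (J - g * Γz) +
          Real.exp (z * A) * Γz * (g - Sm)| := by ring_nf
    _ ≤ |I - Real.exp (z * A) * J| + Real.exp (z * A) * |J - g * Γz| +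
          Real.exp (z * A) * Γz * |g - Sm| := by
        refine (abs_add_three _ _ _).trans_eq ?_
        rw [abs_mul, abs_mul (Real.exp (z * A) * Γz), abs_of_pos hE, abs_of_pos (by positivity :
          0 < Real.exp (z * A) * Γz)]
    _ ≤ C₁ / c₀ * F * (Real.exp (z * A) * Γz) / z ^ (N + 1) +
          Real.exp (z * A) * (K' * C₂ * Γz / z ^ (N + 1)) +
          Real.exp (z * A) * Γz * (C₃ / z ^ (N + 1)) := by gcongr
    _ = _ := by ring


/-! ### Taylor series -/

/-- The Taylor series of `f` at `c`. -/
def taylor (f : ℝ → ℝ) (c : ℝ) : PowerSeries ℝ :=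
  PowerSeries.mk fun n => iteratedDeriv n f c / n.factorial

lemma coeff_taylor (f : ℝ → ℝ) (c : ℝ) (n : ℕ) :
    PowerSeries.coeff n (taylor f c) = iteratedDeriv n f c / n.factorial :=
  PowerSeries.coeff_mk _ _

lemma coeff_zero_taylor (f : ℝ → ℝ) (c : ℝ) : PowerSeries.coeff 0 (taylor f c) = f c := by
  simp [coeff_taylor]

lemma constantCoeff_taylor (f : ℝ → ℝ) (c : ℝ) :
    PowerSeries.constantCoeff (taylor f c) = f c := by
  rw [← PowerSeries.coeff_zero_eq_constantCoeff_apply, coeff_zero_taylor]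

lemma taylor_congr {f g : ℝ → ℝ} {c : ℝ} (h : f =ᶠ[𝓝 c] g) : taylor f c = taylor g c := by
  ext n
  rw [coeff_taylor, coeff_taylor, h.iteratedDeriv_eq]

lemma taylor_const (a c : ℝ) : taylor (fun _ => a) c = PowerSeries.C a := by
  ext n
  rw [coeff_taylor, iteratedDeriv_const, PowerSeries.coeff_C]
  split_ifs with h
  · simp [h]
  · simp

lemma taylor_deriv (f : ℝ → ℝ) (c : ℝ) :
    taylor (deriv f) c = PowerSeries.derivative ℝ (taylor f c) := by
  ext n
  rw [PowerSeries.coeff_derivative, coeff_taylor, coeff_taylor, iteratedDeriv_succ',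
    Nat.factorial_succ]
  push_cast
  field_simp

lemma taylor_add {f g : ℝ → ℝ} {c : ℝ} (hf : AnalyticAt ℝ f c) (hg : AnalyticAt ℝ g c) :
    taylor (fun s => f s + g s) c = taylor f c + taylor g c := by
  ext n
  rw [map_add, coeff_taylor, coeff_taylor, coeff_taylor,
    iteratedDeriv_fun_add hf.contDiffAt hg.contDiffAt, add_div]

lemma taylor_sub {f g : ℝ → ℝ} {c : ℝ} (hf : AnalyticAt ℝ f c) (hg : AnalyticAt ℝ g c) :
    taylor (fun s => f s - g s) c = taylor f c - taylor g c := by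
  ext n
  rw [map_sub, coeff_taylor, coeff_taylor, coeff_taylor,
    iteratedDeriv_fun_sub hf.contDiffAt hg.contDiffAt, sub_div]

lemma taylor_mul {f g : ℝ → ℝ} {c : ℝ} (hf : AnalyticAt ℝ f c) (hg : AnalyticAt ℝ g c) :
    taylor (fun s => f s * g s) c = taylor f c * taylor g c := by
  ext n
  rw [PowerSeries.coeff_mul, coeff_taylor, iteratedDeriv_fun_mul hf.contDiffAt hg.contDiffAt,
    Finset.Nat.sum_antidiagonal_eq_sum_range_succ_mk, Finset.sum_div]
  refine Finset.sum_congr rfl fun k hk => ?_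
  have hk : k ≤ n := Nat.lt_succ_iff.1 (Finset.mem_range.1 hk)
  rw [coeff_taylor, coeff_taylor, Nat.cast_choose ℝ hk]
  have := n.factorial_ne_zero
  field_simp

lemma taylor_id (c : ℝ) : taylor (fun s => s) c = PowerSeries.C c + PowerSeries.X := by
  ext n
  rw [coeff_taylor, map_add, PowerSeries.coeff_C, PowerSeries.coeff_X]
  rcases n with _ | n
  · simp
  · rw [iteratedDeriv_succ']
    have : deriv (fun s : ℝ => s) = fun _ => (1 : ℝ) := by ext s; simp
    rw [this, iteratedDeriv_const]
    rcases n with _ | n <;> simp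

lemma taylor_dslope {f : ℝ → ℝ} {c : ℝ} (hf : AnalyticAt ℝ f c) :
    taylor f c = PowerSeries.C (f c) + PowerSeries.X * taylor (dslope f c) c := by
  have hs : AnalyticAt ℝ (fun s : ℝ => s - c) c := analyticAt_id.sub analyticAt_const
  have h1 : taylor f c = taylor (fun s => f c + (s - c) * dslope f c s) c :=
    taylor_congr (Eventually.of_forall fun s => sub_mul_dslope f c s)
  rw [h1, taylor_add analyticAt_const (hs.fun_mul (analyticAt_dslope hf)), taylor_const,
    taylor_mul hs (analyticAt_dslope hf), taylor_sub (f := fun s => s) analyticAt_id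
    analyticAt_const, taylor_const, taylor_id]
  ring

lemma coeff_taylor_dslope {f : ℝ → ℝ} {c : ℝ} (hf : AnalyticAt ℝ f c) (n : ℕ) :
    PowerSeries.coeff n (taylor (dslope f c) c) = PowerSeries.coeff (n + 1) (taylor f c) := by
  rw [taylor_dslope hf, map_add, PowerSeries.coeff_succ_X_mul, PowerSeries.coeff_C]
  simp

lemma taylor_stepOp {f : ℝ → ℝ} {c : ℝ} (hf : AnalyticAt ℝ f c) :
    taylor (stepOp c f) c = (PowerSeries.C c + PowerSeries.X) *
      PowerSeries.derivative ℝ (taylor (dslope f c) c) := by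
  rw [← taylor_deriv, ← taylor_id, ← taylor_mul (f := fun s => s) analyticAt_id
    (analyticAt_dslope hf).deriv]
  rfl

/-! ### Rational dependence on a parameter -/

/-- The functions that depend rationally on `ρ`, without poles. -/
def ratFun {ι : Type*} (ρ : ι → ℝ) : Subring (ι → ℝ) where
  carrier := {f | ∃ P Q : Polynomial ℝ, ∀ i, Q.eval (ρ i) ≠ 0 ∧ f i = P.eval (ρ i) / Q.eval (ρ i)}
  mul_mem' := by
    rintro f g ⟨P, Q, h⟩ ⟨P', Q', h'⟩
    refine ⟨P * P', Q * Q', fun i => ?_⟩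
    rw [Polynomial.eval_mul, Polynomial.eval_mul, Pi.mul_apply, (h i).2, (h' i).2,
      div_mul_div_comm]
    exact ⟨mul_ne_zero (h i).1 (h' i).1, rfl⟩
  one_mem' := ⟨1, 1, fun i => by simp⟩
  add_mem' := by
    rintro f g ⟨P, Q, h⟩ ⟨P', Q', h'⟩
    refine ⟨P * Q' + Q * P', Q * Q', fun i => ?_⟩
    rw [Polynomial.eval_add, Polynomial.eval_mul, Polynomial.eval_mul, Polynomial.eval_mul,
      Pi.add_apply, (h i).2, (h' i).2, div_add_div _ _ (h i).1 (h' i).1]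
    exact ⟨mul_ne_zero (h i).1 (h' i).1, rfl⟩
  zero_mem' := ⟨0, 1, fun i => by simp⟩
  neg_mem' := by
    rintro f ⟨P, Q, h⟩
    refine ⟨-P, Q, fun i => ⟨(h i).1, ?_⟩⟩
    rw [Polynomial.eval_neg, Pi.neg_apply, (h i).2, neg_div]

section RatFun

variable {ι : Type*} {ρ : ι → ℝ}

lemma const_mem_ratFun (a : ℝ) : (fun _ => a) ∈ ratFun ρ :=
  ⟨Polynomial.C a, 1, fun i => by simp⟩

lemma self_mem_ratFun : ρ ∈ ratFun ρ := ⟨Polynomial.X, 1, fun i => by simp⟩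

lemma div_mem_ratFun {f g : ι → ℝ} (hf : f ∈ ratFun ρ) (hg : g ∈ ratFun ρ) (h0 : ∀ i, g i ≠ 0) :
    (fun i => f i / g i) ∈ ratFun ρ := by
  obtain ⟨P, Q, h⟩ := hf
  obtain ⟨P', Q', h'⟩ := hg
  refine ⟨P * Q', Q * P', fun i => ?_⟩
  have := (h' i).2 ▸ h0 i
  beta_reduce
  rw [Polynomial.eval_mul, Polynomial.eval_mul, (h i).2, (h' i).2, div_div_div_eq]
  exact ⟨mul_ne_zero (h i).1 (fun h1 => this (by rw [h1, zero_div])), rfl⟩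

/-- Rational functions that agree for infinitely many values of the parameter are equal. -/
lemma eq_of_ratFun {f g : ι → ℝ} (hf : f ∈ ratFun ρ) (hg : g ∈ ratFun ρ) {s : Set ι}
    (hs : s.Infinite) (hρ : InjOn ρ s) (h : ∀ i ∈ s, f i = g i) : f = g := by
  obtain ⟨P, Q, hPQ⟩ := hf
  obtain ⟨P', Q', hPQ'⟩ := hg
  have h0 : P * Q' = P' * Q := by
    refine Polynomial.eq_of_infinite_eval_eq _ _ ((hs.image hρ).mono ?_)
    rintro _ ⟨i, hi, rfl⟩
    have := h i hi
    rw [(hPQ i).2, (hPQ' i).2, div_eq_div_iff (hPQ i).1 (hPQ' i).1] at this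
    rw [mem_ofPred_eq, Polynomial.eval_mul, Polynomial.eval_mul, this]
  ext i
  rw [(hPQ i).2, (hPQ' i).2, div_eq_div_iff (hPQ i).1 (hPQ' i).1, ← Polynomial.eval_mul,
    ← Polynomial.eval_mul, h0]

/-- All coefficients of the power series depend rationally on the parameter. -/
def RatCoeffs (ρ : ι → ℝ) (F : ι → PowerSeries ℝ) : Prop :=
  ∀ n, (fun i => PowerSeries.coeff n (F i)) ∈ ratFun ρ

lemma RatCoeffs.add {F G : ι → PowerSeries ℝ} (hF : RatCoeffs ρ F) (hG : RatCoeffs ρ G) :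
    RatCoeffs ρ (fun i => F i + G i) := fun n => by
  simp only [map_add]
  exact (ratFun ρ).add_mem (hF n) (hG n)

lemma RatCoeffs.sub {F G : ι → PowerSeries ℝ} (hF : RatCoeffs ρ F) (hG : RatCoeffs ρ G) :
    RatCoeffs ρ (fun i => F i - G i) := fun n => by
  simp only [map_sub]
  exact (ratFun ρ).sub_mem (hF n) (hG n)

lemma RatCoeffs.mul {F G : ι → PowerSeries ℝ} (hF : RatCoeffs ρ F) (hG : RatCoeffs ρ G) :
    RatCoeffs ρ (fun i => F i * G i) := fun n => by
  have h : (∑ q ∈ Finset.HasAntidiagonal.antidiagonal n, (fun i => PowerSeries.coeff q.1 (F i)) *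
      (fun i => PowerSeries.coeff q.2 (G i))) ∈ ratFun ρ :=
    (ratFun ρ).sum_mem fun q _ => (ratFun ρ).mul_mem (hF q.1) (hG q.2)
  convert h using 1
  ext i
  rw [PowerSeries.coeff_mul, Finset.sum_apply]
  rfl

lemma ratCoeffs_C {f : ι → ℝ} (hf : f ∈ ratFun ρ) : RatCoeffs ρ (fun i => PowerSeries.C (f i)) :=
  fun n => by
    rcases n with _ | n
    · simpa [PowerSeries.coeff_C] using hf
    · simpa [PowerSeries.coeff_C] using const_mem_ratFun (ρ := ρ) 0

lemma ratCoeffs_X : RatCoeffs ρ (fun _ => PowerSeries.X) := fun _ => const_mem_ratFun _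

lemma RatCoeffs.derivative {F : ι → PowerSeries ℝ} (hF : RatCoeffs ρ F) :
    RatCoeffs ρ (fun i => PowerSeries.derivative ℝ (F i)) := fun n => by
  simp only [PowerSeries.coeff_derivative]
  exact (ratFun ρ).mul_mem (hF (n + 1)) (const_mem_ratFun ((n : ℝ) + 1))

/-- Division of power series solves for one coefficient at a time, dividing only by the constant
term of the divisor. -/
lemma RatCoeffs.of_mul {F G : ι → PowerSeries ℝ} (hFG : RatCoeffs ρ (fun i => F i * G i))
    (hG : RatCoeffs ρ G) (h0 : ∀ i, PowerSeries.coeff 0 (G i) ≠ 0) : RatCoeffs ρ F := by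
  intro n
  induction n using Nat.strong_induction_on with
  | _ n ih =>
    have h1 : (∑ k ∈ Finset.range n, (fun i => PowerSeries.coeff k (F i)) *
        (fun i => PowerSeries.coeff (n - k) (G i))) ∈ ratFun ρ :=
      (ratFun ρ).sum_mem fun k hk => (ratFun ρ).mul_mem (ih k (Finset.mem_range.1 hk)) (hG _)
    have h2 := div_mem_ratFun ((ratFun ρ).sub_mem (hFG n) h1) (hG 0) h0
    convert h2 using 1
    ext i
    rw [eq_div_iff (h0 i), Pi.sub_apply, PowerSeries.coeff_mul,
      Finset.Nat.sum_antidiagonal_eq_sum_range_succ_mk, Finset.sum_range_succ, Finset.sum_apply,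
      Nat.sub_self]
    simp only [Pi.mul_apply]
    ring

end RatFun

/-! ### The recursion for the Taylor coefficients of the transformation -/

/-- The operator `X d/dX`. -/
def thetaOp (w : PowerSeries ℝ) : PowerSeries ℝ := PowerSeries.X * PowerSeries.derivative ℝ w

/-- The differential equation of the transformation, in terms of `w = (t - x) / (s - μ)`. -/
def odeSeries (x d m : ℝ) (w : PowerSeries ℝ) : PowerSeries ℝ :=
  (PowerSeries.C m + PowerSeries.X) * w * (w + thetaOp w) * (PowerSeries.C d - PowerSeries.X * w) -
    (PowerSeries.C x + PowerSeries.X * w) * (1 - PowerSeries.C x - PowerSeries.X * w)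

lemma thetaOp_X_pow_mul (k : ℕ) (R : PowerSeries ℝ) :
    thetaOp (PowerSeries.X ^ k * R) = PowerSeries.X ^ k * ((k : PowerSeries ℝ) * R + thetaOp R) := by
  rcases k with _ | k
  · simp [thetaOp]
  · rw [thetaOp, Derivation.leibniz, thetaOp, PowerSeries.derivative_pow, PowerSeries.derivative_X,
      smul_eq_mul, smul_eq_mul]
    simp only [Nat.add_sub_cancel]
    push_cast
    ring

lemma thetaOp_add (v w : PowerSeries ℝ) : thetaOp (v + w) = thetaOp v + thetaOp w := by
  rw [thetaOp, map_add, mul_add]; rfl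

/-- The coefficient of degree `k` contains `w_k` only linearly. The factor `k + 2` is the
linearisation of `w (w + θw)`, in which `θ` multiplies `X^k` by `k`. -/
lemma coeff_odeSeries (x d m : ℝ) (w : PowerSeries ℝ) {k : ℕ} (hk : k ≠ 0) :
    PowerSeries.coeff k (odeSeries x d m w) =
      PowerSeries.coeff k (odeSeries x d m (PowerSeries.trunc k w : PowerSeries ℝ)) +
        m * d * PowerSeries.coeff 0 w * (k + 2) * PowerSeries.coeff k w := by
  set W : PowerSeries ℝ := (PowerSeries.trunc k w : PowerSeries ℝ) with hW
  set R : PowerSeries ℝ := PowerSeries.mk fun i => PowerSeries.coeff (i + k) w with hR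
  have hw : w = PowerSeries.X ^ k * R + W := PowerSeries.eq_X_pow_mul_shift_add_trunc k w
  have hR0 : PowerSeries.constantCoeff R = PowerSeries.coeff k w := by
    rw [← PowerSeries.coeff_zero_eq_constantCoeff_apply, hR, PowerSeries.coeff_mk, zero_add]
  have hW0 : PowerSeries.constantCoeff W = PowerSeries.coeff 0 w := by
    rw [← PowerSeries.coeff_zero_eq_constantCoeff_apply, hW, Polynomial.coeff_coe,
      PowerSeries.coeff_trunc, if_pos (Nat.pos_of_ne_zero hk)]
  have hθ : ∀ v, PowerSeries.constantCoeff (thetaOp v) = 0 := fun v => by simp [thetaOp]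
  have key : odeSeries x d m w = odeSeries x d m W + PowerSeries.X ^ k *
      ((PowerSeries.C m + PowerSeries.X) * (R * (w + thetaOp w) *
        (PowerSeries.C d - PowerSeries.X * w) + W * (((k : PowerSeries ℝ) + 1) * R + thetaOp R) *
        (PowerSeries.C d - PowerSeries.X * w) - W * (W + thetaOp W) * PowerSeries.X * R) -
        PowerSeries.X * R * (1 - PowerSeries.C x - PowerSeries.X * w) +
        (PowerSeries.C x + PowerSeries.X * W) * (PowerSeries.X * R)) := by
    have e : thetaOp w = PowerSeries.X ^ k * ((k : PowerSeries ℝ) * R + thetaOp R) + thetaOp W := by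
      conv_lhs => rw [hw]
      rw [thetaOp_add, thetaOp_X_pow_mul]
    unfold odeSeries
    rw [e]
    clear_value W R
    subst hw
    ring
  rw [key, map_add, PowerSeries.coeff_X_pow_mul', if_pos le_rfl, Nat.sub_self,
    PowerSeries.coeff_zero_eq_constantCoeff_apply]
  have hw0 : PowerSeries.constantCoeff w = PowerSeries.coeff 0 w :=
    (PowerSeries.coeff_zero_eq_constantCoeff_apply w).symm
  simp only [map_add, map_sub, map_mul, hθ, hR0, hW0, hw0, PowerSeries.constantCoeff_C,
    PowerSeries.constantCoeff_X, map_natCast, map_one]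
  ring

/-- A family of solutions of the differential equation depends rationally on the parameter. -/
lemma ratCoeffs_of_odeSeries {ι : Type*} {ρ : ι → ℝ} {x d m : ι → ℝ} {w : ι → PowerSeries ℝ}
    (hx : x ∈ ratFun ρ) (hd : d ∈ ratFun ρ) (hm : m ∈ ratFun ρ)
    (hw0 : (fun i => PowerSeries.coeff 0 (w i)) ∈ ratFun ρ) (hd0 : ∀ i, d i ≠ 0)
    (hm0 : ∀ i, m i ≠ 0) (hw00 : ∀ i, PowerSeries.coeff 0 (w i) ≠ 0)
    (hode : ∀ i, odeSeries (x i) (d i) (m i) (w i) = 0) : RatCoeffs ρ w := by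
  intro k
  induction k using Nat.strong_induction_on with
  | _ k ih =>
    rcases eq_or_ne k 0 with rfl | hk
    · exact hw0
    set W : ι → PowerSeries ℝ := fun i => (PowerSeries.trunc k (w i) : PowerSeries ℝ) with hW
    have rW : RatCoeffs ρ W := fun n => by
      simp only [hW, Polynomial.coeff_coe, PowerSeries.coeff_trunc]
      split_ifs with h
      · exact ih n h
      · exact const_mem_ratFun 0
    have rθ : RatCoeffs ρ (fun i => thetaOp (W i)) := ratCoeffs_X.mul rW.derivative
    have r1 : RatCoeffs ρ (fun _ => (1 : PowerSeries ℝ)) := fun n => const_mem_ratFun _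
    have rX := ratCoeffs_X (ρ := ρ)
    have rE : RatCoeffs ρ (fun i => odeSeries (x i) (d i) (m i) (W i)) :=
      (((((ratCoeffs_C hm).add rX).mul rW).mul (rW.add rθ)).mul
        ((ratCoeffs_C hd).sub (rX.mul rW))).sub
        (((ratCoeffs_C hx).add (rX.mul rW)).mul ((r1.sub (ratCoeffs_C hx)).sub (rX.mul rW)))
    have h2 := div_mem_ratFun ((ratFun ρ).neg_mem (rE k)) ((ratFun ρ).mul_mem
      ((ratFun ρ).mul_mem ((ratFun ρ).mul_mem hm hd) hw0) (const_mem_ratFun ((k : ℝ) + 2)))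
      (fun i => mul_ne_zero (mul_ne_zero (mul_ne_zero (hm0 i) (hd0 i)) (hw00 i)) (by positivity))
    convert h2 using 1
    ext i
    have e := coeff_odeSeries (x i) (d i) (m i) (w i) hk
    rw [hode i, map_zero] at e
    have hne : m i * d i * PowerSeries.coeff 0 (w i) * ((k : ℝ) + 2) ≠ 0 :=
      mul_ne_zero (mul_ne_zero (mul_ne_zero (hm0 i) (hd0 i)) (hw00 i)) (by positivity)
    simp only [Pi.mul_apply, Pi.neg_apply]
    rw [eq_div_iff hne]
    linarith

/-- Insert `T = x + (s - μ) w` in the differential equation; a common factor `s - μ` cancels. -/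
lemma IsGerm.odeSeries_eq_zero {x y : ℝ} {T : ℝ → ℝ} (H : Branch x y) (G : IsGerm x y T) :
    odeSeries x (y - x) (x * y) (taylor (dslope T (x * y)) (x * y)) = 0 := by
  set m := x * y with hm
  have aT := G.analytic
  have h := taylor_congr (G.ode H)
  have ex : AnalyticAt ℝ (fun s => T s - x) m := aT.sub analyticAt_const
  have ey : AnalyticAt ℝ (fun s => y - T s) m := analyticAt_const.sub aT
  have e1 : AnalyticAt ℝ (fun s => 1 - T s) m := analyticAt_const.sub aT
  have em : AnalyticAt ℝ (fun s => s - m) m := analyticAt_id.sub analyticAt_const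
  have ei : AnalyticAt ℝ (fun s : ℝ => s) m := analyticAt_id
  rw [← hm, taylor_mul (ei.fun_mul (ex.fun_mul ey)) aT.deriv, taylor_mul ei (ex.fun_mul ey),
    taylor_mul ex ey, taylor_mul em (aT.fun_mul e1), taylor_mul aT e1, taylor_sub aT analyticAt_const,
    taylor_sub analyticAt_const aT, taylor_sub analyticAt_const aT, taylor_sub ei analyticAt_const,
    taylor_id, taylor_deriv, taylor_const, taylor_const, taylor_const, taylor_const,
    taylor_dslope aT, G.apply_mu] at h
  set w := taylor (dslope T m) m
  have hd : PowerSeries.derivative ℝ (PowerSeries.C x + PowerSeries.X * w) = w + thetaOp w := by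
    rw [map_add, PowerSeries.derivative_C, Derivation.leibniz, PowerSeries.derivative_X, thetaOp,
      smul_eq_mul, smul_eq_mul]
    ring
  rw [hd] at h
  refine mul_left_cancel₀ (PowerSeries.X_ne_zero (R := ℝ)) ?_
  rw [mul_zero, odeSeries, map_sub, map_one] at *
  linear_combination h


/-! ### Rationality of the coefficients and their reflection symmetry -/

lemma IsGerm.deriv_sq {x y : ℝ} {T : ℝ → ℝ} (H : Branch x y) (G : IsGerm x y T) :
    y * (y - x) * deriv T (x * y) ^ 2 = 1 - x := by
  have h := congrArg PowerSeries.constantCoeff (G.odeSeries_eq_zero H)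
  simp only [odeSeries, thetaOp, map_add, map_sub, map_mul, PowerSeries.constantCoeff_C,
    PowerSeries.constantCoeff_X, map_one, map_zero, constantCoeff_taylor, dslope_same] at h
  refine mul_left_cancel₀ H.ne_zero ?_
  linear_combination h

/-- If the critical points and the derivative at `μ` depend rationally on a parameter, then so do
the coefficients of the expansion. -/
lemma coeff_mem_ratFun {ι : Type*} {ρ x y : ι → ℝ} {T : ι → ℝ → ℝ}
    (H : ∀ i, Branch (x i) (y i)) (G : ∀ i, IsGerm (x i) (y i) (T i)) (hx : x ∈ ratFun ρ)
    (hy : y ∈ ratFun ρ) (hc : (fun i => deriv (T i) (x i * y i)) ∈ ratFun ρ) (n : ℕ) :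
    (fun i => coeff (alphaOf (x i) (y i)) (betaOf (x i) (y i)) n) ∈ ratFun ρ := by
  have hm : (fun i => x i * y i) ∈ ratFun ρ := (ratFun ρ).mul_mem hx hy
  have rw' : RatCoeffs ρ (fun i => taylor (dslope (T i) (x i * y i)) (x i * y i)) := by
    refine ratCoeffs_of_odeSeries hx ((ratFun ρ).sub_mem hy hx) hm ?_ (fun i => ?_)
      (fun i => (H i).mu_ne_zero) (fun i => ?_) (fun i => (G i).odeSeries_eq_zero (H i))
    · simpa only [coeff_zero_taylor, dslope_same] using hc
    · exact sub_ne_zero.2 (H i).lt.ne'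
    · rw [coeff_zero_taylor, dslope_same]
      exact (G i).deriv_pos.ne'
  have rT : RatCoeffs ρ (fun i => taylor (T i) (x i * y i)) := by
    have : (fun i => taylor (T i) (x i * y i)) = fun i => PowerSeries.C (x i) +
        PowerSeries.X * taylor (dslope (T i) (x i * y i)) (x i * y i) := by
      ext1 i
      conv_lhs => rw [taylor_dslope (G i).analytic, (G i).apply_mu]
    rw [this]
    exact (ratCoeffs_C hx).add (ratCoeffs_X.mul rw')
  have rp : RatCoeffs ρ (fun i => taylor (germP (T i)) (x i * y i)) := by
    refine RatCoeffs.of_mul (G := fun i => taylor (T i) (x i * y i)) ?_ rT (fun i => ?_)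
    · have : (fun i => taylor (germP (T i)) (x i * y i) * taylor (T i) (x i * y i)) = fun i =>
          (PowerSeries.C (x i * y i) + PowerSeries.X) *
            PowerSeries.derivative ℝ (taylor (T i) (x i * y i)) := by
        ext1 i
        rw [← taylor_mul ((G i).analyticAt_germP (H i)) (G i).analytic, ← taylor_deriv,
          ← taylor_id, ← taylor_mul (f := fun s => s) analyticAt_id (G i).analytic.deriv]
        refine taylor_congr ?_
        filter_upwards [(G i).tendsto.eventually (eventually_ne_nhds (H i).ne_zero)] with s hs
        rw [germP]
        field_simp
      rw [this]
      exact ((ratCoeffs_C hm).add ratCoeffs_X).mul rT.derivative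
    · rw [coeff_zero_taylor, (G i).apply_mu]
      exact (H i).ne_zero
  have rn : ∀ n, RatCoeffs ρ
      (fun i => taylor ((stepOp (x i * y i))^[n] (germP (T i))) (x i * y i)) := by
    intro n
    induction n with
    | zero => exact rp
    | succ n ih =>
      have ha : ∀ i, AnalyticAt ℝ ((stepOp (x i * y i))^[n] (germP (T i))) (x i * y i) :=
        fun i => analyticAt_iterate_stepOp ((G i).analyticAt_germP (H i)) n
      have hd : RatCoeffs ρ (fun i => taylor
          (dslope ((stepOp (x i * y i))^[n] (germP (T i))) (x i * y i)) (x i * y i)) := fun k => by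
        have := ih (k + 1)
        simpa only [coeff_taylor_dslope (ha _)] using this
      have : (fun i => taylor ((stepOp (x i * y i))^[n + 1] (germP (T i))) (x i * y i)) =
          fun i => (PowerSeries.C (x i * y i) + PowerSeries.X) * PowerSeries.derivative ℝ (taylor
            (dslope ((stepOp (x i * y i))^[n] (germP (T i))) (x i * y i)) (x i * y i)) := by
        ext1 i
        rw [Function.iterate_succ_apply', taylor_stepOp (ha i)]
      rw [this]
      exact ((ratCoeffs_C hm).add ratCoeffs_X).mul hd.derivative
  have := rn n 0
  simp only [coeff_zero_taylor] at this
  convert this using 1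
  ext i
  exact (G i).coeff_eq (H i) n

/-- The reflection of the critical points that corresponds to the Kummer transformation. -/
lemma Branch.reflect {x y : ℝ} (hx : x < 1) (hy : 1 < y) : Branch (1 - y) (1 - x) where
  ne_zero := by linarith
  lt_one := by linarith
  pos := by linarith
  lt := by linarith
  neg_or := Or.inl (by linarith)

/-- The symmetry of the coefficients under reflection extends from negative to positive `x`. -/
lemma coeff_reflect_of_neg {y : ℝ} (hy : 1 < y) (n : ℕ)
    (h : ∀ x < 0, coeff (alphaOf x y) (betaOf x y) n =
      coeff (alphaOf (1 - y) (1 - x)) (betaOf (1 - y) (1 - x)) n) {x : ℝ} (hx : x < 1)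
    (hx0 : x ≠ 0) : coeff (alphaOf x y) (betaOf x y) n =
      coeff (alphaOf (1 - y) (1 - x)) (betaOf (1 - y) (1 - x)) n := by
  let ι := {x : ℝ // x < 1 ∧ x ≠ 0}
  have H : ∀ i : ι, Branch i.1 y := fun i =>
    ⟨i.2.2, i.2.1, by linarith, by linarith [i.2.1], Or.inr hy⟩
  have H' : ∀ i : ι, Branch (1 - y) (1 - i.1) := fun i => Branch.reflect i.2.1 hy
  choose T G using fun i => (H i).exists_germ
  choose T' G' using fun i => (H' i).exists_germ
  -- The derivative at `μ` is a square root in `x`. For fixed `y`, however, `x` is rational in this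
  -- derivative, which therefore serves as the parameter.
  set ρ : ι → ℝ := fun i => deriv (T i) (i.1 * y) with hρ
  have hpos : ∀ i : ι, 0 < ρ i := fun i => (G i).deriv_pos
  have hyx : ∀ i : ι, 0 < y - i.1 := fun i => by linarith [i.2.1]
  have hsq : ∀ i : ι, y * (y - i.1) * ρ i ^ 2 = 1 - i.1 := fun i => (G i).deriv_sq (H i)
  have hden : ∀ i : ι, 1 - y * ρ i ^ 2 ≠ 0 := fun i h0 => by
    have h1 := hsq i
    have : y - i.1 = 1 - i.1 := by
      rw [← h1]; linear_combination (y - i.1) * h0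
    linarith
  have hxi : ∀ i : ι, i.1 = (1 - y ^ 2 * ρ i ^ 2) / (1 - y * ρ i ^ 2) := fun i => by
    rw [eq_div_iff (hden i)]; linear_combination hsq i
  have ry : (fun _ : ι => y) ∈ ratFun ρ := const_mem_ratFun y
  have r1 : (fun _ : ι => (1 : ℝ)) ∈ ratFun ρ := const_mem_ratFun 1
  have rρ := self_mem_ratFun (ρ := ρ)
  have rx : (fun i : ι => i.1) ∈ ratFun ρ := by
    have := div_mem_ratFun ((ratFun ρ).sub_mem r1 ((ratFun ρ).mul_mem ((ratFun ρ).pow_mem ry 2)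
      ((ratFun ρ).pow_mem rρ 2))) ((ratFun ρ).sub_mem r1 ((ratFun ρ).mul_mem ry
      ((ratFun ρ).pow_mem rρ 2))) hden
    convert this using 1
    ext i
    exact hxi i
  -- By `deriv_sq` for both pairs of critical points, the reflected derivative is `1/(ρ(y - x))`,
  -- positivity fixing the sign of the root.
  have rc' : (fun i : ι => deriv (T' i) ((1 - y) * (1 - i.1))) ∈ ratFun ρ := by
    have := div_mem_ratFun r1 ((ratFun ρ).mul_mem rρ ((ratFun ρ).sub_mem ry rx))
      (fun i => mul_ne_zero (hpos i).ne' (hyx i).ne')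
    convert this using 1
    ext i
    have h1 := (G' i).deriv_sq (H' i)
    have h2 := (G' i).deriv_pos
    have h3 := hpos i
    have h4 := hyx i
    have h5 := hsq i
    set c := deriv (T' i) ((1 - y) * (1 - i.1))
    have h7 : 0 < 1 - i.1 := by linarith [i.2.1]
    have h6 : (c * (ρ i * (y - i.1))) ^ 2 = 1 ^ 2 := by
      refine mul_left_cancel₀ (mul_pos h7 (by linarith : 0 < y)).ne' ?_
      linear_combination y * (y - i.1) * ρ i ^ 2 * h1 + y * h5
    have h8 := (sq_eq_sq₀ (by positivity) one_pos.le).1 h6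
    show c = 1 / (ρ i * (y - i.1))
    rw [eq_div_iff (by positivity), h8]
  have k1 := coeff_mem_ratFun H G rx ry rρ n
  have k2 := coeff_mem_ratFun H' G' ((ratFun ρ).sub_mem r1 ry) ((ratFun ρ).sub_mem r1 rx) rc' n
  have hinf : {i : ι | i.1 < 0}.Infinite := by
    refine Set.infinite_of_injective_forall_mem
      (f := fun k : ℕ => (⟨-(k + 1 : ℝ), by
        have : (0 : ℝ) ≤ k := k.cast_nonneg
        constructor <;> linarith⟩ : ι)) ?_ ?_
    · intro k l hkl
      have := congrArg Subtype.val hkl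
      simpa using this
    · intro k
      have : (0 : ℝ) ≤ k := k.cast_nonneg
      show -(k + 1 : ℝ) < 0
      linarith
  have hinj : InjOn ρ {i : ι | i.1 < 0} := fun i _ j _ hij => by
    refine Subtype.ext ?_
    rw [hxi i, hxi j, hij]
  exact congrFun (eq_of_ratFun k1 k2 hinf hinj fun i hi => h i.1 hi) ⟨x, hx, hx0⟩


/-! ### Uniqueness of asymptotic expansions -/

/-- Let `w → 0` to kill the constant term, divide by `w`, and repeat. -/
lemma eq_zero_of_sum_pow_bound {C : ℝ} (N : ℕ) (d : ℕ → ℝ)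
    (h : ∀ w : ℝ, 0 < w → w ≤ 1 → |∑ n ∈ Finset.range N, d n * w ^ n| ≤ C * w ^ N) :
    ∀ n < N, d n = 0 := by
  induction N generalizing d with
  | zero => intro n hn; omega
  | succ N ih =>
    have h0 : d 0 = 0 := by
      have t1 : Tendsto (fun w : ℝ => |∑ n ∈ Finset.range (N + 1), d n * w ^ n|) (𝓝[>] 0)
          (𝓝 |∑ n ∈ Finset.range (N + 1), d n * (0 : ℝ) ^ n|) :=
        ((by fun_prop : Continuous fun w : ℝ => |∑ n ∈ Finset.range (N + 1), d n * w ^ n|).tendsto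
          0).mono_left nhdsWithin_le_nhds
      have t2 : Tendsto (fun w : ℝ => C * w ^ (N + 1)) (𝓝[>] 0) (𝓝 (C * 0 ^ (N + 1))) :=
        ((by fun_prop : Continuous fun w : ℝ => C * w ^ (N + 1)).tendsto 0).mono_left
          nhdsWithin_le_nhds
      have hle := le_of_tendsto_of_tendsto t1 t2 (by
        filter_upwards [Ioc_mem_nhdsGT (zero_lt_one (α := ℝ))] with w hw
        exact h w hw.1 hw.2)
      rw [Finset.sum_range_succ'] at hle
      simpa using hle
    have h1 : ∀ n < N, d (n + 1) = 0 := by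
      refine ih (fun n => d (n + 1)) fun w hw hw1 => ?_
      have h2 := h w hw hw1
      rw [Finset.sum_range_succ', h0, zero_mul, add_zero] at h2
      have h3 : ∑ n ∈ Finset.range N, d (n + 1) * w ^ (n + 1) =
          w * ∑ n ∈ Finset.range N, d (n + 1) * w ^ n := by
        rw [Finset.mul_sum]
        exact Finset.sum_congr rfl fun n _ => by ring
      rw [h3, abs_mul, abs_of_pos hw, pow_succ] at h2
      refine le_of_mul_le_mul_left ?_ hw
      linarith
    intro n hn
    rcases n with _ | n
    · exact h0
    · exact h1 n (by omega)

/-- An asymptotic expansion determines its coefficients. -/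
lemma expansion_unique {f E : ℝ → ℝ} {c d : ℕ → ℝ} {C D : ℝ} {N : ℕ} (hE : ∀ z, 0 < E z)
    (hc : ∀ z, 1 ≤ z → |f z - E z * ∑ n ∈ Finset.range (N + 1), c n / z ^ n| ≤
      C * E z / z ^ (N + 1))
    (hd : ∀ z, 1 ≤ z → |f z - E z * ∑ n ∈ Finset.range (N + 1), d n / z ^ n| ≤
      D * E z / z ^ (N + 1)) : ∀ n ≤ N, c n = d n := by
  have key : ∀ n < N + 1, c n - d n = 0 := by
    refine eq_zero_of_sum_pow_bound (C := C + D) (N + 1) (fun n => c n - d n) fun w hw hw1 => ?_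
    have hz : 1 ≤ w⁻¹ := (one_le_inv₀ hw).2 hw1
    have h1 := hc _ hz
    have h2 := hd _ hz
    have hEz := hE w⁻¹
    have e : ∀ a : ℕ → ℝ, ∑ n ∈ Finset.range (N + 1), a n / w⁻¹ ^ n =
        ∑ n ∈ Finset.range (N + 1), a n * w ^ n := fun a =>
      Finset.sum_congr rfl fun n _ => by rw [inv_pow, div_inv_eq_mul]
    rw [e, inv_pow, div_inv_eq_mul] at h1 h2
    have h3 := abs_sub_le (E w⁻¹ * ∑ n ∈ Finset.range (N + 1), c n * w ^ n) (f w⁻¹)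
      (E w⁻¹ * ∑ n ∈ Finset.range (N + 1), d n * w ^ n)
    rw [abs_sub_comm _ (f w⁻¹), ← mul_sub, abs_mul, abs_of_pos hEz, ← Finset.sum_sub_distrib] at h3
    have h4 : ∑ n ∈ Finset.range (N + 1), (c n - d n) * w ^ n =
        ∑ n ∈ Finset.range (N + 1), (c n * w ^ n - d n * w ^ n) :=
      Finset.sum_congr rfl fun n _ => by ring
    rw [h4]
    refine le_of_mul_le_mul_left ?_ hEz
    linarith
  intro n hn
  exact sub_eq_zero.1 (key n (Nat.lt_succ_of_le hn))

/-! ### Identification of the coefficients -/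

lemma alphaOf_reflect (x y : ℝ) : alphaOf (1 - y) (1 - x) = -(x * y) := by unfold alphaOf; ring

lemma mul_reflect (x y : ℝ) : -((1 - y) * (1 - x)) = alphaOf x y := by unfold alphaOf; ring

/-- Both expansions must have the same front factor for their coefficients to be comparable. -/
lemma expA_reflect {x y : ℝ} (hx : x < 1) (hy : 1 < y) :
    expA (alphaOf (1 - y) (1 - x)) (betaOf (1 - y) (1 - x)) = expA (alphaOf x y) (betaOf x y) := by
  rw [expA_param (by linarith) (by linarith), expA_param (by linarith) (by linarith),
    alphaOf_reflect, show 1 - (1 - y) = y by ring]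
  unfold alphaOf
  ring

lemma alphaOf_pos {x y : ℝ} (hx : x < 1) (hy : 1 < y) : 0 < alphaOf x y :=
  mul_pos (by linarith) (by linarith)

lemma scaledU_param {x y z : ℝ} (hx : x < 1) (hy : 1 < y) (hz : 0 < z) :
    scaledU (alphaOf x y * z) (betaOf x y * z + 1) z *
      (Real.Gamma (alphaOf x y * z) * z ^ (-(alphaOf x y * z))) =
    ∫ u in Ioi (0 : ℝ), weight (alphaOf x y * z) (x * y * z) z u := by
  have hα := mul_pos (alphaOf_pos hx hy) hz
  have hG := (Real.Gamma_pos_of_pos hα).ne'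
  have hzz : z ^ (alphaOf x y * z) ≠ 0 := (Real.rpow_pos_of_pos hz _).ne'
  rw [scaledU, U_eq_integral_weight, Real.rpow_neg hz.le,
    show betaOf x y * z - alphaOf x y * z = x * y * z by unfold betaOf alphaOf; ring]
  field_simp

/-- For fixed critical points the expansion holds with the coefficients of the reflected points. -/
lemma exists_expansion_reflect {x y : ℝ} (hx : x < 1) (hy : 1 < y) (N : ℕ) :
    ∃ C > 0, ∀ z : ℝ, 1 ≤ z →
      |scaledU (alphaOf x y * z) (betaOf x y * z + 1) z -
        Real.exp (z * expA (alphaOf x y) (betaOf x y)) * ∑ n ∈ Finset.range (N + 1),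
          (-1) ^ n * coeff (alphaOf (1 - y) (1 - x)) (betaOf (1 - y) (1 - x)) n / z ^ n| ≤
      C * Real.exp (z * expA (alphaOf x y) (betaOf x y)) / z ^ (N + 1) := by
  -- Reflection exchanges `α` and `-μ`, so the integral for the reflected points is the defining
  -- integral of `U`, with no Kummer transformation. The smaller reflected point `1 - y` is
  -- negative.
  obtain ⟨C, hC, h⟩ := exists_laplace_expansion (Branch.reflect hx hy) (by linarith) N
  refine ⟨C, hC, fun z hz => ?_⟩
  have hz0 : 0 < z := by linarith
  have h1 := h z hz
  rw [expA_reflect hx hy, mul_reflect, show alphaOf (1 - y) (1 - x) * z = -(x * y) * z by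
    rw [alphaOf_reflect],
    show -(-(x * y) * z) = x * y * z by ring, ← scaledU_param hx hy hz0] at h1
  have hα := mul_pos (alphaOf_pos hx hy) hz0
  have hW : 0 < Real.Gamma (alphaOf x y * z) * z ^ (-(alphaOf x y * z)) :=
    mul_pos (Real.Gamma_pos_of_pos hα) (Real.rpow_pos_of_pos hz0 _)
  set W := Real.Gamma (alphaOf x y * z) * z ^ (-(alphaOf x y * z))
  set E := Real.exp (z * expA (alphaOf x y) (betaOf x y))
  simp only [mul_div_assoc] at h1 ⊢
  rw [mul_right_comm E W, ← sub_mul, abs_mul, abs_of_pos hW] at h1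
  refine le_of_mul_le_mul_right (h1.trans_eq ?_) hW
  ring

/-- For fixed critical points with `x < 0` the expansion holds with the coefficients of the
transformation. -/
lemma exists_expansion_of_neg {x y : ℝ} (hx : x < 0) (hy : 1 < y) (N : ℕ) :
    ∃ C > 0, ∀ z : ℝ, 1 ≤ z →
      |scaledU (alphaOf x y * z) (betaOf x y * z + 1) z -
        Real.exp (z * expA (alphaOf x y) (betaOf x y)) * ∑ n ∈ Finset.range (N + 1),
          (-1) ^ n * coeff (alphaOf x y) (betaOf x y) n / z ^ n| ≤
      C * Real.exp (z * expA (alphaOf x y) (betaOf x y)) / z ^ (N + 1) := by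
  have H : Branch x y := ⟨hx.ne, by linarith, by linarith, by linarith, Or.inl hx⟩
  obtain ⟨C, hC, h⟩ := exists_laplace_expansion H hx N
  refine ⟨C, hC, fun z hz => ?_⟩
  have hz0 : 0 < z := by linarith
  have hα := mul_pos (alphaOf_pos (by linarith : x < 1) hy) hz0
  have hν : 0 < -(x * y) * z := mul_pos (by nlinarith) hz0
  have hW : 0 < Real.Gamma (-(x * y) * z) * z ^ (-(-(x * y) * z)) :=
    mul_pos (Real.Gamma_pos_of_pos hν) (Real.rpow_pos_of_pos hz0 _)
  -- Here `-μz > 0`, so the Kummer-transformed integral converges.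
  have hk := integral_weight_kummer hα hν hz0
  rw [show -(-(x * y) * z) = x * y * z by ring, ← scaledU_param (by linarith) hy hz0,
    sub_eq_add_neg, Real.rpow_add hz0] at hk
  have hint : ∫ u in Ioi (0 : ℝ), weight (-(x * y) * z) (-(alphaOf x y * z)) z u =
      scaledU (alphaOf x y * z) (betaOf x y * z + 1) z *
        (Real.Gamma (-(x * y) * z) * z ^ (-(-(x * y) * z))) := by
    have hG := (Real.Gamma_pos_of_pos hα).ne'
    have hz1 : z ^ (-(alphaOf x y * z)) ≠ 0 := (Real.rpow_pos_of_pos hz0 _).ne'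
    have hz2 : z ^ (-(x * y) * z) ≠ 0 := (Real.rpow_pos_of_pos hz0 _).ne'
    rw [Real.rpow_neg hz0.le (-(x * y) * z)]
    refine mul_left_cancel₀ (mul_ne_zero hG (mul_ne_zero hz2 hz1)) ?_
    rw [mul_assoc, ← hk]
    field_simp
  have h1 := h z hz
  rw [hint] at h1
  set W := Real.Gamma (-(x * y) * z) * z ^ (-(-(x * y) * z))
  set E := Real.exp (z * expA (alphaOf x y) (betaOf x y))
  simp only [mul_div_assoc] at h1 ⊢
  rw [mul_right_comm E W, ← sub_mul, abs_mul, abs_of_pos hW] at h1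
  refine le_of_mul_le_mul_right (h1.trans_eq ?_) hW
  ring

/-- For `x < 0` the two expansions belong to the same function, so uniqueness applies; rationality
then covers `0 < x < 1`. -/
lemma coeff_reflect {x y : ℝ} (hx : x < 1) (hx0 : x ≠ 0) (hy : 1 < y) (n : ℕ) :
    coeff (alphaOf x y) (betaOf x y) n =
      coeff (alphaOf (1 - y) (1 - x)) (betaOf (1 - y) (1 - x)) n := by
  refine coeff_reflect_of_neg hy n (fun x hx => ?_) hx hx0
  obtain ⟨C, -, h1⟩ := exists_expansion_of_neg hx hy n
  obtain ⟨D, -, h2⟩ := exists_expansion_reflect (by linarith : x < 1) hy n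
  exact mul_left_cancel₀ (pow_ne_zero n (by norm_num : (-1 : ℝ) ≠ 0))
    (expansion_unique (fun z => Real.exp_pos _) h1 h2 n le_rfl)

/-- Along `a = αz`, `b = βz` the uniform expansion has fixed coefficients and must coincide with the
Laplace expansion for these `α`, `β`. -/
lemma uniformCoeff_eq {x y : ℝ} (hx : x < 1) (hx0 : x ≠ 0) (hy : 1 < y) {N n : ℕ} (hn : n ≤ N) :
    firstCoeff (alphaOf x y) (betaOf x y) * uniformCoeff N n (alphaOf x y) (betaOf x y) =
      (-1) ^ n * coeff (alphaOf x y) (betaOf x y) n := by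
  have hα := alphaOf_pos hx hy
  have hh := saddleH_pos hα (betaOf x y)
  have hη : 0 < min (saddleH (alphaOf x y) (betaOf x y)) 1 := lt_min hh one_pos
  obtain ⟨C, -, h1⟩ := exists_uniform_expansion N hη (min_le_right _ _)
  obtain ⟨D, -, h2⟩ := exists_expansion_reflect hx hy N
  rw [coeff_reflect hx hx0 hy]
  refine expansion_unique
    (c := fun n => firstCoeff (alphaOf x y) (betaOf x y) *
      uniformCoeff N n (alphaOf x y) (betaOf x y))
    (d := fun n => (-1) ^ n * coeff (alphaOf (1 - y) (1 - x)) (betaOf (1 - y) (1 - x)) n)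
    (C := C) (fun z => Real.exp_pos _) (fun z hz => ?_) h2 n hn
  have hz0 : z ≠ 0 := by linarith
  have h3 := h1 (alphaOf x y * z) (betaOf x y * z) z (mul_pos hα (by linarith)) hz
  rw [mul_div_cancel_right₀ _ hz0, mul_div_cancel_right₀ _ hz0] at h3
  have h4 := h3 (min_le_left _ _)
  simp only [mul_div_assoc, ← Finset.mul_sum] at h4 ⊢
  rwa [← mul_assoc]

/-- The value is `(μ/x) T'(μ) = y T'(μ)`, and `deriv_sq` gives the derivative. -/
lemma coeff_zero_eq {x y : ℝ} (hx : x < 1) (hx0 : x ≠ 0) (hy : 1 < y) :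
    coeff (alphaOf x y) (betaOf x y) 0 = firstCoeff (alphaOf x y) (betaOf x y) := by
  have H : Branch x y := ⟨hx0, hx, by linarith, by linarith, Or.inr hy⟩
  obtain ⟨T, G⟩ := H.exists_germ
  have hsq := G.deriv_sq H
  have hpos := G.deriv_pos
  rw [G.coeff_eq H, firstCoeff_param H.lt H.pos hx, Function.iterate_zero, id, germP, G.apply_mu,
    mul_div_cancel_left₀ _ hx0]
  have hd : 0 < y - x := by linarith
  symm
  rw [Real.sqrt_eq_iff_eq_sq (div_nonneg (mul_nonneg H.pos.le (by linarith)) hd.le)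
    (mul_pos H.pos hpos).le, div_eq_iff hd.ne']
  linear_combination -y * hsq

/-! ### The case `μ = 0` -/

lemma hasDerivAt_phi_self (α : ℝ) {t : ℝ} (ht : t < 1) :
    HasDerivAt (phi α α) (1 + α / (1 - t)) t := by
  have h1 : 1 - t ≠ 0 := by linarith
  have d := (hasDerivAt_id t).fun_sub ((((hasDerivAt_id t).const_sub 1).log h1).const_mul α)
  have e : phi α α = fun t => id t - α * Real.log (1 - id t) := by
    ext t; simp [phi, mu]
  rw [e]
  refine d.congr_deriv ?_
  simp only [id]
  ring

lemma phi_self_strictMonoOn {α : ℝ} (hα : 0 < α) : StrictMonoOn (phi α α) (Iio 1) := by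
  refine strictMonoOn_of_deriv_pos (convex_Iio 1) (fun t ht =>
    (hasDerivAt_phi_self α ht).continuousAt.continuousWithinAt) (fun t ht => ?_)
  rw [interior_Iio] at ht
  rw [(hasDerivAt_phi_self α ht).deriv]
  have : 0 < 1 - t := sub_pos.2 ht
  positivity

lemma analyticAt_phi_self (α : ℝ) : AnalyticAt ℝ (phi α α) 0 := by
  have e : phi α α = fun t => t - α * Real.log (1 - t) := by
    ext t; simp [phi, mu]
  rw [e]
  exact analyticAt_id.sub (analyticAt_const.mul
    (AnalyticAt.log (analyticAt_const.sub analyticAt_id) (by norm_num)))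

lemma mu_self (α : ℝ) : mu α α = 0 := sub_self α

lemma t0_self (α : ℝ) : t0 α α = 0 := by rw [t0, mu_self, zero_mul]

lemma phi_self_zero (α : ℝ) : phi α α 0 = 0 := by simp [phi, mu_self]

lemma psi_self (α s : ℝ) : psi α α s = s := by simp [psi, mu_self]

/-- For `μ = 0` the transformation is near the origin the inverse of `φ`. -/
lemma exists_germ_self {α : ℝ} (hα : 0 < α) : ∃ L : ℝ → ℝ, AnalyticAt ℝ L 0 ∧ L 0 = 0 ∧
    0 < deriv L 0 ∧ tOf α α =ᶠ[𝓝 0] L := by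
  have a := analyticAt_phi_self α
  have hd : deriv (phi α α) 0 = 1 + α := by
    rw [(hasDerivAt_phi_self α one_pos).deriv]; simp
  have hd0 : deriv (phi α α) 0 ≠ 0 := by rw [hd]; positivity
  set L := a.hasStrictDerivAt.localInverse _ _ _ hd0 with hL
  have aL : AnalyticAt ℝ L 0 := by
    have := a.analyticAt_localInverse hd0
    rwa [phi_self_zero] at this
  have dL : HasStrictDerivAt L (deriv (phi α α) 0)⁻¹ 0 := by
    have := a.hasStrictDerivAt.to_localInverse hd0
    rwa [phi_self_zero] at this
  have L0 : L 0 = 0 := by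
    have := (a.hasStrictDerivAt.eventually_left_inverse hd0).self_of_nhds
    rwa [phi_self_zero] at this
  have hright : ∀ᶠ r in 𝓝 0, phi α α (L r) = r := by
    have := a.hasStrictDerivAt.eventually_right_inverse hd0
    rwa [phi_self_zero] at this
  have hpos : 0 < deriv L 0 := by
    rw [dL.hasDerivAt.deriv, hd]; positivity
  refine ⟨L, aL, L0, hpos, ?_⟩
  have hp : 0 < dslope L 0 0 := by rwa [dslope_same]
  have ht : Tendsto L (𝓝 0) (𝓝 0) := by
    have := aL.continuousAt.tendsto
    rwa [L0] at this
  filter_upwards [hright, ht.eventually (gt_mem_nhds one_pos),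
    (analyticAt_dslope aL).continuousAt.eventually (lt_mem_nhds hp)] with s h1 h2 h3
  have hs : SignType.sign (L s) = SignType.sign s := by
    have := sub_mul_dslope L 0 s
    rw [L0, zero_add, sub_zero] at this
    rw [this, sign_mul, sign_pos h3, mul_one]
  have hT : Corresponds α α s (L s) := by
    refine ⟨h2, hs, ?_, ?_⟩
    · rw [t0_self, mu_self, sub_zero, sub_zero, hs]
    · rw [t0_self, mu_self, phi_self_zero, psi_self, psi_self, h1]
  obtain ⟨g1, g2, g3, g4⟩ := Classical.epsilon_spec (p := Corresponds α α s) ⟨_, hT⟩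
  rw [t0_self, mu_self, phi_self_zero, psi_self, psi_self, sub_zero, sub_zero] at g4
  exact (phi_self_strictMonoOn hα).injOn g1 h2 (g4.trans h1.symm)

/-- Near `s = 0` both `t/s` and `dt/ds` tend to the same nonzero derivative, so the limit defining
`p(0)` is `1`. -/
lemma coeff_zero_self {α : ℝ} (hα : 0 < α) : coeff α α 0 = 1 := by
  obtain ⟨L, aL, L0, hpos, hL⟩ := exists_germ_self hα
  rw [coeff, pFun, p, mu_self, Function.update_self]
  refine Tendsto.limUnder_eq ?_
  have hp : dslope L 0 0 ≠ 0 := by rw [dslope_same]; exact hpos.ne'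
  have h1 : Tendsto (fun s => (dslope L 0 s)⁻¹ * deriv L s) (𝓝[≠] 0)
      (𝓝 ((dslope L 0 0)⁻¹ * deriv L 0)) :=
    (((analyticAt_dslope aL).continuousAt.inv₀ hp).mul
      aL.deriv.continuousAt).tendsto.mono_left nhdsWithin_le_nhds
  rw [dslope_same, inv_mul_cancel₀ hpos.ne'] at h1
  refine h1.congr' ?_
  filter_upwards [(hL.and hL.deriv).filter_mono (nhdsWithin_le_nhds (s := {0}ᶜ)),
    self_mem_nhdsWithin] with s hs hne
  have hne : s ≠ 0 := hne
  have := sub_mul_dslope L 0 s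
  rw [L0, zero_add, sub_zero] at this
  rw [hs.1, hs.2, this, ← div_div, div_self hne, one_div]

/-- The prefactor `s` of the recursion vanishes at `s = μ = 0`. -/
lemma coeff_succ_self (α : ℝ) (n : ℕ) : coeff α α (n + 1) = 0 := by
  rw [coeff, pFun, mu_self]
  exact zero_mul _

lemma expA_self (α : ℝ) : expA α α = 0 := by simp [expA, mu_self]

lemma firstCoeff_self (α : ℝ) : firstCoeff α α = 1 := by simp [firstCoeff, mu_self]

lemma scaledU_self {a z : ℝ} (ha : 0 < a) (hz : 0 < z) : scaledU a (a + 1) z = 1 := by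
  have h : ∀ u : ℝ, weight a (a - a) z u = u ^ (a - 1) * Real.exp (-(z * u)) := fun u => by
    rw [weight, sub_self, Real.rpow_zero, mul_one, mul_comm]
  have hG := (Real.Gamma_pos_of_pos ha).ne'
  have hz1 : z ^ a ≠ 0 := (Real.rpow_pos_of_pos hz _).ne'
  rw [scaledU, U_eq_integral_weight]
  simp only [h]
  rw [integral_rpow_mul_exp ha hz, Real.rpow_neg hz.le]
  field_simp

/-! ### The uniform expansion with the coefficients of the transformation -/

lemma sum_coeff_self {α : ℝ} (hα : 0 < α) (z : ℝ) (N : ℕ) :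
    ∑ n ∈ Finset.range (N + 1), (-1) ^ n * (coeff α α n / z ^ n) = 1 := by
  rw [Finset.sum_range_succ']
  simp [coeff_succ_self, coeff_zero_self hα]

lemma coeff_zero_eq_firstCoeff {α : ℝ} (hα : 0 < α) (β : ℝ) :
    coeff α β 0 = firstCoeff α β := by
  have hg := saddleG_pos hα β
  have hh := saddleH_pos hα β
  rcases eq_or_ne (1 - saddleH α β) 0 with h0 | h0
  · have h1 := saddleG_mul_saddleH hα β
    have h2 := saddleG_sub_saddleH α β
    have hβα : β = α := by
      have : saddleH α β = 1 := by linarith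
      rw [this] at h1 h2; linarith
    rw [hβα, coeff_zero_self hα, firstCoeff_self]
  · have := coeff_zero_eq (x := 1 - saddleH α β) (y := 1 + saddleG α β) (by linarith) h0
      (by linarith)
    rwa [alphaOf_saddle hα, betaOf_saddle] at this

/-- If `h = 1`, then `b = a` and the expansion is exact; otherwise `uniformCoeff_eq` replaces the
coefficients without touching the uniform error. -/
lemma exists_coeff_expansion (N : ℕ) {η : ℝ} (hη : 0 < η) (hη1 : η ≤ 1) :
    ∃ C > 0, ∀ a b z : ℝ, 0 < a → 1 ≤ z → η ≤ saddleH (a / z) (b / z) →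
      |scaledU a (b + 1) z - Real.exp (z * expA (a / z) (b / z)) *
          ∑ n ∈ Finset.range (N + 1), (-1) ^ n * (coeff (a / z) (b / z) n / z ^ n)| ≤
        C * Real.exp (z * expA (a / z) (b / z)) / z ^ (N + 1) := by
  obtain ⟨C, hC, h⟩ := exists_uniform_expansion N hη hη1
  refine ⟨C, hC, fun a b z ha hz hH => ?_⟩
  have hz0 : 0 < z := by linarith
  have hα : 0 < a / z := div_pos ha hz0
  have hg := saddleG_pos hα (b / z)
  have hh := saddleH_pos hα (b / z)
  rcases eq_or_ne (1 - saddleH (a / z) (b / z)) 0 with h0 | h0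
  · have h1 := saddleG_mul_saddleH hα (b / z)
    have h2 := saddleG_sub_saddleH (a / z) (b / z)
    have hba : b = a := by
      have h3 : saddleH (a / z) (b / z) = 1 := by linarith
      rw [h3] at h1 h2
      have : b / z = a / z := by linarith
      field_simp at this
      exact this
    rw [hba, scaledU_self ha hz0, expA_self, sum_coeff_self hα, mul_zero, Real.exp_zero, mul_one,
      sub_self, abs_zero]
    positivity
  · have h1 := h a b z ha hz hH
    have h2 : ∀ n ∈ Finset.range (N + 1), firstCoeff (a / z) (b / z) *
        (uniformCoeff N n (a / z) (b / z) / z ^ n) =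
        (-1) ^ n * (coeff (a / z) (b / z) n / z ^ n) := fun n hn => by
      have := uniformCoeff_eq (x := 1 - saddleH (a / z) (b / z))
        (y := 1 + saddleG (a / z) (b / z)) (by linarith) h0 (by linarith)
        (Nat.lt_succ_iff.1 (Finset.mem_range.1 hn))
      rw [alphaOf_saddle hα, betaOf_saddle] at this
      rw [← mul_div_assoc, this, mul_div_assoc]
    rwa [mul_assoc, Finset.mul_sum, Finset.sum_congr rfl h2] at h1

end KummerU

end

/-! ### The main theorem -/

theorem corollary2 (a₀ b₀ ρ : ℝ) (ha₀ : 0 < a₀) (hb₀ : 0 < b₀) (hρ₀ : 0 < ρ) (hρ₁ : ρ < 1)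
    (N : ℕ) :
    ∃ C > 0, ∃ z₀ > 0, ∀ z a b : ℝ, z₀ ≤ z →
      ((a₀ ≤ a ∧ a ≤ b ∧ KummerU.t0 (a / z) (b / z) ≤ ρ) ∨ (b₀ ≤ b ∧ b ≤ a)) →
      KummerU.coeff (a / z) (b / z) 0 = KummerU.firstCoeff (a / z) (b / z) ∧
      0 < KummerU.firstCoeff (a / z) (b / z) ∧
      |KummerU.U a (b + 1) z -
          Real.exp (z * KummerU.expA (a / z) (b / z)) * z ^ (-a) *
            ∑ n ∈ Finset.range (N + 1), (-1) ^ n * (KummerU.coeff (a / z) (b / z) n / z ^ n)|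
        ≤ C * (Real.exp (z * KummerU.expA (a / z) (b / z)) * z ^ (-a)) / z ^ (N + 1) ∧
      |KummerU.scaledU a (b + 1) z -
          Real.exp (z * KummerU.expA (a / z) (b / z)) * KummerU.firstCoeff (a / z) (b / z) *
            ∑ n ∈ Finset.range (N + 1), (-1) ^ n * (KummerU.normCoeff (a / z) (b / z) n / z ^ n)|
        ≤ C * (Real.exp (z * KummerU.expA (a / z) (b / z)) *
            KummerU.firstCoeff (a / z) (b / z)) / z ^ (N + 1) := by
  have hη : 0 < 1 - ρ := by linarith
  have hη1 : 1 - ρ ≤ 1 := by linarith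
  obtain ⟨C, hC, h⟩ := KummerU.exists_coeff_expansion N hη hη1
  -- Dividing by `1 - ρ` serves the second estimate, whose error carries `p_0 ≥ 1 - ρ`; the first
  -- holds already with `C`.
  refine ⟨C / (1 - ρ), by positivity, 1, one_pos, fun z a b hz hab => ?_⟩
  have hz0 : 0 < z := by linarith
  have ha : 0 < a := by
    rcases hab with h1 | h1 <;> linarith [h1.1, h1.2]
  have hb : 0 < b := by
    rcases hab with h1 | h1
    · linarith [h1.1, h1.2.1]
    · linarith [h1.1]
  have hα : 0 < a / z := div_pos ha hz0
  have hβ : 0 < b / z := div_pos hb hz0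
  -- For `b ≤ a` one has `μ ≤ 0`, hence `t₀ ≤ 0`. Both cases thus reduce to `h = 1 - t₀ ≥ 1 - ρ`.
  have ht : KummerU.t0 (a / z) (b / z) ≤ ρ := by
    rcases hab with h1 | h1
    · exact h1.2.2
    · refine (mul_nonpos_of_nonpos_of_nonneg ?_ ?_).trans hρ₀.le
      · rw [KummerU.mu, ← sub_div]
        exact div_nonpos_of_nonpos_of_nonneg (by linarith [h1.2]) hz0.le
      · exact div_nonneg zero_le_two (add_nonneg (by linarith) (Real.sqrt_nonneg _))
  have hH : 1 - ρ ≤ KummerU.saddleH (a / z) (b / z) := by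
    rw [KummerU.t0_saddle hα] at ht; linarith
  have hp := KummerU.firstCoeff_pos hα (b / z)
  have hp2 := KummerU.le_firstCoeff_sq hα hη1 hH
  have hpη : 1 - ρ ≤ KummerU.firstCoeff (a / z) (b / z) := by nlinarith
  have h0 := KummerU.coeff_zero_eq_firstCoeff hα (b / z)
  have h1 := h a b z ha hz hH
  set E := Real.exp (z * KummerU.expA (a / z) (b / z)) with hE
  have hE0 : 0 < E := Real.exp_pos _
  have hza : 0 < z ^ (-a) := Real.rpow_pos_of_pos hz0 _
  have hzN : 0 < z ^ (N + 1) := pow_pos hz0 _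
  have hU : KummerU.U a (b + 1) z = z ^ (-a) * KummerU.scaledU a (b + 1) z := by
    rw [KummerU.scaledU, ← mul_assoc, ← Real.rpow_add hz0, neg_add_cancel, Real.rpow_zero, one_mul]
  refine ⟨h0, hp, ?_, ?_⟩
  · rw [hU, mul_comm E, mul_assoc, ← mul_sub, abs_mul, abs_of_pos hza]
    calc _ ≤ z ^ (-a) * (C * E / z ^ (N + 1)) := mul_le_mul_of_nonneg_left h1 hza.le
      _ = C * (z ^ (-a) * E) / z ^ (N + 1) := by ring
      _ ≤ _ := by
        have : C ≤ C / (1 - ρ) := by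
          rw [le_div_iff₀ hη]; nlinarith
        gcongr
  · have hs : KummerU.firstCoeff (a / z) (b / z) * ∑ n ∈ Finset.range (N + 1),
        (-1) ^ n * (KummerU.normCoeff (a / z) (b / z) n / z ^ n) =
        ∑ n ∈ Finset.range (N + 1), (-1) ^ n * (KummerU.coeff (a / z) (b / z) n / z ^ n) := by
      rw [Finset.mul_sum]
      refine Finset.sum_congr rfl fun n _ => ?_
      rw [KummerU.normCoeff, h0]
      field_simp
    rw [mul_assoc, hs]
    refine h1.trans ?_
    have : C ≤ C / (1 - ρ) * KummerU.firstCoeff (a / z) (b / z) := by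
      rw [div_mul_eq_mul_div, le_div_iff₀ hη]
      exact mul_le_mul_of_nonneg_left hpη hC.le
    calc C * E / z ^ (N + 1)
        ≤ C / (1 - ρ) * KummerU.firstCoeff (a / z) (b / z) * E / z ^ (N + 1) := by gcongr
      _ = _ := by ring
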